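/- Let $k$ be an algebraically closed field of characteristic zero, let $V$ be a $k$-vector space of dimension $7$, and let $K\subset V$ be a linear subspace of dimension $3$. Let $\mathbf G=\mathbf G(2,V)\subset\mathbf P(\wedge^2V)$ be the Grassmannian of two-dimensional subspaces of $V$ in its Plücker embedding, with line bundle $\mathscr O_{\mathbf G}(-1)$ the restriction of $\mathscr O_{\mathbf P(\wedge^2 V)}(-1)$, let $T\subset V\otimes\mathscr O_{\mathbf G}$ be the tautological bundle of rank two, and let $A=\operatorname{Ann}K\subset V^*$. Let $S\subset\mathbf G$ be the Schubert cycle of the planes $P$ with $P\cap K\ne 0$, a closed subset with its reduced induced scheme structure. Then there are morphisms of $\mathscr O_{\mathbf G}$-modules that form an exact sequence $$0\to\wedge^4A\otimes\operatorname{Sym}^2(T)(-1)\to\wedge^3A\otimes T(-1)\to\wedge^2A\otimes\mathscr O_{\mathbf G}(-1)\to\mathscr O_{\mathbf G}\to\mathscr O_S\to 0,$$ whose last map $\mathscr O_{\mathbf G}\to\mathscr O_S$ is the canonical one. Moreover, this locally free resolution is locally the Eagon–Northcott complex of the generic $2\times4$ matrix: every point of $\mathbf G$ lies in an open subscheme $U\cong\mathbf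 A^{10}_k=\operatorname{Spec}R$, $R=k[a_{ij}: 1\le i\le2,\,1\le j\le5]$ (isomorphism over $k$), on which the complex formed by the first four terms is isomorphic, through the canonical identification in degree $0$, to the complex of sheaves associated with the Eagon–Northcott complex $$0\to\wedge^4F\otimes D_2(G^*)\to\wedge^3F\otimes G^*\to\wedge^2F\to R$$ of the matrix $(a_{ij})_{1\le i\le 2,\,1\le j\le4}:F=R^4\to G=R^2$, where $D_2$ is the second divided power and the last map sends $e_i\wedge e_j$ to the minor $a_{1i}a_{2j}-a_{1j}a_{2i}$. -/

import Mathlib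

open CategoryTheory AlgebraicGeometry TopologicalSpace Opposite
universe u
noncomputable section
namespace SchubertRes
section Ring
variable (k V : Type u) [Field k] [AddCommGroup V] [Module k V]

/-- The homogeneous coordinate ring of the Plücker image of `G(2, V)` in `ℙ(⋀²V)`, as an algebra of
functions: a polynomial function on `⋀²V`, restricted to the cone of decomposable bivectors, is the
function `(v₀, v₁) ↦ f(v₀ ∧ v₁)`; this algebra is generated by the alternating two-forms on `V`. -/
def pluckerSubalgebra : Subalgebra k ((Fin 2 → V) → k) :=
  Algebra.adjoin k (Set.range fun ω : V [⋀^Fin 2]→ₗ[k] k => (ω : (Fin 2 → V) → k))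

/-- The type of elements of `pluckerSubalgebra`. -/
def PluckerRing : Type u := pluckerSubalgebra k V

instance : CommRing (PluckerRing k V) := inferInstanceAs (CommRing (pluckerSubalgebra k V))
instance : Algebra k (PluckerRing k V) := inferInstanceAs (Algebra k (pluckerSubalgebra k V))

variable {k V} in
/-- An element of the coordinate ring as a function of `(v₀, v₁)`. -/
def PluckerRing.toFun : PluckerRing k V →ₐ[k] ((Fin 2 → V) → k) := (pluckerSubalgebra k V).val

lemma PluckerRing.toFun_injective :
    Function.Injective (PluckerRing.toFun (k := k) (V := V)) := Subtype.val_injective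

/-- Degree `n` part: forms of degree `n` in `v₀ ∧ v₁`, hence of degree `2n` in `(v₀, v₁)`. -/
def pluckerGrading (n : ℕ) : Submodule k (PluckerRing k V) where
  carrier := {f | ∀ (c : k) (v : Fin 2 → V), f.toFun (c • v) = c ^ (2 * n) * f.toFun v}
  add_mem' {f g} hf hg c v := by
    simp only [map_add, Pi.add_apply, hf c v, hg c v]; ring
  zero_mem' c v := by simp
  smul_mem' a f hf c v := by
    simp only [map_smul, Pi.smul_apply, hf c v, smul_eq_mul]; ring

instance : SetLike.GradedMonoid (pluckerGrading k V) where
  one_mem c v := by simp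
  mul_mem i j f g hf hg c v := by
    simp only [map_mul, Pi.mul_apply, hf c v, hg c v]; ring

lemma iSup_pluckerGrading : ⨆ n, pluckerGrading k V n = ⊤ := by
  have key : (⨆ n, pluckerGrading k V n) * (⨆ n, pluckerGrading k V n) ≤
      ⨆ n, pluckerGrading k V n := by
    simp only [Submodule.iSup_mul, Submodule.mul_iSup, iSup_le_iff]
    intro i j
    refine (Submodule.mul_le.2 fun a ha b hb => ?_).trans (le_iSup _ (j + i))
    exact SetLike.mul_mem_graded ha hb
  rw [eq_top_iff]
  rintro ⟨a, ha⟩ -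
  induction ha using Algebra.adjoin_induction with
  | mem x hx =>
    refine Submodule.mem_iSup_of_mem 1 ?_
    obtain ⟨ω, rfl⟩ := hx
    intro c v
    have := ω.toMultilinearMap.map_smul_univ (fun _ => c) v
    simp only [Fin.prod_univ_two, smul_eq_mul] at this
    refine this.trans ?_
    rw [mul_one, pow_two]
    rfl
  | algebraMap r =>
    refine Submodule.mem_iSup_of_mem 0 fun c v => ?_
    rw [mul_zero, pow_zero, one_mul]
    rfl
  | add x y hx hy h1 h2 => exact add_mem h1 h2
  | mul x y hx hy h1 h2 => exact key (Submodule.mul_mem_mul h1 h2)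

lemma isInternal_pluckerGrading [Infinite k] :
    DirectSum.IsInternal (pluckerGrading k V) := by
  classical
  constructor
  · rw [injective_iff_map_eq_zero]
    intro x hx
    refine DFinsupp.ext fun n => Subtype.ext (PluckerRing.toFun_injective k V (funext fun v => ?_))
    let P : Polynomial k :=
      ∑ m ∈ DFinsupp.support x, Polynomial.monomial (2 * m) ((x m).1.toFun v)
    have hP : P = 0 := by
      refine Polynomial.funext fun c => ?_
      have h1 : (DirectSum.coeAddMonoidHom (pluckerGrading k V) x).toFun (c • v) = 0 := by
        rw [hx]; simp
      rw [DirectSum.coeAddMonoidHom_eq_dfinsuppSum, DFinsupp.sum, map_sum, Finset.sum_apply] at h1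
      rw [Polynomial.eval_finsetSum, Polynomial.eval_zero, ← h1]
      refine Finset.sum_congr rfl fun m _ => ?_
      rw [Polynomial.eval_monomial, (x m).2 c v, mul_comm]
    have h2 := congrArg (fun p => Polynomial.coeff p (2 * n)) hP
    simp only [P, Polynomial.finsetSum_coeff, Polynomial.coeff_monomial, Polynomial.coeff_zero]
      at h2
    change (x n).1.toFun v = 0
    by_cases hn : n ∈ DFinsupp.support x
    · rw [Finset.sum_eq_single n] at h2
      · simpa using h2
      · intro m _ hm
        rw [if_neg]; omega
      · exact fun h => absurd hn h
    · have : x n = 0 := by simpa using hn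
      rw [this]; rfl
  · intro a
    have ha : a ∈ ⨆ n, pluckerGrading k V n := by
      rw [iSup_pluckerGrading]; trivial
    rw [Submodule.iSup_eq_range_dfinsupp_lsum] at ha
    obtain ⟨x, hx⟩ := ha
    exact ⟨x, hx⟩

instance [Infinite k] : GradedAlgebra (pluckerGrading k V) :=
  { (inferInstance : SetLike.GradedMonoid (pluckerGrading k V)) with
    toDecomposition := (isInternal_pluckerGrading k V).chooseDecomposition }

end Ring

section Tilde
variable {A : Type u} [CommRing A] {σ : Type*} [SetLike σ A] [AddSubgroupClass σ A]
  (𝒜 : ℕ → σ) [GradedRing 𝒜]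
  {M : Type u} [AddCommGroup M] [Module A M] (ℳ : ℕ → AddSubgroup M)

/-- The complement of the homogeneous prime ideal of a point of `Proj`. -/
abbrev projCompl (x : ProjectiveSpectrum 𝒜) : Submonoid A :=
  x.asHomogeneousIdeal.toIdeal.primeCompl

variable (M) in
/-- The localization of a module at the homogeneous prime ideal of a point of `Proj`. -/
abbrev ProjStalk (x : ProjectiveSpectrum 𝒜) : Type u := LocalizedModule (projCompl 𝒜 x) M

/-- The value of a regular function at a point, in the localization of the graded ring. -/
def projEval {U : (Proj 𝒜).Opens} (x : U) :
    Γ(Proj 𝒜, U) →+* Localization (projCompl 𝒜 x.1) :=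
  (algebraMap (HomogeneousLocalization 𝒜 (projCompl 𝒜 x.1)) (Localization (projCompl 𝒜 x.1))).comp
    (openToLocalization 𝒜 U x.1 x.2).hom

/-- A family of germs that is one fraction `m / a` with `m` and `a` homogeneous of equal degree. -/
def ProjIsFraction {U : (Proj 𝒜).Opens} (s : ∀ x : U, ProjStalk 𝒜 M x.1) : Prop :=
  ∃ (i : ℕ) (m : M) (a : A), m ∈ ℳ i ∧ a ∈ 𝒜 i ∧
    ∀ x : U, ∃ ha : a ∈ projCompl 𝒜 x.1,
      s x = LocalizedModule.mk m ⟨a, ha⟩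

/-- Being a fraction of equal degrees, as a prelocal predicate. -/
def projIsFractionPrelocal : TopCat.PrelocalPredicate (X := (Proj 𝒜).toTopCat) (ProjStalk 𝒜 M) where
  pred s := ProjIsFraction 𝒜 ℳ s
  res := by
    rintro V U i f ⟨n, m, a, hm, ha, h⟩
    exact ⟨n, m, a, hm, ha, fun x => h (i x)⟩

/-- Being locally a fraction of equal degrees. -/
def projIsLocallyFraction : TopCat.LocalPredicate (X := (Proj 𝒜).toTopCat) (ProjStalk 𝒜 M) :=
  (projIsFractionPrelocal 𝒜 ℳ).sheafify

variable [SetLike.GradedSMul 𝒜 ℳ]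

lemma projIsLocallyFraction_smul {U : (Proj 𝒜).Opens} (r : Γ(Proj 𝒜, U))
    {s : ∀ x : U, ProjStalk 𝒜 M x.1} (hs : (projIsLocallyFraction 𝒜 ℳ).pred s) :
    (projIsLocallyFraction 𝒜 ℳ).pred fun x => projEval 𝒜 x r • s x := by
  intro x
  obtain ⟨W, hxW, iW, n, m, a, hm, ha, hW⟩ := hs x
  obtain ⟨W', hxW', iW', j, ⟨b, hb⟩, ⟨c, hc⟩, hcn, hW'⟩ := r.2 x
  refine ⟨W ⊓ W', ⟨hxW, hxW'⟩, Opens.infLELeft _ _ ≫ iW, j + n, b • m, c * a,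
    SetLike.GradedSMul.smul_mem hb hm, SetLike.mul_mem_graded hc ha, fun y => ?_⟩
  obtain ⟨hay, hsy⟩ := hW ⟨y.1, y.2.1⟩
  have hcy : c ∈ projCompl 𝒜 y.1 := hcn ⟨y.1, y.2.2⟩
  refine ⟨mul_mem hcy hay, ?_⟩
  have hr : projEval 𝒜 (iW ⟨y.1, y.2.1⟩) r = Localization.mk b ⟨c, hcy⟩ :=
    (congrArg HomogeneousLocalization.val (hW' ⟨y.1, y.2.2⟩)).trans
      (HomogeneousLocalization.val_mk _)
  refine (congrArg₂ (· • ·) hr hsy).trans ?_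
  exact LocalizedModule.mk_smul_mk _ _ _ _

/-- Sections over `U` of the sheaf associated with a graded module. -/
def projSections (U : (Proj 𝒜).Opens) : AddSubgroup (∀ x : U, ProjStalk 𝒜 M x.1) where
  carrier := {s | (projIsLocallyFraction 𝒜 ℳ).pred s}
  add_mem' {s t} hs ht x := by
    obtain ⟨W, hxW, iW, n, m, a, hm, ha, hW⟩ := hs x
    obtain ⟨W', hxW', iW', n', m', a', hm', ha', hW'⟩ := ht x
    refine ⟨W ⊓ W', ⟨hxW, hxW'⟩, Opens.infLELeft _ _ ≫ iW, n + n', a' • m + a • m', a * a',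
      add_mem ?_ (SetLike.GradedSMul.smul_mem ha hm'), SetLike.mul_mem_graded ha ha',
      fun y => ?_⟩
    · rw [add_comm n n']
      exact SetLike.GradedSMul.smul_mem ha' hm
    · obtain ⟨hay, hsy⟩ := hW ⟨y.1, y.2.1⟩
      obtain ⟨hay', hsy'⟩ := hW' ⟨y.1, y.2.2⟩
      refine ⟨mul_mem hay hay', ?_⟩
      exact (congrArg₂ (· + ·) hsy hsy').trans LocalizedModule.mk_add_mk
  zero_mem' x := ⟨U, x.2, 𝟙 _, 0, 0, 1, zero_mem _, SetLike.GradedOne.one_mem, fun y =>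
    ⟨one_mem _, (LocalizedModule.zero_mk _).symm⟩⟩
  neg_mem' {s} hs x := by
    obtain ⟨W, hxW, iW, n, m, a, hm, ha, hW⟩ := hs x
    refine ⟨W, hxW, iW, n, -m, a, neg_mem hm, ha, fun y => ?_⟩
    obtain ⟨hay, hsy⟩ := hW y
    exact ⟨hay, (congrArg (- ·) hsy).trans LocalizedModule.mk_neg.symm⟩

instance (U : (Proj 𝒜).Opens) : Module Γ(Proj 𝒜, U) (projSections 𝒜 ℳ U) where
  smul r s := ⟨fun x => projEval 𝒜 x r • s.1 x, projIsLocallyFraction_smul 𝒜 ℳ r s.2⟩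
  one_smul s := Subtype.ext <| funext fun x => by
    change projEval 𝒜 x 1 • s.1 x = s.1 x
    rw [map_one, one_smul]
  mul_smul a b s := Subtype.ext <| funext fun x => by
    change projEval 𝒜 x (a * b) • s.1 x = projEval 𝒜 x a • projEval 𝒜 x b • s.1 x
    rw [map_mul, mul_smul]
  smul_zero a := Subtype.ext <| funext fun x => by
    change projEval 𝒜 x a • (0 : ProjStalk 𝒜 M x.1) = 0
    rw [smul_zero]
  smul_add a s t := Subtype.ext <| funext fun x => by
    change projEval 𝒜 x a • (s.1 x + t.1 x) = projEval 𝒜 x a • s.1 x + projEval 𝒜 x a • t.1 x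
    rw [smul_add]
  add_smul a b s := Subtype.ext <| funext fun x => by
    change projEval 𝒜 x (a + b) • s.1 x = projEval 𝒜 x a • s.1 x + projEval 𝒜 x b • s.1 x
    rw [map_add, add_smul]
  zero_smul s := Subtype.ext <| funext fun x => by
    change projEval 𝒜 x 0 • s.1 x = 0
    rw [map_zero, zero_smul]

/-- The presheaf of groups of sections. -/
def projSectionsPresheaf : TopCat.Presheaf Ab.{u} (Proj 𝒜).toTopCat where
  obj U := .of (projSections 𝒜 ℳ U.unop)
  map {U W} i := AddCommGrpCat.ofHom
    { toFun := fun s => ⟨fun x => s.1 (i.unop x), (projIsLocallyFraction 𝒜 ℳ).res i.unop s.1 s.2⟩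
      map_zero' := rfl
      map_add' := fun _ _ => rfl }

instance (U : ((Proj 𝒜).Opens)ᵒᵖ) : Module ((Proj 𝒜).ringCatSheaf.obj.obj U)
    ((projSectionsPresheaf 𝒜 ℳ).obj U) :=
  inferInstanceAs (Module Γ(Proj 𝒜, U.unop) (projSections 𝒜 ℳ U.unop))

/-- The sheaf of modules on `Proj 𝒜` associated with the graded module `⨁ ℳ i`. -/
def projTilde : (Proj 𝒜).Modules where
  val := PresheafOfModules.ofPresheaf (R := (Proj 𝒜).ringCatSheaf.obj)
    (projSectionsPresheaf 𝒜 ℳ) (fun _ _ _ _ _ => rfl)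
  isSheaf := (TopCat.Presheaf.isSheaf_iff_isSheaf_comp (forget AddCommGrpCat) _).2
    (TopCat.subsheafToTypes (projIsLocallyFraction 𝒜 ℳ)).2

end Tilde

section Modules

/-- Tensor product of sheaves of modules: the sheaf associated with `U ↦ M(U) ⊗ N(U)`. -/
def tensorObj {X : Scheme.{u}} (M N : X.Modules) : X.Modules :=
  (PresheafOfModules.sheafification (𝟙 X.ringCatSheaf.obj)).obj
    (PresheafOfModules.Monoidal.tensorObj (R := X.presheaf) M.val N.val)

/-- The presheaf `U ↦ Sym² P(U)`, i.e. `P(U) ⊗ P(U)` modulo all `a ⊗ b - b ⊗ a`. -/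
def presheafSym2 {X : Scheme.{u}}
    (P : PresheafOfModules.{u} (X.presheaf ⋙ forget₂ CommRingCat RingCat)) :
    PresheafOfModules.{u} (X.presheaf ⋙ forget₂ CommRingCat RingCat) :=
  Limits.cokernel (𝟙 (MonoidalCategory.tensorObj P P) - (BraidedCategory.braiding P P).hom)

/-- The second symmetric power of a sheaf of modules. -/
def sym2 {X : Scheme.{u}} (M : X.Modules) : X.Modules :=
  (PresheafOfModules.sheafification (𝟙 X.ringCatSheaf.obj)).obj (presheafSym2 M.val)

/-- The structure sheaf as a module over itself. -/
def structureSheafModule (X : Scheme.{u}) : X.Modules := SheafOfModules.unit X.ringCatSheaf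

/-- The canonical map `𝒪_Y → f_* 𝒪_X`. -/
def toPushforward {X Y : Scheme.{u}} (f : X ⟶ Y) :
    structureSheafModule Y ⟶ (Scheme.Modules.pushforward f).obj (structureSheafModule X) :=
  SheafOfModules.unitToPushforwardObjUnit f.toRingCatSheafHom

end Modules

section Bundles
variable (k V : Type u) [Field k] [AddCommGroup V] [Module k V]

/-- The Grassmannian `G(2, V)`, in its Plücker embedding. -/
abbrev Gr [Infinite k] : Scheme.{u} := Proj (pluckerGrading k V)

/-- The structure morphism of the Grassmannian. -/
def Gr.toSpec [Infinite k] : Gr k V ⟶ Spec (.of k) :=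
  Proj.toSpecZero (pluckerGrading k V) ≫
    Spec.map (CommRingCat.ofHom (algebraMap k (pluckerGrading k V 0)))

/-- The shifted grading: degree `i` part of `A(n)` is `A_{i+n}`. -/
def twistGrading (n : ℤ) (i : ℕ) : AddSubgroup (PluckerRing k V) :=
  if 0 ≤ (i : ℤ) + n then (pluckerGrading k V ((i : ℤ) + n).toNat).toAddSubgroup else ⊥

instance (n : ℤ) : SetLike.GradedSMul (pluckerGrading k V) (twistGrading k V n) where
  smul_mem {i j a b} ha hb := by
    unfold twistGrading at hb ⊢
    split_ifs at hb with h
    · have h' : 0 ≤ ((i +ᵥ j : ℕ) : ℤ) + n := by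
        change 0 ≤ ((i + j : ℕ) : ℤ) + n
        omega
      rw [if_pos h']
      have e : (((i +ᵥ j : ℕ) : ℤ) + n).toNat = i + ((j : ℤ) + n).toNat := by
        change (((i + j : ℕ) : ℤ) + n).toNat = _
        omega
      rw [e]
      exact SetLike.mul_mem_graded ha hb
    · rw [AddSubgroup.mem_bot] at hb
      subst hb
      rw [smul_zero]
      exact zero_mem _

/-- The line bundle `𝒪_G(n)` of the Plücker embedding. -/
def Gr.twist [Infinite k] (n : ℤ) : (Gr k V).Modules :=
  projTilde (pluckerGrading k V) (twistGrading k V n)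

variable (W : Type u) [AddCommGroup W] [Module k W]

/-- `W`-valued functions of `(v₀, v₁)` all of whose coordinates lie in the coordinate ring `A`
(for `W` of finite dimension this is `A ⊗ W`). -/
def polyMapSubmodule : Submodule k ((Fin 2 → V) → W) where
  carrier := {f | ∀ ξ : Module.Dual k W, (fun v => ξ (f v)) ∈ pluckerSubalgebra k V}
  add_mem' {f g} hf hg ξ := by
    simpa only [Pi.add_apply, map_add] using! add_mem (hf ξ) (hg ξ)
  zero_mem' ξ := by
    simpa only [Pi.zero_apply, map_zero] using! zero_mem (pluckerSubalgebra k V)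
  smul_mem' a f hf ξ := by
    simpa only [Pi.smul_apply, map_smul] using! Subalgebra.smul_mem _ (hf ξ) a

/-- The type of elements of `polyMapSubmodule`, a module over the coordinate ring. -/
def PolyMap : Type u := polyMapSubmodule k V W

instance : AddCommGroup (PolyMap k V W) := inferInstanceAs (AddCommGroup (polyMapSubmodule k V W))

variable {k V W} in
/-- An element of `PolyMap` as a function. -/
def PolyMap.toFun : PolyMap k V W →+ ((Fin 2 → V) → W) :=
  (polyMapSubmodule k V W).subtype.toAddMonoidHom

variable {k V W} in
lemma PolyMap.ext {f g : PolyMap k V W} (h : ∀ v, f.toFun v = g.toFun v) : f = g :=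
  Subtype.ext (funext h)

instance : Module (PluckerRing k V) (PolyMap k V W) where
  smul a f := ⟨fun v => a.toFun v • f.toFun v, fun ξ => by
    simpa only [map_smul] using! mul_mem a.2 (f.2 ξ)⟩
  one_smul f := PolyMap.ext fun v => by
    change PluckerRing.toFun (1 : PluckerRing k V) v • f.toFun v = _
    simp
  mul_smul a b f := PolyMap.ext fun v => by
    change PluckerRing.toFun (a * b) v • f.toFun v = a.toFun v • b.toFun v • f.toFun v
    simp [mul_smul]
  smul_zero a := PolyMap.ext fun v => by
    change a.toFun v • PolyMap.toFun (0 : PolyMap k V W) v = _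
    simp
  smul_add a f g := PolyMap.ext fun v => by
    change a.toFun v • (f + g).toFun v = a.toFun v • f.toFun v + a.toFun v • g.toFun v
    simp
  add_smul a b f := PolyMap.ext fun v => by
    change (a + b).toFun v • f.toFun v = a.toFun v • f.toFun v + b.toFun v • f.toFun v
    simp [add_smul]
  zero_smul f := PolyMap.ext fun v => by
    change PluckerRing.toFun (0 : PluckerRing k V) v • f.toFun v =
      PolyMap.toFun (0 : PolyMap k V W) v
    simp

variable {k V W} in
lemma PolyMap.smul_toFun (a : PluckerRing k V) (f : PolyMap k V W) (v : Fin 2 → V) :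
    (a • f).toFun v = a.toFun v • f.toFun v := rfl

/-- The grading of `A ⊗ W` by the grading of `A`. -/
def polyMapGrading (n : ℕ) : AddSubgroup (PolyMap k V W) where
  carrier := {f | ∀ (c : k) (v : Fin 2 → V), f.toFun (c • v) = c ^ (2 * n) • f.toFun v}
  add_mem' {f g} hf hg c v := by simp only [map_add, Pi.add_apply, hf c v, hg c v, smul_add]
  zero_mem' c v := by simp
  neg_mem' {f} hf c v := by simp only [map_neg, Pi.neg_apply, hf c v, smul_neg]

instance : SetLike.GradedSMul (pluckerGrading k V) (polyMapGrading k V W) where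
  smul_mem {i j a f} ha hf c v := by
    rw [PolyMap.smul_toFun, PolyMap.smul_toFun, ha c v, hf c v, smul_smul, smul_smul]
    congr 1
    change _ = c ^ (2 * (i + j)) * _
    ring

/-- The trivial bundle `W ⊗ 𝒪_G` on the Grassmannian, for `W` of finite dimension. -/
def Gr.trivialBundle [Infinite k] : (Gr k V).Modules :=
  projTilde (pluckerGrading k V) (polyMapGrading k V W)

/-- The `V`-valued polynomial maps whose value at `(v₀, v₁)` lies in the span of `v₀, v₁`. -/
def tautModule : Submodule (PluckerRing k V) (PolyMap k V V) where
  carrier := {f | ∀ v : Fin 2 → V, f.toFun v ∈ Submodule.span k (Set.range v)}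
  add_mem' {f g} hf hg v := by
    rw [map_add]
    exact add_mem (hf v) (hg v)
  zero_mem' v := by
    rw [map_zero]
    exact zero_mem _
  smul_mem' a f hf v := Submodule.smul_mem _ _ (hf v)

/-- The grading of `tautModule`. -/
def tautGrading (n : ℕ) : AddSubgroup (tautModule k V) :=
  (polyMapGrading k V V n).comap (tautModule k V).subtype.toAddMonoidHom

instance : SetLike.GradedSMul (pluckerGrading k V) (tautGrading k V) where
  smul_mem {i j _ _} ha hf :=
    SetLike.GradedSMul.smul_mem (A := pluckerGrading k V) (B := polyMapGrading k V V)
      (i := i) (j := j) ha hf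

/-- The tautological rank two subbundle `T ⊆ V ⊗ 𝒪_G`: its sections are the regular `V`-valued
functions whose value at a plane `P` lies in `P`. -/
def Gr.tautologicalBundle [Infinite k] : (Gr k V).Modules :=
  projTilde (pluckerGrading k V) (tautGrading k V)

end Bundles

section Schubert
variable {k V : Type u} [Field k] [AddCommGroup V] [Module k V]

/-- `x` is the closed point of the Grassmannian given by the plane `P`: its homogeneous ideal consists
of the functions vanishing at `v₀ ∧ v₁` for all `v₀, v₁ ∈ P`. -/
def Gr.IsPoint [Infinite k] (x : Gr k V) (P : Submodule k V) : Prop :=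
  Module.finrank k P = 2 ∧ ∀ f : PluckerRing k V,
    f ∈ ProjectiveSpectrum.asHomogeneousIdeal x ↔
      ∀ v : Fin 2 → V, (∀ i, v i ∈ P) → f.toFun v = 0

/-- The closed points of the Grassmannian whose plane meets `K` non-trivially. -/
def schubertLocus [Infinite k] (K : Submodule k V) : Set (Gr k V) :=
  {x | ∃ P : Submodule k V, Gr.IsPoint x P ∧ P ⊓ K ≠ ⊥}

/-- The ideal sheaf of the reduced closed subscheme with these closed points. -/
def schubertIdeal [Infinite k] (K : Submodule k V) : (Gr k V).IdealSheafData :=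
  Scheme.IdealSheafData.vanishingIdeal (.closure (schubertLocus K))

/-- The Schubert cycle `S`, with its reduced induced scheme structure. -/
def schubertCycle [Infinite k] (K : Submodule k V) : Scheme.{u} := (schubertIdeal K).subscheme

/-- The closed immersion of `S` in the Grassmannian. -/
def schubertι [Infinite k] (K : Submodule k V) : schubertCycle K ⟶ Gr k V :=
  (schubertIdeal K).subschemeι

end Schubert

section EagonNorthcott
variable {R : Type u} [CommRing R] {F : Type u} [AddCommGroup F] [Module R F]

lemma contractLeft_mem (d : Module.Dual R F) (n : ℕ) (z : ExteriorAlgebra R F)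
    (hz : z ∈ ⋀[R]^(n + 1) F) : CliffordAlgebra.contractLeft d z ∈ ⋀[R]^n F := by
  induction n generalizing z with
  | zero =>
    rw [zero_add, ExteriorAlgebra.exteriorPower, pow_one] at hz
    obtain ⟨y, rfl⟩ := hz
    rw [ExteriorAlgebra.exteriorPower, pow_zero]
    exact Submodule.mem_one.2 ⟨d y, (CliffordAlgebra.contractLeft_ι (0 : QuadraticForm R F) d y).symm⟩
  | succ n ih =>
    rw [ExteriorAlgebra.exteriorPower, pow_succ'] at hz
    induction hz using Submodule.mul_induction_on' with
    | mem_mul_mem a ha b hb =>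
      obtain ⟨y, rfl⟩ := ha
      have := CliffordAlgebra.contractLeft_ι_mul (Q := (0 : QuadraticForm R F)) (d := d) y b
      refine (congrArg (· ∈ ⋀[R]^(n + 1) F) this).mpr ?_
      refine sub_mem (Submodule.smul_mem _ _ hb) ?_
      rw [ExteriorAlgebra.exteriorPower, pow_succ']
      exact Submodule.mul_mem_mul ⟨y, rfl⟩ (ih b hb)
    | add a _ b _ ha hb =>
      rw [map_add]
      exact add_mem ha hb

/-- Contraction `⋀^{n+1} F → ⋀^n F` by a linear form on `F`. -/
def contraction (d : Module.Dual R F) (n : ℕ) : ⋀[R]^(n + 1) F →ₗ[R] ⋀[R]^n F :=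
  (CliffordAlgebra.contractLeft (Q := (0 : QuadraticForm R F)) d).restrict
    (contractLeft_mem d n)

/-- The differentials `⋀^{p+1} F ⊗ D_{m+1}(G*) → ⋀^p F ⊗ D_m(G*)` of the Eagon–Northcott complex of
`(r 0, r 1) : F → G = R²`. In `Fin (m + 2) → ⋀^{p+1} F`, the entry `i` is the coefficient of the
divided monomial `ε₀^(m+1-i) ε₁^(i)` in the dual basis of `G*`. -/
def enMap (r : Fin 2 → Module.Dual R F) (p m : ℕ) :
    (Fin (m + 2) → ⋀[R]^(p + 1) F) →ₗ[R] (Fin (m + 1) → ⋀[R]^p F) :=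
  LinearMap.pi fun j =>
    contraction (r 0) p ∘ₗ LinearMap.proj j.castSucc + contraction (r 1) p ∘ₗ LinearMap.proj j.succ

/-- The last differential `⋀²F → ⋀²G = R` of the Eagon–Northcott complex, which sends `x ∧ y` to the
minor `r₀(x) r₁(y) - r₀(y) r₁(x)`. -/
def enMinors (r : Fin 2 → Module.Dual R F) : (Fin 1 → ⋀[R]^2 F) →ₗ[R] R :=
  (exteriorPower.zeroEquiv R F).toLinearMap ∘ₗ contraction (r 1) 0 ∘ₗ contraction (r 0) 1 ∘ₗ
    LinearMap.proj 0

/-- The two components of the linear map `R⁴ → R²` of a `2 × 4` matrix. -/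
def rowForms (a : Matrix (Fin 2) (Fin 4) R) (i : Fin 2) : Module.Dual R (Fin 4 → R) :=
  LinearMap.proj i ∘ₗ a.mulVecLin

end EagonNorthcott

section Terms
variable {k V : Type u} [Field k] [Infinite k] [AddCommGroup V] [Module k V] (K : Submodule k V)

/-- The trivial bundle `⋀^i A` on the Grassmannian, where `A = Ann K ⊆ V*`. -/
abbrev Gr.extAnn (i : ℕ) : (Gr k V).Modules := Gr.trivialBundle k V (⋀[k]^i K.dualAnnihilator)

/-- `⋀²A ⊗ 𝒪(-1)`. -/
def resTerm1 : (Gr k V).Modules := tensorObj (Gr.extAnn K 2) (Gr.twist k V (-1))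
/-- `⋀³A ⊗ T(-1)`. -/
def resTerm2 : (Gr k V).Modules :=
  tensorObj (Gr.extAnn K 3) (tensorObj (Gr.tautologicalBundle k V) (Gr.twist k V (-1)))
/-- `⋀⁴A ⊗ Sym²T(-1)`. -/
def resTerm3 : (Gr k V).Modules :=
  tensorObj (Gr.extAnn K 4) (tensorObj (sym2 (Gr.tautologicalBundle k V)) (Gr.twist k V (-1)))

/-- The polynomial ring in the entries `a_{ij}` of a `2 × 5` matrix. -/
abbrev ChartRing (k : Type u) [Field k] : CommRingCat.{u} := .of (MvPolynomial (Fin 2 × Fin 5) k)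

/-- The generic `2 × 4` matrix `(a_{ij})`, formed by the first four columns. -/
def chartForms (k : Type u) [Field k] : Fin 2 → Module.Dual (ChartRing k) (Fin 4 → ChartRing k) :=
  rowForms (Matrix.of fun i j => MvPolynomial.X (i, j.castSucc))

/-- The term `⋀⁴F ⊗ D₂(G*)` of the Eagon–Northcott complex of the generic `2 × 4` matrix. -/
def en3 (k : Type u) [Field k] : ModuleCat.{u} (ChartRing k) :=
  .of _ (Fin 3 → ⋀[ChartRing k]^4 (Fin 4 → ChartRing k))
/-- The term `⋀³F ⊗ D₁(G*)`. -/
def en2 (k : Type u) [Field k] : ModuleCat.{u} (ChartRing k) :=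
  .of _ (Fin 2 → ⋀[ChartRing k]^3 (Fin 4 → ChartRing k))
/-- The term `⋀²F`. -/
def en1 (k : Type u) [Field k] : ModuleCat.{u} (ChartRing k) :=
  .of _ (Fin 1 → ⋀[ChartRing k]^2 (Fin 4 → ChartRing k))
/-- The differential `⋀⁴F ⊗ D₂(G*) → ⋀³F ⊗ D₁(G*)`. -/
def enD3 (k : Type u) [Field k] : en3 k ⟶ en2 k := ModuleCat.ofHom (enMap (chartForms k) 3 1)
/-- The differential `⋀³F ⊗ D₁(G*) → ⋀²F`. -/
def enD2 (k : Type u) [Field k] : en2 k ⟶ en1 k := ModuleCat.ofHom (enMap (chartForms k) 2 0)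
/-- The differential `⋀²F → R` given by the maximal minors. -/
def enD1 (k : Type u) [Field k] : en1 k ⟶ ModuleCat.of (ChartRing k) (ChartRing k) :=
  ModuleCat.ofHom (enMinors (chartForms k))

/-- The canonical isomorphism `𝒪_Y|_X ≅ 𝒪_X` for an open immersion `X → Y`. -/
def restrictStructureSheafIso {X Y : Scheme.{u}} (f : X ⟶ Y) [IsOpenImmersion f] :
  (structureSheafModule Y).restrict f ≅ structureSheafModule X := Scheme.Modules.restrictUnitIso f

end Terms

end SchubertRes

end

open SchubertRes

/-! A plane `P` meets `K` exactly when `P → V/K` fails to be injective. Since `A = (V/K)*`, the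
inclusion `T ⊆ V ⊗ 𝒪` gives a map `A ⊗ 𝒪 → T*`, locally a 2 × 4 matrix, and `S` is the locus where
its rank is at most one. The complex is the Eagon–Northcott complex of this map, with `⋀²T = 𝒪(-1)`.
Around every point of the Grassmannian there is a standard affine chart in which the four equations
of `K`, evaluated on the basis of the universal plane, are eight of the ten affine coordinates
(`exists_chart_basis`, `awayToPoly_bijective`). There the matrix is generic, the fifth column plays
no part, and everything becomes commutative algebra over a polynomial ring.

Global maps. The terms are sheafified tensor products, so the differentials are handled through
their composites with functionals. Each term carries globally defined functionals to `𝒪`, made from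
a linear form on `⋀^i A`, linear forms on `V`, and a two-form read as a map `𝒪(-1) → 𝒪`. On each
chart some of them are the dual basis of a local basis (`Frame`), so together they separate
sections. The composite of a differential with such a functional is given by one global formula,
contraction with the canonical element of `A* ⊗ A` (`diffFunctional₂`, `diffFunctional₃`). The local
Eagon–Northcott differentials satisfy this formula (`resForm₁_enMap`, `resForm₂_enMap`), hence agree
on overlaps and glue (`exists_glued_hom`). The map to `𝒪` is itself a sum of functionals, `diff₁`.

Algebra of the generic matrix with rows `x`, `y`. Injectivity on the left is Cramer's rule. At `⋀³`
the kernel consists of pairs with `x ∧ u + y ∧ v = 0`; Cramer's rule solves this with a minor as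
denominator, and the denominator cancels because the minor is prime and does not divide another
minor (`exists_of_wedge_eq_zero`). At `⋀²`, once `x₀` is inverted the three minors that involve
column 0 become independent variables and the relation becomes a Koszul relation; powers of `x₀` are
then removed by reduction modulo `x₀`, which uses the previous step (`isWedgeSum_of_sum_minor`,
`isWedgeSum_of_mul`).

Cokernel. As `S` is reduced, the functions vanishing at the closed points of the Schubert locus in a
chart must be shown to form the ideal of minors. This is the Segre parametrization of matrices of
rank at most one, whose kernel is spanned by binomials (`mem_minorIdeal`,
`forall_chart_mem_schubertLocus_iff`). -/

noncomputable section

namespace SchubertRes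

/-! ### Functionals on sheaves of modules and locality of sections -/

section Sheaf
variable {X : Scheme.{u}} {M N : X.Modules}

/-- The action of a functional `M ⟶ 𝒪_X` on sections. -/
def ev (φ : M ⟶ structureSheafModule X) (U : X.Opens) : Γ(M, U) →ₗ[Γ(X, U)] Γ(X, U) where
  toFun s := φ.app U s
  map_add' s t := map_add (φ.app U).hom s t
  map_smul' r s := φ.app_smul r s

/-- Restriction of sections. -/
def res (M : X.Modules) {U V : X.Opens} (h : V ≤ U) : Γ(M, U) →+ Γ(M, V) :=
  (M.presheaf.map (homOfLE h).op).hom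

lemma app_res (φ : M ⟶ N) {U V : X.Opens} (h : V ≤ U) (s : Γ(M, U)) :
    φ.app V (res M h s) = res N h (φ.app U s) :=
  congr($(φ.mapPresheaf.naturality (homOfLE h).op) s)

lemma ev_res (φ : M ⟶ structureSheafModule X) {U V : X.Opens} (h : V ≤ U) (s : Γ(M, U)) :
    ev φ V (res M h s) = X.presheaf.map (homOfLE h).op (ev φ U s) :=
  app_res φ h s

lemma ev_ext {φ ψ : M ⟶ structureSheafModule X} (h : ∀ U s, ev φ U s = ev ψ U s) : φ = ψ := by
  ext U s
  exact h U s

/-- Sections that agree locally are equal. -/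
lemma eq_of_locally_eq {U : X.Opens} {s t : Γ(M, U)}
    (h : ∀ x ∈ U, ∃ (V : X.Opens) (hV : V ≤ U), x ∈ V ∧ res M hV s = res M hV t) : s = t := by
  choose! V hV hx he using h
  refine TopCat.Sheaf.eq_of_locally_eq' ⟨_, M.isSheaf⟩ (fun x : U => V x) U
    (fun x => homOfLE (hV x x.2)) ?_ s t fun x => he x x.2
  intro x hxU
  exact Opens.mem_iSup.2 ⟨⟨x, hxU⟩, hx x hxU⟩

/-- Make a functional from compatible linear maps on sections. -/
def mkFunctional (f : ∀ U : X.Opens, Γ(M, U) →ₗ[Γ(X, U)] Γ(X, U))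
    (hf : ∀ (U V : X.Opens) (h : V ≤ U) (s : Γ(M, U)),
      f V (res M h s) = X.presheaf.map (homOfLE h).op (f U s)) : M ⟶ structureSheafModule X :=
  ⟨⟨fun U => ModuleCat.ofHom (f U.unop), fun {U V} i => by
    ext s
    exact hf U.unop V.unop (leOfHom i.unop) s⟩⟩

end Sheaf

/-! ### Sheafification of presheaves of modules -/

section Sheafify
variable {X : Scheme.{u}} (P : X.PresheafOfModules)

instance (U : X.Opens) : Module Γ(X, U) (P.obj (op U)) := (P.obj (op U)).isModule

/-- The sheaf associated with a presheaf of modules. -/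
abbrev shf : X.Modules := (PresheafOfModules.sheafification (𝟙 X.ringCatSheaf.obj)).obj P

/-- The canonical map to sections of the associated sheaf. -/
def toShf (U : X.Opens) : P.obj (op U) →ₗ[Γ(X, U)] Γ(shf P, U) :=
  (((PresheafOfModules.sheafificationAdjunction (𝟙 X.ringCatSheaf.obj)).unit.app P).app (op U)).hom

lemma exists_toShf_eq {U : X.Opens} (s : Γ(shf P, U)) (x : X) (hx : x ∈ U) :
    ∃ (V : X.Opens) (h : V ≤ U) (t : P.obj (op V)), x ∈ V ∧ toShf P V t = res (shf P) h s := by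
  have : Presheaf.IsLocallySurjective (Opens.grothendieckTopology X)
    (CategoryTheory.toSheafify (Opens.grothendieckTopology X) P.presheaf) := inferInstance
  obtain ⟨V, f, ⟨t, ht⟩, hxV⟩ := this.imageSieve_mem s x hx
  exact ⟨V, leOfHom f, t, hxV, ht⟩

variable {P} in
/-- A morphism to the structure sheaf from compatible linear maps. -/
def preHom (f : ∀ U : X.Opens, P.obj (op U) →ₗ[Γ(X, U)] Γ(X, U))
    (hf : ∀ (U V : X.Opens) (h : V ≤ U) (s : P.obj (op U)),
      f V (P.map (homOfLE h).op s) = X.presheaf.map (homOfLE h).op (f U s)) :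
    P ⟶ (structureSheafModule X).val :=
  ⟨fun U => ModuleCat.ofHom (f U.unop), fun {U V} i => by
    ext s
    exact hf U.unop V.unop (leOfHom i.unop) s⟩

variable {P} in
/-- Functionals on the associated sheaf. -/
def shfFunctional (f : ∀ U : X.Opens, P.obj (op U) →ₗ[Γ(X, U)] Γ(X, U))
    (hf : ∀ (U V : X.Opens) (h : V ≤ U) (s : P.obj (op U)),
      f V (P.map (homOfLE h).op s) = X.presheaf.map (homOfLE h).op (f U s)) :
    shf P ⟶ structureSheafModule X :=
  (PresheafOfModules.sheafificationHomEquiv (𝟙 X.ringCatSheaf.obj)).symm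
    ⟨fun U => ModuleCat.ofHom (f U.unop), fun {U V} i => by
    ext s
    exact hf U.unop V.unop (leOfHom i.unop) s⟩

variable {P} in
lemma ev_shfFunctional (f : ∀ U : X.Opens, P.obj (op U) →ₗ[Γ(X, U)] Γ(X, U)) (hf) (U) (s) :
    ev (shfFunctional f hf) U (toShf P U s) = f U s := by
  have := (PresheafOfModules.sheafificationHomEquiv (𝟙 X.ringCatSheaf.obj)).apply_symm_apply
    (show P ⟶ (PresheafOfModules.restrictScalars (𝟙 X.ringCatSheaf.obj)).obj
      ((SheafOfModules.forget X.ringCatSheaf).obj (structureSheafModule X)) from 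
      ⟨fun U => ModuleCat.ofHom (f U.unop), fun {U V} i => by
    ext s
    exact hf U.unop V.unop (leOfHom i.unop) s⟩)
  exact congr((($this).app (op U)).hom s)
end Sheafify
-- Tensor products and their functionals
section Tensor
open scoped TensorProduct
variable {X : Scheme.{u}} {M N : X.Modules}

/-- The presheaf tensor product. -/
abbrev preTensor (M N : X.Modules) : X.PresheafOfModules :=
  PresheafOfModules.Monoidal.tensorObj (R := X.presheaf) M.val N.val

variable (M N) in
/-- Restriction of presheaf tensors. -/
def preTensorRes {U V : X.Opens} (h : V ≤ U) :
    Γ(M, U) ⊗[Γ(X, U)] Γ(N, U) →+ Γ(M, V) ⊗[Γ(X, V)] Γ(N, V) :=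
  ((preTensor M N).map (homOfLE h).op).hom.toAddMonoidHom

variable (M N) in
/-- Sections of the tensor product from presheaf tensors. -/
def toTensor (U : X.Opens) :
    Γ(M, U) ⊗[Γ(X, U)] Γ(N, U) →ₗ[Γ(X, U)] Γ(tensorObj M N, U) :=
  toShf (preTensor M N) U

lemma exists_toTensor_eq {U : X.Opens} (s : Γ(tensorObj M N, U)) (x : X) (hx : x ∈ U) :
    ∃ (V : X.Opens) (h : V ≤ U) (t : Γ(M, V) ⊗[Γ(X, V)] Γ(N, V)), x ∈ V ∧
      toTensor M N V t = res (tensorObj M N) h s :=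
  exists_toShf_eq (preTensor M N) s x hx

/-- The section `s ⊗ t`. -/
def tm {U : X.Opens} (s : Γ(M, U)) (t : Γ(N, U)) : Γ(tensorObj M N, U) :=
  toTensor M N U (s ⊗ₜ[Γ(X, U)] t)

/-- The bilinear form `s ⊗ t ↦ φ s * ψ t`. -/
def preTensorFunctional (φ : M ⟶ structureSheafModule X) (ψ : N ⟶ structureSheafModule X)
    (U : X.Opens) : Γ(M, U) ⊗[Γ(X, U)] Γ(N, U) →ₗ[Γ(X, U)] Γ(X, U) :=
  TensorProduct.lift ((LinearMap.mul Γ(X, U) Γ(X, U)).compl₁₂ (ev φ U) (ev ψ U))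

lemma preTensorFunctional_tmul (φ : M ⟶ structureSheafModule X) (ψ : N ⟶ structureSheafModule X)
    {U : X.Opens} (s : Γ(M, U)) (t : Γ(N, U)) :
    preTensorFunctional φ ψ U (s ⊗ₜ t) = ev φ U s * ev ψ U t := by
  simp [preTensorFunctional]

lemma preTensorFunctional_res (φ : M ⟶ structureSheafModule X) (ψ : N ⟶ structureSheafModule X)
    {U V : X.Opens} (h : V ≤ U) (s : Γ(M, U) ⊗[Γ(X, U)] Γ(N, U)) :
    preTensorFunctional φ ψ V (preTensorRes M N h s) =
      X.presheaf.map (homOfLE h).op (preTensorFunctional φ ψ U s) := by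
  have : (preTensorFunctional φ ψ V).toAddMonoidHom.comp (preTensorRes M N h) =
      (X.presheaf.map (homOfLE h).op).hom.toAddMonoidHom.comp
        (preTensorFunctional φ ψ U).toAddMonoidHom := by
    ext s
    induction s using TensorProduct.induction_on with
    | zero => rw [map_zero, map_zero]
    | add s t hs ht => rw [map_add, map_add, hs, ht]
    | tmul s t =>
    change preTensorFunctional φ ψ V (res M h s ⊗ₜ res N h t) =
      X.presheaf.map (homOfLE h).op (preTensorFunctional φ ψ U (s ⊗ₜ t))
    rw [preTensorFunctional_tmul, preTensorFunctional_tmul, ev_res, ev_res, map_mul]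
  exact congr($this s)

/-- The functional `s ⊗ t ↦ φ s * ψ t` on a tensor product. -/
def tensorFunctional (φ : M ⟶ structureSheafModule X) (ψ : N ⟶ structureSheafModule X) :
    tensorObj M N ⟶ structureSheafModule X :=
  shfFunctional (P := preTensor M N) (preTensorFunctional φ ψ)
    fun _ _ h s => preTensorFunctional_res φ ψ h s

lemma ev_tensorFunctional (φ : M ⟶ structureSheafModule X) (ψ : N ⟶ structureSheafModule X)
    {U : X.Opens} (s : Γ(M, U) ⊗[Γ(X, U)] Γ(N, U)) :
    ev (tensorFunctional φ ψ) U (toTensor M N U s) = preTensorFunctional φ ψ U s :=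
  ev_shfFunctional _ _ _ _

lemma ev_tensorFunctional_tm (φ : M ⟶ structureSheafModule X) (ψ : N ⟶ structureSheafModule X)
    {U : X.Opens} (s : Γ(M, U)) (t : Γ(N, U)) :
    ev (tensorFunctional φ ψ) U (tm s t) = ev φ U s * ev ψ U t := by
  rw [tm, ev_tensorFunctional, preTensorFunctional_tmul]
end Tensor

/-! ### Symmetric squares and their functionals -/

section Sym
open scoped TensorProduct

section
variable {X : Scheme.{u}} (P : PresheafOfModules.{u} (X.presheaf ⋙ forget₂ CommRingCat RingCat))

/-- The projection of the presheaf tensor square to the presheaf symmetric square. -/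
def symProj : PresheafOfModules.Monoidal.tensorObj P P ⟶ presheafSym2 P :=
  Limits.cokernel.π (𝟙 (MonoidalCategory.tensorObj P P) - (BraidedCategory.braiding P P).hom)

instance : Epi (symProj P) := inferInstanceAs (Epi (Limits.cokernel.π _))

lemma symProj_surjective (U : X.Opens) :
    Function.Surjective ((symProj P).app (op U)) :=
  fun y => (PresheafOfModules.epi_iff_surjective (symProj P)).1 inferInstance y

lemma swap_comp_symProj : symProj P = (BraidedCategory.braiding P P).hom ≫ symProj P := by
  have := Limits.cokernel.condition
    (𝟙 (MonoidalCategory.tensorObj P P) - (BraidedCategory.braiding P P).hom)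
  rwa [Preadditive.sub_comp, sub_eq_zero, Category.id_comp] at this

/-- Descent of morphisms to the presheaf symmetric square. -/
def symDesc {Q : PresheafOfModules.{u} (X.presheaf ⋙ forget₂ CommRingCat RingCat)}
    (f : PresheafOfModules.Monoidal.tensorObj P P ⟶ Q)
    (hf : f = (BraidedCategory.braiding P P).hom ≫ f) : presheafSym2 P ⟶ Q :=
  Limits.cokernel.desc _ f (by rw [Preadditive.sub_comp, sub_eq_zero, Category.id_comp]; exact hf)

lemma symProj_symDesc {Q : PresheafOfModules.{u} (X.presheaf ⋙ forget₂ CommRingCat RingCat)}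
    (f : PresheafOfModules.Monoidal.tensorObj P P ⟶ Q)
    (hf : f = (BraidedCategory.braiding P P).hom ≫ f) : symProj P ≫ symDesc P f hf = f :=
  Limits.cokernel.π_desc _ _ _
end
variable {X : Scheme.{u}} {M : X.Modules}

variable (M) in
/-- The projection `M ⊗ M → Sym² M` on presheaf sections. -/
def preSymProj (U : X.Opens) :
    Γ(M, U) ⊗[Γ(X, U)] Γ(M, U) →ₗ[Γ(X, U)] (presheafSym2 M.val).obj (op U) :=
  ((symProj (X := X) M.val).app (op U)).hom

lemma preSymProj_surjective (U : X.Opens) : Function.Surjective (preSymProj M U) := by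
  exact symProj_surjective (X := X) M.val U

lemma preSymProj_comm {U : X.Opens} (s t : Γ(M, U)) :
    preSymProj M U (s ⊗ₜ t) = preSymProj M U (t ⊗ₜ s) := by
  have := swap_comp_symProj (X := X) M.val
  exact congr((($this).app (op U)).hom (s ⊗ₜ[Γ(X, U)] t))

variable (M) in
/-- Sections of the symmetric square from presheaf tensors. -/
def toSym (U : X.Opens) :
    Γ(M, U) ⊗[Γ(X, U)] Γ(M, U) →ₗ[Γ(X, U)] Γ(sym2 M, U) :=
  toShf (presheafSym2 M.val) U ∘ₗ preSymProj M U

lemma exists_toSym_eq {U : X.Opens} (s : Γ(sym2 M, U)) (x : X) (hx : x ∈ U) :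
    ∃ (V : X.Opens) (h : V ≤ U) (t : Γ(M, V) ⊗[Γ(X, V)] Γ(M, V)), x ∈ V ∧
      toSym M V t = res (sym2 M) h s := by
  obtain ⟨V, h, t, hV, ht⟩ := exists_toShf_eq (presheafSym2 M.val) s x hx
  obtain ⟨t, rfl⟩ := preSymProj_surjective V t
  exact ⟨V, h, t, hV, ht⟩

lemma toSym_comm {U : X.Opens} (s t : Γ(M, U)) : toSym M U (s ⊗ₜ t) = toSym M U (t ⊗ₜ s) :=
  congrArg (toShf (presheafSym2 M.val) U) (preSymProj_comm s t)

/-- The product `s t` in the symmetric square. -/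
def sm {U : X.Opens} (s t : Γ(M, U)) : Γ(sym2 M, U) := toSym M U (s ⊗ₜ t)

/-- The symmetrised bilinear form of two functionals, as a morphism of presheaves. -/
def preSymHom (φ ψ : M ⟶ structureSheafModule X) :
    preTensor M M ⟶ (structureSheafModule X).val :=
  preHom (P := preTensor M M)
    (fun U => preTensorFunctional φ ψ U + preTensorFunctional ψ φ U) fun _ _ h s =>
      (congrArg₂ (· + ·) (preTensorFunctional_res φ ψ h s)
        (preTensorFunctional_res ψ φ h s)).trans (map_add (X.presheaf.map (homOfLE h).op).hom _
            _).symm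

lemma preSymFunctional_comm (φ ψ : M ⟶ structureSheafModule X) {U : X.Opens}
    (s : Γ(M, U) ⊗[Γ(X, U)] Γ(M, U)) :
    (preTensorFunctional φ ψ U + preTensorFunctional ψ φ U) s =
      (preTensorFunctional φ ψ U + preTensorFunctional ψ φ U) (TensorProduct.comm _ _ _ s) := by
  induction s using TensorProduct.induction_on with
  | zero => simp
  | add s t hs ht => rw [map_add, map_add, map_add, hs, ht]
  | tmul s t =>
    simp only [LinearMap.add_apply, TensorProduct.comm_tmul, preTensorFunctional_tmul]
    ring

/-- The functional `s t ↦ φ s * ψ t + φ t * ψ s` on a symmetric square. -/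
def symFunctional (φ ψ : M ⟶ structureSheafModule X) : sym2 M ⟶ structureSheafModule X :=
  (PresheafOfModules.sheafificationHomEquiv (𝟙 X.ringCatSheaf.obj)).symm
    (symDesc (X := X) M.val (preSymHom φ ψ) (by
      ext U s
      exact preSymFunctional_comm φ ψ s))

lemma ev_symFunctional (φ ψ : M ⟶ structureSheafModule X) {U : X.Opens}
    (s : Γ(M, U) ⊗[Γ(X, U)] Γ(M, U)) :
    ev (symFunctional φ ψ) U (toSym M U s) =
      preTensorFunctional φ ψ U s + preTensorFunctional ψ φ U s := by
  have hc : preSymHom φ ψ = (BraidedCategory.braiding (C := PresheafOfModules.{u} (X.presheaf ⋙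
      forget₂ CommRingCat RingCat)) M.val M.val).hom ≫ preSymHom φ ψ := by
      ext U s
      exact preSymFunctional_comm φ ψ s
  have := (PresheafOfModules.sheafificationHomEquiv (𝟙 X.ringCatSheaf.obj)).apply_symm_apply
    (show presheafSym2 M.val ⟶ (PresheafOfModules.restrictScalars (𝟙 X.ringCatSheaf.obj)).obj
      ((SheafOfModules.forget X.ringCatSheaf).obj (structureSheafModule X)) from
        symDesc (X := X) M.val (preSymHom φ ψ) hc)
  have h1 := congr((($this).app (op U)).hom (preSymProj M U s))
  have h2 := congr((($(symProj_symDesc (X := X) M.val (preSymHom φ ψ) hc)).app (op U)).hom s)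
  exact h1.trans h2

lemma ev_symFunctional_sm (φ ψ : M ⟶ structureSheafModule X) {U : X.Opens} (s t : Γ(M, U)) :
    ev (symFunctional φ ψ) U (sm s t) = ev φ U s * ev ψ U t + ev ψ U s * ev φ U t := by
  rw [sm, ev_symFunctional, preTensorFunctional_tmul, preTensorFunctional_tmul]
end Sym

/-! ### Morphisms out of the sheaf of a module on an affine scheme -/

section TildeHom
variable {R : CommRingCat.{u}} {N N' : ModuleCat.{u} R} {M : (Spec R).Modules}

variable (N) in
/-- The canonical map from a module to the sections of the associated sheaf. -/
def toTilde (U : (Spec R).Opens) : N →ₗ[R] Γ(tilde N, U) := (tilde.toOpen N U).hom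

lemma tildeMap_app_toTilde (f : N ⟶ N') (U : (Spec R).Opens) (n : N) :
    (tilde.map f).app U (toTilde N U n) = toTilde N' U (f n) :=
  congr($(tilde.toOpen_map_app f U).hom n)

variable (N M) in
/-- The correspondence between morphisms out of `tilde N` and linear maps to global sections. -/
def tildeHomEquiv : (tilde N ⟶ M) ≃ (N ⟶ moduleSpecΓFunctor.obj M) :=
  tilde.adjunction.homEquiv N M

lemma tildeHomEquiv_apply (g : tilde N ⟶ M) (n : N) :
    (tildeHomEquiv N M g).hom n = g.app ⊤ (toTilde N ⊤ n) :=
  congr(($(tilde.adjunction.homEquiv_unit (X := N) (Y := M) (f := g))).hom n)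

/-- Maps out of `tilde N` are adjoint to linear maps into global sections, so the images of elements
of `N` over `⊤` determine them. -/
lemma tildeHom_ext {g h : tilde N ⟶ M}
    (H : ∀ n, g.app ⊤ (toTilde N ⊤ n) = h.app ⊤ (toTilde N ⊤ n)) : g = h := by
  apply (tildeHomEquiv N M).injective
  ext n
  rw [tildeHomEquiv_apply, tildeHomEquiv_apply, H]

lemma exists_tildeHom (ψ : N →ₗ[R] Γ(M, ⊤)) :
    ∃ g : tilde N ⟶ M, ∀ n, g.app ⊤ (toTilde N ⊤ n) = ψ n := by
  let f : N ⟶ moduleSpecΓFunctor.obj M :=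
    ModuleCat.ofHom (X := N) (Y := (moduleSpecΓFunctor.obj M : ModuleCat R)) ψ
  refine ⟨(tildeHomEquiv N M).symm f, fun n => ?_⟩
  rw [← tildeHomEquiv_apply, Equiv.apply_symm_apply]
  rfl

lemma hom_app_smul {M' : (Spec R).Modules} (g : M ⟶ M') (U : (Spec R).Opens) (r : R) (s : Γ(M, U)) :
    g.app U (r • s) = r • g.app U s := g.app_smul _ s

end TildeHom
-- Functionals read on an affine chart
section Chart
variable {R : CommRingCat.{u}} {X : Scheme.{u}} (j : Spec R ⟶ X) [IsOpenImmersion j]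
  {M : X.Modules}

/-- The coordinate ring of a chart. -/
def chartRingIso : Γ(X, j ''ᵁ ⊤) ≃+* R :=
  (j.appIso ⊤ ≪≫ Scheme.ΓSpecIso R).commRingCatIsoToRingEquiv

/-- The functional induced on a chart. -/
def chartFunctional (Φ : M ⟶ structureSheafModule X) :
    M.restrict j ⟶ tilde (ModuleCat.of R R) :=
  (Scheme.Modules.restrictFunctor j).map Φ ≫ (restrictStructureSheafIso j).hom ≫ tildeSelf.inv

lemma toTilde_self (U : (Spec R).Opens) (r : R) :
    toTilde (ModuleCat.of R R) U r = ((Spec R).presheaf.map U.leTop.op) ((Scheme.ΓSpecIso R).inv r)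
        :=
  rfl

lemma chartFunctional_app (Φ : M ⟶ structureSheafModule X) (W : (Spec R).Opens)
    (s : Γ(M, j ''ᵁ W)) :
    (chartFunctional j Φ).app W s = (j.appIso W).hom (ev Φ _ s) := rfl

lemma chartFunctional_app_top (Φ : M ⟶ structureSheafModule X) (s : Γ(M, j ''ᵁ ⊤)) :
    (chartFunctional j Φ).app ⊤ s = toTilde (ModuleCat.of R R) ⊤ (chartRingIso j (ev Φ _ s)) := by
  rw [chartFunctional_app, toTilde_self]
  have h : (Spec R).presheaf.map (Opens.leTop ⊤ : (⊤ : (Spec R).Opens) ⟶ ⊤).op = 𝟙 _ :=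
    (Spec R).presheaf.map_id _
  refine Eq.trans ?_ congr($h _).symm
  exact ((Scheme.ΓSpecIso R).hom_inv_id_apply _).symm

lemma ev_eq_zero_of_chartFunctional (Φ : M ⟶ structureSheafModule X) (W : (Spec R).Opens)
    (s : Γ(M, j ''ᵁ W)) (h : (chartFunctional j Φ).app W s = 0) : ev Φ _ s = 0 := by
  rw [chartFunctional_app] at h
  exact (map_eq_zero_iff _ (j.appIso W).commRingCatIsoToRingEquiv.injective).1 h
end Chart

/-! ### Local bases with globally defined dual functionals -/

section Frame
variable {X : Scheme.{u}}

/-- A basis of a sheaf of modules over an open set whose dual basis is formed by functionals that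
are defined everywhere. -/
structure Frame (M : X.Modules) (D : X.Opens) (I : Type*) [Fintype I] [DecidableEq I] where
  /-- The basis. -/
  b : I → Γ(M, D)
  /-- The dual basis. -/
  dual : I → (M ⟶ structureSheafModule X)
  ev_dual : ∀ i j, ev (dual i) D (b j) = if i = j then 1 else 0
  inj : ∀ (U : X.Opens), U ≤ D → ∀ s : Γ(M, U), (∀ i, ev (dual i) U s = 0) → s = 0

namespace Frame
variable {M N : X.Modules} {D : X.Opens} {I J : Type*} [Fintype I] [DecidableEq I]
  [Fintype J] [DecidableEq J]

lemma ev_dual_res (P : Frame M D I) {U : X.Opens} (h : U ≤ D) (i j : I) :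
    ev (P.dual i) U (res M h (P.b j)) = if i = j then 1 else 0 := by
  rw [ev_res, P.ev_dual]
  split_ifs <;> simp

lemma expand (P : Frame M D I) {U : X.Opens} (h : U ≤ D) (s : Γ(M, U)) :
    s = ∑ i, ev (P.dual i) U s • res M h (P.b i) := by
  rw [← sub_eq_zero]
  refine P.inj U h _ fun i => ?_
  simp only [map_sub, map_sum, map_smul, ev_dual_res, smul_eq_mul, mul_ite, mul_one, mul_zero,
    Finset.sum_ite_eq, Finset.mem_univ, if_true, sub_self]

/-- Restriction of a frame. -/
def restrict (P : Frame M D I) {U : X.Opens} (h : U ≤ D) : Frame M U I where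
  b i := res M h (P.b i)
  dual := P.dual
  ev_dual := P.ev_dual_res h
  inj V hV := P.inj V (hV.trans h)

/-- The frame of a tensor product. -/
def tensor (P : Frame M D I) (Q : Frame N D J) : Frame (tensorObj M N) D (I × J) where
  b p := tm (P.b p.1) (Q.b p.2)
  dual p := tensorFunctional (P.dual p.1) (Q.dual p.2)
  ev_dual p q := by
    rw [ev_tensorFunctional_tm, P.ev_dual, Q.ev_dual]
    by_cases h1 : p.1 = q.1 <;> by_cases h2 : p.2 = q.2 <;> simp [h1, h2, Prod.ext_iff]
  inj U hU s hs := by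
    refine eq_of_locally_eq fun x hx => ?_
    obtain ⟨V, hV, t, hxV, ht⟩ := exists_toTensor_eq s x hx
    refine ⟨V, hV, hxV, ?_⟩
    -- Locally the section comes from a presheaf tensor, which expands in products of the two bases
    -- with the product functionals as coefficients; these are the functionals assumed to vanish.
    have hexp : t = ∑ p : I × J, preTensorFunctional (P.dual p.1) (Q.dual p.2) V t •
        (res M (hV.trans hU) (P.b p.1) ⊗ₜ[Γ(X, V)] res N (hV.trans hU) (Q.b p.2)) := by
      clear ht
      induction t using TensorProduct.induction_on with
      | zero => simp
      | add s t hs ht =>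
        simp only [map_add, add_smul, Finset.sum_add_distrib]
        rw [← hs, ← ht]
      | tmul s t =>
        conv_lhs => rw [P.expand (hV.trans hU) s, Q.expand (hV.trans hU) t]
        rw [TensorProduct.sum_tmul, Fintype.sum_prod_type]
        refine Finset.sum_congr rfl fun i _ => ?_
        rw [TensorProduct.tmul_sum]
        refine Finset.sum_congr rfl fun j _ => ?_
        rw [TensorProduct.smul_tmul_smul, preTensorFunctional_tmul]
    have h0 : t = 0 := by
      rw [hexp]
      refine Finset.sum_eq_zero fun p _ => ?_
      rw [← ev_tensorFunctional, ht, ev_res, hs, map_zero, zero_smul]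
    rw [← ht, h0, map_zero, map_zero]

/-- The frame of the symmetric square of a sheaf of rank two, with basis the divided monomials. -/
def sym2 (P : Frame M D (Fin 2)) (c : Γ(X, D)) (hc : 2 * c = 1) :
    Frame (sym2 M) D (Fin 3) where
  -- `symFunctional φ φ` takes the value 2 on the square of a vector where `φ` is 1, whence the
  -- factor `c = 1/2` on the two squares.
  b := ![c • sm (P.b 0) (P.b 0), sm (P.b 0) (P.b 1), c • sm (P.b 1) (P.b 1)]
  dual := ![symFunctional (P.dual 0) (P.dual 0), symFunctional (P.dual 0) (P.dual 1),
    symFunctional (P.dual 1) (P.dual 1)]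
  ev_dual i j := by
    have hc' : c * (1 + 1) = 1 := by linear_combination hc
    fin_cases i <;> fin_cases j <;>
      simp [ev_symFunctional_sm, P.ev_dual, hc']
  inj U hU s hs := by
    refine eq_of_locally_eq fun x hx => ?_
    obtain ⟨V, hV, t, hxV, ht⟩ := exists_toSym_eq s x hx
    refine ⟨V, hV, hxV, ?_⟩
    set p := fun i => res M (hV.trans hU) (P.b i)
    set d := X.presheaf.map (homOfLE (hV.trans hU)).op c with hd
    have hd2 : (1 + 1) * d = 1 := by
      have := congrArg (X.presheaf.map (homOfLE (hV.trans hU)).op) hc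
      rw [map_mul, map_one, ← hd, map_ofNat] at this
      linear_combination this
    have key : toSym M V t =
        (ev (symFunctional (P.dual 0) (P.dual 0)) V (toSym M V t) * d) • sm (p 0) (p 0) +
        ev (symFunctional (P.dual 0) (P.dual 1)) V (toSym M V t) • sm (p 0) (p 1) +
        (ev (symFunctional (P.dual 1) (P.dual 1)) V (toSym M V t) * d) • sm (p 1) (p 1) := by
      clear ht
      induction t using TensorProduct.induction_on with
      | zero => simp
      | add s t hs ht =>
        conv_lhs => rw [map_add, hs, ht]
        simp only [map_add, add_mul, add_smul]
        abel
      | tmul s t =>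
        change sm s t = (ev _ V (sm s t) * d) • _ + ev _ V (sm s t) • _ + (ev _ V (sm s t) * d) • _
        simp only [ev_symFunctional_sm]
        set s0 := ev (P.dual 0) V s
        set s1 := ev (P.dual 1) V s
        set t0 := ev (P.dual 0) V t
        set t1 := ev (P.dual 1) V t
        have e0 : (s0 * t0 + s0 * t0) * d = s0 * t0 := by linear_combination s0 * t0 * hd2
        have e1 : (s1 * t1 + s1 * t1) * d = s1 * t1 := by linear_combination s1 * t1 * hd2
        rw [e0, e1]
        have hs : s = s0 • p 0 + s1 • p 1 := by
          rw [P.expand (hV.trans hU) s, Fin.sum_univ_two]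
        have ht : t = t0 • p 0 + t1 • p 1 := by
          rw [P.expand (hV.trans hU) t, Fin.sum_univ_two]
        rw [hs, ht]
        simp only [sm, TensorProduct.add_tmul, TensorProduct.tmul_add, TensorProduct.smul_tmul_smul,
          map_add, map_smul]
        rw [toSym_comm (p 1) (p 0)]
        module
    rw [← ht, key, ht, map_zero]
    simp only [ev_res]
    have h0 := hs 0
    have h1 := hs 1
    have h2 := hs 2
    simp only [Matrix.cons_val_zero, Matrix.cons_val_one, Matrix.cons_val] at h0 h1 h2
    rw [h0, h1, h2]
    simp

end Frame
end Frame

/-! ### Monomorphisms, epimorphisms and exactness tested on sections -/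

section Exact
variable {X : Scheme.{u}} {M N : X.Modules}

lemma mono_of_app_injective (d : M ⟶ N) (h : ∀ U s, d.app U s = 0 → s = 0) : Mono d where
  right_cancellation {Z} f g hfg := by
    ext U s
    rw [← sub_eq_zero]
    apply h
    rw [map_sub, sub_eq_zero]
    exact congr(Scheme.Modules.Hom.app $hfg U s)

lemma app_injective_of_mono (d : M ⟶ N) [Mono d] (U : X.Opens) : Function.Injective (d.app U) := by
  have : Mono ((Scheme.Modules.toPresheaf X).map d) := inferInstance
  have : Mono (((Scheme.Modules.toPresheaf X).map d).app (op U)) :=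
    (NatTrans.mono_iff_mono_app _).1 this (op U)
  exact (AddCommGrpCat.mono_iff_injective _).1 this

lemma epi_of_locally_surjective (d : M ⟶ N)
    (h : ∀ (U : X.Opens) (s : Γ(N, U)), ∀ x ∈ U, ∃ (V : X.Opens) (hV : V ≤ U) (t : Γ(M, V)),
      x ∈ V ∧ d.app V t = res N hV s) : Epi d where
  left_cancellation {Z} f g hfg := by
    ext U s
    refine eq_of_locally_eq fun x hx => ?_
    obtain ⟨V, hV, t, hxV, ht⟩ := h U s x hx
    refine ⟨V, hV, hxV, ?_⟩
    rw [← app_res, ← app_res, ← ht]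
    exact congr(Scheme.Modules.Hom.app $hfg V t)

/-- Exactness means that the map into the kernel is an epimorphism, which local lifts detect. The
kernel inclusion is injective on sections, so it is enough to lift inside `S.X₂`. -/
lemma exact_of_locally_exact (S : ShortComplex X.Modules)
    (h : ∀ (U : X.Opens) (s : Γ(S.X₂, U)), S.g.app U s = 0 → ∀ x ∈ U,
      ∃ (V : X.Opens) (hV : V ≤ U) (t : Γ(S.X₁, V)), x ∈ V ∧ S.f.app V t = res S.X₂ hV s) :
    S.Exact := by
  rw [S.exact_iff_epi_kernel_lift]
  refine epi_of_locally_surjective _ fun U s x hx => ?_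
  obtain ⟨V, hV, t, hxV, ht⟩ := h U ((Limits.kernel.ι S.g).app U s)
    congr(Scheme.Modules.Hom.app $(Limits.kernel.condition S.g) U s) x hx
  refine ⟨V, hV, t, hxV, app_injective_of_mono (Limits.kernel.ι S.g) V ?_⟩
  rw [app_res, ← ht]
  exact congr(Scheme.Modules.Hom.app $(Limits.kernel.lift_ι S.g S.f S.zero) V t)

end Exact

/-! ### A frame trivializes a sheaf on a chart -/

section ChartIso
variable {R : CommRingCat.{u}} {X : Scheme.{u}} (j : Spec R ⟶ X) [IsOpenImmersion j]
  {M : X.Modules} {I : Type*} [Fintype I] [DecidableEq I] (P : Frame M (j ''ᵁ ⊤) I)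
  {N : ModuleCat.{u} R} (n : Module.Basis I R N)

/-- The linear form on the module of a chart that corresponds to a functional. -/
def chartForm (Φ : M ⟶ structureSheafModule X) : N →ₗ[R] R :=
  n.constr R fun i => chartRingIso j (ev Φ _ (P.b i))

lemma chartForm_basis (Φ : M ⟶ structureSheafModule X) (i : I) :
    chartForm j P n Φ (n i) = chartRingIso j (ev Φ _ (P.b i)) :=
  n.constr_basis _ _ _

lemma chartForm_sum {ι : Type*} (s : Finset ι) (Φ : ι → (M ⟶ structureSheafModule X)) :
    chartForm j P n (∑ a ∈ s, Φ a) = ∑ a ∈ s, chartForm j P n (Φ a) := by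
  refine n.ext fun i => ?_
  let f : (M ⟶ structureSheafModule X) →+ R :=
    { toFun := fun Ψ => chartRingIso j (ev Ψ _ (P.b i))
      map_zero' := map_zero _
      map_add' := fun Ψ Ψ' => map_add (chartRingIso j) (ev Ψ _ (P.b i)) (ev Ψ' _ (P.b i)) }
  rw [chartForm_basis, LinearMap.sum_apply]
  simp only [chartForm_basis]
  exact map_sum f Φ s

lemma chartForm_dual (i : I) : chartForm j P n (P.dual i) = n.coord i := by
  refine n.ext fun k => ?_
  rw [chartForm_basis, P.ev_dual, n.coord_apply, n.repr_self, Finsupp.single_apply]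
  simp only [eq_comm (a := i)]
  split_ifs <;> simp

lemma tildeMap_sum {R : CommRingCat.{u}} {N N' : ModuleCat.{u} R} {I : Type*} (s : Finset I)
    (f : I → (N ⟶ N')) :
    tilde.map (∑ i ∈ s, f i) = ∑ i ∈ s, tilde.map (f i) :=
  map_sum ((tilde.functor R).mapAddHom (X := N) (Y := N')) f s

/-- A frame over a chart identifies the sheaf with the sheaf associated with a free module. -/
lemma exists_chartIso : ∃ e : M.restrict j ≅ tilde N, ∀ Φ : M ⟶ structureSheafModule X,
    chartFunctional j Φ = e.hom ≫ tilde.map (ModuleCat.ofHom (chartForm j P n Φ)) := by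
  obtain ⟨g, hg⟩ := exists_tildeHom (N := N) (M := M.restrict j)
    (n.constr R fun i => (P.b i : Γ(M.restrict j, ⊤)))
  have h1 (Φ : M ⟶ structureSheafModule X) : g ≫ chartFunctional j Φ =
      tilde.map (ModuleCat.ofHom (chartForm j P n Φ)) := by
    refine tildeHom_ext fun m => ?_
    rw [tildeMap_app_toTilde]
    change (chartFunctional j Φ).app ⊤ (g.app ⊤ (toTilde N ⊤ m)) = toTilde _ ⊤ (chartForm j P n Φ m)
    rw [hg]
    rw [← n.sum_repr m]
    simp only [map_sum, map_smul, hom_app_smul, chartForm_basis]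
    exact Finset.sum_congr rfl fun i _ =>
      congrArg (n.repr m i • ·) ((congrArg ((chartFunctional j Φ).app ⊤)
        (n.constr_basis R _ i)).trans (chartFunctional_app_top j Φ (P.b i)))
  -- The inverse of `g` is the sum of the dual functionals, each followed by the inclusion of the
  -- line spanned by its basis vector.
  let a (i : I) : ModuleCat.of R R ⟶ N := ModuleCat.ofHom (LinearMap.toSpanSingleton R N (n i))
  let f : M.restrict j ⟶ tilde N := ∑ i, chartFunctional j (P.dual i) ≫ tilde.map (a i)
  have h2 : g ≫ f = 𝟙 _ := by
    rw [Preadditive.comp_sum]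
    simp only [← Category.assoc, h1, ← tilde.map_comp]
    rw [← tildeMap_sum, ← tilde.map_id]
    congr 1
    ext m
    simp only [a, ← ModuleCat.ofHom_comp, chartForm_dual]
    rw [ModuleCat.hom_sum]
    simp [LinearMap.sum_apply, n.sum_repr]
  -- The dual functionals separate sections, so this identity may be checked after composing with
  -- each of them.
  have h3 : f ≫ g = 𝟙 _ := by
    ext W s
    rw [← sub_eq_zero]
    refine P.inj (j ''ᵁ W) (j.image_mono le_top) _ fun i => ?_
    refine ev_eq_zero_of_chartFunctional j _ W _ ?_
    rw [map_sub, sub_eq_zero]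
    have h4 : (f ≫ g) ≫ chartFunctional j (P.dual i) = chartFunctional j (P.dual i) := by
      rw [Category.assoc, h1, Preadditive.sum_comp]
      simp only [Category.assoc, ← tilde.map_comp]
      rw [Finset.sum_eq_single i]
      · have : a i ≫ ModuleCat.ofHom (chartForm j P n (P.dual i)) = 𝟙 _ := by
          ext
          simp [a, chartForm_dual]
        rw [this, tilde.map_id, Category.comp_id]
      · intro k _ hk
        have : a k ≫ ModuleCat.ofHom (chartForm j P n (P.dual i)) = 0 := by
          ext
          simp [a, chartForm_dual, hk]
        rw [this, tilde.map_zero, Limits.comp_zero]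
      · simp
    exact congr(Scheme.Modules.Hom.app $h4 W s)
  exact ⟨⟨f, g, h3, h2⟩, fun Φ => by rw [← h1, ← Category.assoc, h3, Category.id_comp]⟩

end ChartIso

/-! ### Gluing sections and morphisms from their values under functionals -/

section Glue
variable {R : CommRingCat.{u}} {X : Scheme.{u}} {M N : X.Modules}

/-- The functionals separate sections, so local sections with the prescribed values agree on
overlaps automatically and no cocycle condition has to be assumed. -/
lemma exists_glued_section {ι C : Type*} (Ψ : ι → (N ⟶ structureSheafModule X)) {U : X.Opens}
    (a : ι → Γ(X, U)) (V : C → X.Opens) (hV : ∀ c, V c ≤ U) (hc : ∀ x ∈ U, ∃ c, x ∈ V c)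
    (hinj : ∀ (W : X.Opens) (s : Γ(N, W)), (∀ i, ev (Ψ i) W s = 0) → s = 0)
    (t : ∀ c, Γ(N, V c))
    (ht : ∀ c i, ev (Ψ i) (V c) (t c) = X.presheaf.map (homOfLE (hV c)).op (a i)) :
    ∃ s : Γ(N, U), ∀ i, ev (Ψ i) U s = a i := by
  have hinj' (W : X.Opens) (s s' : Γ(N, W)) (h : ∀ i, ev (Ψ i) W s = ev (Ψ i) W s') : s = s' := by
    rw [← sub_eq_zero]
    refine hinj W _ fun i => ?_
    rw [map_sub, h, sub_self]
  have hmap {W W' W'' : X.Opens} (h : W' ≤ W) (h' : W'' ≤ W') (r : Γ(X, W)) :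
      X.presheaf.map (homOfLE h').op (X.presheaf.map (homOfLE h).op r) =
        X.presheaf.map (homOfLE (h'.trans h)).op r :=
    congr($(X.presheaf.map_comp (homOfLE h).op (homOfLE h').op) r).symm
  have hcov : U ≤ iSup V := fun x hx => by
    obtain ⟨c, hc⟩ := hc x hx
    exact Opens.mem_iSup.2 ⟨c, hc⟩
  obtain ⟨s, hs, -⟩ := TopCat.Sheaf.existsUnique_gluing' (⟨_, N.isSheaf⟩ : TopCat.Sheaf Ab X) V U
    (fun c => homOfLE (hV c)) hcov t fun c c' => by
      refine hinj' _ (res N inf_le_left (t c)) (res N inf_le_right (t c')) fun i => ?_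
      rw [ev_res, ev_res, ht, ht, hmap, hmap]
  refine ⟨s, fun i => ?_⟩
  refine TopCat.Sheaf.eq_of_locally_eq' X.sheaf V U (fun c => homOfLE (hV c)) hcov _ _ fun c => ?_
  refine Eq.trans ?_ (ht c i)
  refine (ev_res (Ψ i) (hV c) s).symm.trans ?_
  exact congrArg (ev (Ψ i) (V c)) (hs c)

/-- A morphism is determined by its compositions with a jointly injective family of functionals, and
exists as soon as it exists locally. -/
lemma exists_glued_hom {ι : Type*} (Ψ : ι → (N ⟶ structureSheafModule X))
    (T : ι → (M ⟶ structureSheafModule X)) (j : X → (Spec R ⟶ X)) [∀ x, IsOpenImmersion (j x)]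
    (hj : ∀ x, x ∈ Set.range (j x))
    (hinj : ∀ (x : X) (W : X.Opens), W ≤ j x ''ᵁ ⊤ → ∀ s : Γ(N, W),
      (∀ i, ev (Ψ i) W s = 0) → s = 0)
    (d : ∀ x, M.restrict (j x) ⟶ N.restrict (j x))
    (hd : ∀ x i, d x ≫ chartFunctional (j x) (Ψ i) = chartFunctional (j x) (T i)) :
    ∃ D : M ⟶ N, (∀ i, D ≫ Ψ i = T i) ∧
      ∀ x, (Scheme.Modules.restrictFunctor (j x)).map D = d x := by
  have hinj0 (W : X.Opens) (s : Γ(N, W)) (hs : ∀ i, ev (Ψ i) W s = 0) : s = 0 := by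
    refine eq_of_locally_eq fun x hx => ⟨W ⊓ j x ''ᵁ ⊤, inf_le_left, ⟨hx, ?_⟩, ?_⟩
    · obtain ⟨y, hy⟩ := hj x
      exact ⟨y, trivial, hy⟩
    · rw [map_zero]
      refine hinj x _ inf_le_right _ fun i => ?_
      rw [ev_res, hs, map_zero]
  have hinj' (W : X.Opens) (s s' : Γ(N, W)) (h : ∀ i, ev (Ψ i) W s = ev (Ψ i) W s') : s = s' := by
    rw [← sub_eq_zero]
    refine hinj0 W _ fun i => ?_
    rw [map_sub, h, sub_self]
  have hloc (x : X) (i : ι) (W : (Spec R).Opens) (s : Γ(M, j x ''ᵁ W)) :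
      ev (Ψ i) (j x ''ᵁ W) ((d x).app W s) = ev (T i) (j x ''ᵁ W) s := by
    have h1 : (chartFunctional (j x) (Ψ i)).app W ((d x).app W s) =
      (chartFunctional (j x) (T i)).app W s := congr(Scheme.Modules.Hom.app $(hd x i) W s)
    erw [chartFunctional_app, chartFunctional_app] at h1
    exact ((j x).appIso W).commRingCatIsoToRingEquiv.injective h1
  -- The values `T i s` prescribe the image of `s`, and the local morphisms `d x` attain them on
  -- charts. Uniqueness of the glued section then gives linearity, compatibility with restriction
  -- and agreement with each `d x`.
  have hex (U : X.Opens) (s : Γ(M, U)) : ∃ t : Γ(N, U), ∀ i, ev (Ψ i) U t = ev (T i) U s := by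
    have hV (x : X) : j x ''ᵁ (j x ⁻¹ᵁ U) ≤ U := Scheme.Hom.image_preimage_le ..
    refine exists_glued_section Ψ (fun i => ev (T i) U s) (fun x => j x ''ᵁ (j x ⁻¹ᵁ U)) hV
      (fun x hx => ⟨x, ?_⟩) hinj0 (fun x => (d x).app _ (res M (hV x) s)) fun x i => ?_
    · obtain ⟨y, hy⟩ := hj x
      have hyU : j x y ∈ U := by rw [hy]; exact hx
      exact ⟨y, hyU, hy⟩
    · exact (hloc x i _ (res M (hV x) s)).trans (ev_res _ _ _)
  choose t ht using hex
  let f (U : X.Opens) : Γ(M, U) →ₗ[Γ(X, U)] Γ(N, U) :=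
    { toFun := t U
      map_add' := fun a b => hinj' _ _ _ fun i => by simp only [ht, map_add]
      map_smul' := fun r a => hinj' _ _ _ fun i => by simp only [ht, map_smul, RingHom.id_apply] }
  let D : M ⟶ N := ⟨⟨fun U => ModuleCat.ofHom (f U.unop), fun {U V} i => by
    ext s
    refine hinj' V.unop (t V.unop (res M (leOfHom i.unop) s)) (res N (leOfHom i.unop) (t U.unop s))
      fun l => ?_
    exact (ht _ _ l).trans ((ev_res _ _ _).trans
      ((congrArg _ (ht _ _ l).symm).trans (ev_res _ _ _).symm))⟩⟩
  refine ⟨D, fun i => ev_ext fun U s => ht U s i, fun x => ?_⟩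
  ext W s
  refine hinj' (j x ''ᵁ W) (t _ s) ((d x).app W s) fun i => ?_
  exact (ht _ _ i).trans (hloc x i W s).symm

end Glue

/-! ### Exactness and injectivity checked on charts -/

section TildeExact
variable {R : CommRingCat.{u}} {X : Scheme.{u}}

/-- The basic open set of an element, as an open set of the scheme. -/
def specOpen (a : R) : (Spec R).Opens := PrimeSpectrum.basicOpen a

instance (N : ModuleCat.{u} R) (a : R) :
    IsLocalizedModule (.powers a) (toTilde N (specOpen a)) :=
  inferInstanceAs (IsLocalizedModule.Away a (tilde.toOpen N (PrimeSpectrum.basicOpen a)).hom)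

/-- Sections over `D(a)` are the localization at `a`, and both maps are linear and extend `f`.
Exactness of localization then passes to sections over basic open sets. -/
lemma tildeMap_app {N₁ N₂ : ModuleCat.{u} R} (f : N₁ ⟶ N₂) (a : R) :
    ⇑((tilde.map f).app (specOpen a)) =
      IsLocalizedModule.map (.powers a) (toTilde N₁ (specOpen a))
        (toTilde N₂ (specOpen a)) f.hom := by
  let F : Γ(tilde N₁, specOpen a) →ₗ[R] Γ(tilde N₂, specOpen a) :=
    { toFun := (tilde.map f).app (specOpen a)
      map_add' := map_add _
      map_smul' := fun r s => hom_app_smul _ _ r s }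
  have : F = IsLocalizedModule.map (.powers a) (toTilde N₁ (specOpen a))
        (toTilde N₂ (specOpen a)) f.hom := by
    refine IsLocalizedModule.linearMap_ext (.powers a) (toTilde N₁ (specOpen a))
      (toTilde N₂ (specOpen a)) ?_
    ext n
    refine (tildeMap_app_toTilde f _ n).trans ?_
    simp
  exact congrArg DFunLike.coe this

lemma tilde_exact_app {N₁ N₂ N₃ : ModuleCat.{u} R} (f : N₁ ⟶ N₂) (g : N₂ ⟶ N₃)
    (h : Function.Exact f g) (a : R) :
    Function.Exact ((tilde.map f).app (specOpen a))
      ((tilde.map g).app (specOpen a)) := by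
  rw [tildeMap_app, tildeMap_app]
  exact IsLocalizedModule.map_exact (.powers a) (toTilde N₁ (specOpen a))
    (toTilde N₂ (specOpen a)) (toTilde N₃ (specOpen a)) f.hom g.hom h

lemma tilde_injective_app {N₁ N₂ : ModuleCat.{u} R} (f : N₁ ⟶ N₂)
    (h : Function.Injective f) (a : R) :
    Function.Injective ((tilde.map f).app (specOpen a)) := by
  rw [tildeMap_app]
  exact IsLocalizedModule.map_injective (.powers a) (toTilde N₁ (specOpen a))
    (toTilde N₂ (specOpen a)) f.hom h

lemma exists_chart_basicOpen (j : Spec R ⟶ X) [IsOpenImmersion j] {U : X.Opens} {x : X}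
    (hx : x ∈ Set.range j) (hU : x ∈ U) :
    ∃ a : R, j ''ᵁ specOpen a ≤ U ∧ x ∈ j ''ᵁ specOpen a := by
  obtain ⟨y, hy⟩ := hx
  have hyU : y ∈ j ⁻¹ᵁ U := by
    change j y ∈ U
    rw [hy]
    exact hU
  obtain ⟨_, ⟨_, ⟨a, rfl⟩, rfl⟩, hya, haU⟩ :=
    PrimeSpectrum.isBasis_basic_opens.exists_subset_of_mem_open hyU (j ⁻¹ᵁ U).2
  refine ⟨a, ?_, y, hya, hy⟩
  rintro _ ⟨z, hz, rfl⟩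
  exact haU hz

lemma iso_app_injective {M N : X.Modules} (e : M ≅ N) (U : X.Opens) :
    Function.Injective (e.hom.app U) := app_injective_of_mono _ _

/-- Exactness may be checked on charts. -/
lemma exact_of_charts (S : ShortComplex X.Modules) (j : X → (Spec R ⟶ X))
    [∀ x, IsOpenImmersion (j x)] (hj : ∀ x, x ∈ Set.range (j x)) {N₁ N₂ N₃ : ModuleCat.{u} R}
    (f : N₁ ⟶ N₂) (g : N₂ ⟶ N₃) (h : Function.Exact f g)
    (e₁ : ∀ x, S.X₁.restrict (j x) ≅ tilde N₁) (e₂ : ∀ x, S.X₂.restrict (j x) ≅ tilde N₂)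
    (e₃ : ∀ x, S.X₃.restrict (j x) ≅ tilde N₃)
    (hf : ∀ x, (Scheme.Modules.restrictFunctor (j x)).map S.f ≫ (e₂ x).hom =
      (e₁ x).hom ≫ tilde.map f)
    (hg : ∀ x, (Scheme.Modules.restrictFunctor (j x)).map S.g ≫ (e₃ x).hom =
      (e₂ x).hom ≫ tilde.map g) : S.Exact := by
  refine exact_of_locally_exact S fun U s hs x hx => ?_
  obtain ⟨a, haU, hxa⟩ := exists_chart_basicOpen (j x) (hj x) hx
  set W := specOpen a
  set s' : Γ(S.X₂.restrict (j x), W) := res S.X₂ haU s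
  have h1 : (tilde.map g).app W ((e₂ x).hom.app W s') = 0 := by
    refine (congr(Scheme.Modules.Hom.app $(hg x) W s')).symm.trans ?_
    have : S.g.app _ (res S.X₂ haU s) = 0 := by rw [app_res, hs, map_zero]
    exact (congrArg ((e₃ x).hom.app W) this).trans (map_zero _)
  obtain ⟨t, ht⟩ := (tilde_exact_app f g h a _).1 h1
  refine ⟨_, haU, (e₁ x).inv.app W t, hxa, iso_app_injective (e₂ x) W ?_⟩
  refine (congr(Scheme.Modules.Hom.app $(hf x) W ((e₁ x).inv.app W t))).trans (Eq.trans ?_ ht)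
  exact congrArg ((tilde.map f).app W) congr(Scheme.Modules.Hom.app $((e₁ x).inv_hom_id) W t)

lemma mono_of_charts {M N : X.Modules} (d : M ⟶ N) (j : X → (Spec R ⟶ X))
    [∀ x, IsOpenImmersion (j x)] (hj : ∀ x, x ∈ Set.range (j x)) {N₁ N₂ : ModuleCat.{u} R}
    (f : N₁ ⟶ N₂) (h : Function.Injective f)
    (e₁ : ∀ x, M.restrict (j x) ≅ tilde N₁) (e₂ : ∀ x, N.restrict (j x) ≅ tilde N₂)
    (hf : ∀ x, (Scheme.Modules.restrictFunctor (j x)).map d ≫ (e₂ x).hom =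
      (e₁ x).hom ≫ tilde.map f) : Mono d := by
  refine mono_of_app_injective d fun U s hs => eq_of_locally_eq fun x hx => ?_
  obtain ⟨a, haU, hxa⟩ := exists_chart_basicOpen (j x) (hj x) hx
  set W := specOpen a
  set s' : Γ(M.restrict (j x), W) := res M haU s
  refine ⟨_, haU, hxa, ?_⟩
  have h1 : (tilde.map f).app W ((e₁ x).hom.app W s') = 0 := by
    refine (congr(Scheme.Modules.Hom.app $(hf x) W s')).symm.trans ?_
    have : d.app _ (res M haU s) = 0 := by rw [app_res, hs, map_zero]
    exact (congrArg ((e₂ x).hom.app W) this).trans (map_zero _)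
  have h2 := tilde_injective_app f h a (h1.trans (map_zero _).symm)
  exact (iso_app_injective (e₁ x) W (h2.trans (map_zero _).symm)).trans (map_zero _).symm

end TildeExact

/-! ### Functionals and frames for the sheaf of a graded module on `Proj` -/

section ProjFunctional
variable {A : Type u} [CommRing A] {σ : Type*} [SetLike σ A] [AddSubgroupClass σ A]
  {𝒜 : ℕ → σ} [GradedRing 𝒜]
  {M : Type u} [AddCommGroup M] [Module A M] {ℳ : ℕ → AddSubgroup M}

/-- The map induced by a linear form on localizations. -/
def stalkForm (φ : M →ₗ[A] A) (x : ProjectiveSpectrum 𝒜) :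
    ProjStalk 𝒜 M x →ₗ[A] Localization (projCompl 𝒜 x) :=
  IsLocalizedModule.map (projCompl 𝒜 x) (LocalizedModule.mkLinearMap (projCompl 𝒜 x) M)
    (Algebra.linearMap A (Localization (projCompl 𝒜 x))) φ

lemma stalkForm_mk (φ : M →ₗ[A] A) (x : ProjectiveSpectrum 𝒜) (m : M) (a : projCompl 𝒜 x) :
    stalkForm φ x (LocalizedModule.mk m a) = Localization.mk (φ m) a := by
  have h : a • stalkForm φ x (LocalizedModule.mk m a) = a • Localization.mk (φ m) a := by
    rw [Submonoid.smul_def, ← map_smul]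
    have h1 : (a : A) • LocalizedModule.mk m a = LocalizedModule.mkLinearMap (projCompl 𝒜 x) M m :=
        by
      rw [LocalizedModule.mkLinearMap_apply, LocalizedModule.smul'_mk]
      exact LocalizedModule.mk_cancel a m
    rw [h1, stalkForm, IsLocalizedModule.map_apply, Algebra.linearMap_apply, Submonoid.smul_def,
      Algebra.smul_def, ← Localization.mk_one_eq_algebraMap, ← Localization.mk_one_eq_algebraMap,
          Localization.mk_mul,
      one_mul, Localization.mk_eq_mk_iff, Localization.r_iff_exists]
    exact ⟨1, by simp⟩
  have hu := IsLocalization.map_units (Localization (projCompl 𝒜 x)) a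
  rw [Submonoid.smul_def, Submonoid.smul_def, Algebra.smul_def, Algebra.smul_def] at h
  exact hu.mul_left_cancel h

lemma stalkForm_smul (φ : M →ₗ[A] A) (x : ProjectiveSpectrum 𝒜)
    (r : Localization (projCompl 𝒜 x)) (s : ProjStalk 𝒜 M x) :
    stalkForm φ x (r • s) = r * stalkForm φ x s := by
  induction r using Localization.induction_on with
  | H p =>
  induction s using LocalizedModule.induction_on with
  | h m a =>
  rw [LocalizedModule.mk_smul_mk, stalkForm_mk, stalkForm_mk, map_smul, smul_eq_mul,
    Localization.mk_mul]

lemma projSection_ext {U : (Proj 𝒜).Opens} {r r' : Γ(Proj 𝒜, U)}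
    (h : ∀ x : U, projEval 𝒜 x r = projEval 𝒜 x r') : r = r' :=
  Subtype.ext (funext fun x => HomogeneousLocalization.val_injective _ (h x))

/-- Regular functions from compatible values. -/
lemma exists_projSection {U : (Proj 𝒜).Opens}
    (f : ∀ x : U, Localization (projCompl 𝒜 x.1))
    (hf : ∀ x : U, ∃ (W : (Proj 𝒜).Opens) (_ : x.1 ∈ W) (h : W ≤ U) (i : ℕ) (a b : A),
      a ∈ 𝒜 i ∧ b ∈ 𝒜 i ∧ ∀ y : W, ∃ hb : b ∈ projCompl 𝒜 y.1,
        f ⟨y.1, h y.2⟩ = Localization.mk a ⟨b, hb⟩) :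
    ∃ r : Γ(Proj 𝒜, U), ∀ x : U, projEval 𝒜 x r = f x := by
  have h1 (x : U) : ∃ r : HomogeneousLocalization 𝒜 (projCompl 𝒜 x.1), r.val = f x := by
    obtain ⟨W, hW, h, i, a, b, ha, hb, H⟩ := hf x
    obtain ⟨hb', H⟩ := H ⟨x.1, hW⟩
    exact ⟨HomogeneousLocalization.mk ⟨i, ⟨a, ha⟩, ⟨b, hb⟩, hb'⟩,
      (HomogeneousLocalization.val_mk _).trans H.symm⟩
  choose r hr using h1
  refine ⟨⟨r, fun x => ?_⟩, hr⟩
  obtain ⟨W, hW, h, i, a, b, ha, hb, H⟩ := hf x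
  refine ⟨W, hW, homOfLE h, i, ⟨a, ha⟩, ⟨b, hb⟩, fun y => (H y).choose, fun y => ?_⟩
  refine HomogeneousLocalization.val_injective _ ((hr _).trans ?_)
  obtain ⟨hb', H'⟩ := H y
  exact H'.trans (HomogeneousLocalization.val_mk (x := projCompl 𝒜 y.1)
    ⟨i, ⟨a, ha⟩, ⟨b, hb⟩, hb'⟩).symm

variable [SetLike.GradedSMul 𝒜 ℳ]

lemma exists_projFunctional_apply (φ : M →ₗ[A] A) (hφ : ∀ i, ∀ m ∈ ℳ i, φ m ∈ 𝒜 i)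
    {U : (Proj 𝒜).Opens} (s : projSections 𝒜 ℳ U) :
    ∃ r : Γ(Proj 𝒜, U), ∀ x : U, projEval 𝒜 x r = stalkForm φ x.1 (s.1 x) := by
  refine exists_projSection _ fun x => ?_
  obtain ⟨W, hW, h, i, m, a, hm, ha, H⟩ := s.2 x
  refine ⟨W, hW, leOfHom h, i, φ m, a, hφ i m hm, ha, fun y => ?_⟩
  obtain ⟨hb, H⟩ := H y
  exact ⟨hb, (congrArg (stalkForm φ y.1) H).trans (stalkForm_mk _ _ _ _)⟩

/-- The functional on the sheaf of a graded module given by a linear form of degree zero. -/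
def projFunctional (φ : M →ₗ[A] A) (hφ : ∀ i, ∀ m ∈ ℳ i, φ m ∈ 𝒜 i) :
    projTilde 𝒜 ℳ ⟶ structureSheafModule (Proj 𝒜) :=
  mkFunctional
    (fun U =>
      { toFun := fun s => (exists_projFunctional_apply φ hφ s).choose
        map_add' := fun s t => projSection_ext fun x => by
          rw [map_add, (exists_projFunctional_apply φ hφ s).choose_spec,
            (exists_projFunctional_apply φ hφ t).choose_spec, ← map_add]
          exact (exists_projFunctional_apply φ hφ (s + t : projSections 𝒜 ℳ U)).choose_spec x
        map_smul' := fun r s => projSection_ext fun x => by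
          refine ((exists_projFunctional_apply φ hφ
            (r • s : projSections 𝒜 ℳ U)).choose_spec x).trans ?_
          rw [RingHom.id_apply, smul_eq_mul, map_mul,
            (exists_projFunctional_apply φ hφ s).choose_spec]
          exact stalkForm_smul φ x.1 _ _ })
    fun U V h s => projSection_ext fun x =>
      ((exists_projFunctional_apply φ hφ (res (projTilde 𝒜 ℳ) h s)).choose_spec x).trans
        ((exists_projFunctional_apply φ hφ s).choose_spec ⟨x.1, h x.2⟩).symm

lemma projEval_projFunctional (φ : M →ₗ[A] A) (hφ : ∀ i, ∀ m ∈ ℳ i, φ m ∈ 𝒜 i)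
    {U : (Proj 𝒜).Opens} (s : projSections 𝒜 ℳ U) (x : U) :
    projEval 𝒜 x (ev (projFunctional φ hφ) U s) = stalkForm φ x.1 (s.1 x) :=
  (exists_projFunctional_apply φ hφ s).choose_spec x

/-- The fraction `g / f` on the basic open set of `f`. -/
def projFrac {i : ℕ} {f g : A} (hf : f ∈ 𝒜 i) (hg : g ∈ 𝒜 i) : Γ(Proj 𝒜, Proj.basicOpen 𝒜 f) :=
  Proj.awayToSection 𝒜 f (HomogeneousLocalization.mk ⟨i, ⟨g, hg⟩, ⟨f, hf⟩, ⟨1, pow_one f⟩⟩)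

lemma projEval_projFrac {i : ℕ} {f g : A} (hf : f ∈ 𝒜 i) (hg : g ∈ 𝒜 i)
    (x : Proj.basicOpen 𝒜 f) :
    projEval 𝒜 x (projFrac hf hg) = Localization.mk g ⟨f, x.2⟩ := by
  refine (ProjectiveSpectrum.Proj.awayToSection_apply 𝒜 f
    (HomogeneousLocalization.mk ⟨i, ⟨g, hg⟩, ⟨f, hf⟩, ⟨1, pow_one f⟩⟩) x).trans ?_
  rw [HomogeneousLocalization.val_mk, Localization.mk_eq_mk', IsLocalization.map_mk',
    ← Localization.mk_eq_mk']
  rfl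

/-- The section `m / f` on the basic open set of `f`. -/
def modFrac {i : ℕ} {f : A} {m : M} (hf : f ∈ 𝒜 i) (hm : m ∈ ℳ i) :
    projSections 𝒜 ℳ (Proj.basicOpen 𝒜 f) :=
  ⟨fun x => LocalizedModule.mk m ⟨f, x.2⟩, fun x =>
    ⟨_, x.2, 𝟙 _, i, m, f, hm, hf, fun y => ⟨y.2, rfl⟩⟩⟩

lemma ev_modFrac (φ : M →ₗ[A] A) (hφ : ∀ i, ∀ m ∈ ℳ i, φ m ∈ 𝒜 i) {i : ℕ} {f : A} {m : M}
    (hf : f ∈ 𝒜 i) (hm : m ∈ ℳ i) :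
    ev (projFunctional φ hφ) (Proj.basicOpen 𝒜 f) (modFrac hf hm) = projFrac hf (hφ i m hm) := by
  refine projSection_ext fun x => ?_
  rw [projEval_projFunctional, projEval_projFrac]
  exact stalkForm_mk _ _ _ _

/-- The frame of the sheaf of a graded module on a basic open set, from a basis up to denominators
with its dual basis. -/
def projFrame {I : Type*} [Fintype I] [DecidableEq I] {i : ℕ} {f : A} (hf : f ∈ 𝒜 i)
    (m : I → M) (hm : ∀ a, m a ∈ ℳ i) (φ : I → (M →ₗ[A] A))
    (hφ : ∀ a, ∀ i, ∀ m ∈ ℳ i, φ a m ∈ 𝒜 i) (hdual : ∀ a b, φ a (m b) = if a = b then f else 0)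
    (hexp : ∀ x : M, f • x = ∑ a, φ a x • m a) :
    Frame (projTilde 𝒜 ℳ) (Proj.basicOpen 𝒜 f) I where
  b a := modFrac hf (hm a)
  dual a := projFunctional (φ a) (hφ a)
  ev_dual a b := by
    rw [ev_modFrac]
    refine projSection_ext fun x => ?_
    rw [projEval_projFrac, hdual]
    split_ifs
    · rw [map_one]
      exact Localization.mk_self ⟨f, x.2⟩
    · rw [map_zero, Localization.mk_zero]
  inj U hU s hs := by
    refine Subtype.ext (funext fun x => ?_)
    have h1 (a : I) : stalkForm (φ a) x.1 (s.1 x) = 0 := by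
      rw [← projEval_projFunctional (φ a) (hφ a) s x]
      exact (congrArg _ (hs a)).trans (map_zero _)
    change s.1 x = 0
    revert h1
    generalize s.1 x = y
    induction y using LocalizedModule.induction_on with
    | h n c =>
    intro h1
    -- Each coordinate of the numerator `n` is killed by some `d a` outside the prime. The product
    -- of all `d a` kills every coordinate, so by `hexp` its product with `f` kills `n`.
    have h2 (a : I) : ∃ d : projCompl 𝒜 x.1, (d : A) * φ a n = 0 := by
      have := (stalkForm_mk (φ a) x.1 n c).symm.trans (h1 a)
      rw [Localization.mk_eq_mk', IsLocalization.mk'_eq_zero_iff] at this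
      exact this
    choose d hd using h2
    have hfx : f ∈ projCompl 𝒜 x.1 := hU x.2
    refine (LocalizedModule.mk_eq.2 ⟨(∏ a, d a) * ⟨f, hfx⟩, ?_⟩).trans (LocalizedModule.zero_mk 1)
    rw [one_smul, smul_zero, smul_zero, mul_smul]
    change ((∏ a, d a : projCompl 𝒜 x.1) : A) • f • n = 0
    rw [hexp, Finset.smul_sum]
    refine Finset.sum_eq_zero fun a _ => ?_
    rw [smul_smul, ← Finset.mul_prod_erase _ d (Finset.mem_univ a), Submonoid.coe_mul]
    rw [mul_right_comm, hd, zero_mul, zero_smul]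

end ProjFunctional

/-! ### The Plücker coordinate ring and its localization at a two-form -/

section Plucker
variable {k V : Type u} [Field k] [AddCommGroup V] [Module k V]

/-- An alternating two-form as an element of the coordinate ring. -/
def formElt (ω : V [⋀^Fin 2]→ₗ[k] k) : PluckerRing k V :=
  ⟨ω, Algebra.subset_adjoin ⟨ω, rfl⟩⟩

@[simp] lemma formElt_toFun (ω : V [⋀^Fin 2]→ₗ[k] k) (v : Fin 2 → V) :
    (formElt ω).toFun v = ω v := rfl

lemma plucker_ext {F G : PluckerRing k V} (h : ∀ v, F.toFun v = G.toFun v) : F = G :=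
  PluckerRing.toFun_injective k V (funext h)

lemma formElt_mem (ω : V [⋀^Fin 2]→ₗ[k] k) : formElt ω ∈ pluckerGrading k V 1 := by
  intro c v
  have := ω.toMultilinearMap.map_smul_univ (fun _ => c) v
  simp only [Fin.prod_univ_two, smul_eq_mul] at this
  refine this.trans ?_
  rw [mul_one, pow_two]
  rfl

/-- Induction on the generation of the coordinate ring by two-forms. -/
lemma plucker_induction {p : PluckerRing k V → Prop} (form : ∀ ω, p (formElt ω))
    (const : ∀ c : k, p (algebraMap k _ c)) (add : ∀ F G, p F → p G → p (F + G))
    (mul : ∀ F G, p F → p G → p (F * G)) (F : PluckerRing k V) : p F := by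
  obtain ⟨F, hF⟩ := F
  induction hF using Algebra.adjoin_induction with
  | mem x hx => obtain ⟨ω, rfl⟩ := hx; exact form ω
  | algebraMap r => exact const r
  | add x y hx hy h1 h2 => exact add ⟨x, hx⟩ ⟨y, hy⟩ h1 h2
  | mul x y hx hy h1 h2 => exact mul ⟨x, hx⟩ ⟨y, hy⟩ h1 h2

/-- An element of the coordinate ring depends only on the bivector `v₀ ∧ v₁`, because two-forms
generate the ring. -/
lemma toFun_eq_of_forms {v v' : Fin 2 → V} (h : ∀ ω : V [⋀^Fin 2]→ₗ[k] k, ω v = ω v')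
    (F : PluckerRing k V) : F.toFun v = F.toFun v' := by
  induction F using plucker_induction with
  | form ω => exact h ω
  | const c => simp
  | add F G hF hG => simp [hF, hG]
  | mul F G hF hG => simp [hF, hG]

lemma alternating_comb (ω : V [⋀^Fin 2]→ₗ[k] k) (p : Fin 2 → V) (g : Fin 2 → Fin 2 → k) :
    ω (fun i => g i 0 • p 0 + g i 1 • p 1) = (g 0 0 * g 1 1 - g 0 1 * g 1 0) * ω p := by
  have h1 : (fun i => g i 0 • p 0 + g i 1 • p 1) = fun i => ∑ l, g i l • p l := by
    funext i
    rw [Fin.sum_univ_two]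
  rw [h1]
  refine (ω.toMultilinearMap.map_sum _).trans ?_
  simp only [MultilinearMap.map_smul_univ]
  rw [← (piFinTwoEquiv fun _ => Fin 2).symm.sum_comp, Fintype.sum_prod_type]
  have h00 (c : Fin 2) : ω (fun i => p c) = 0 := ω.map_eq_zero_of_eq _ (i := 0) (j := 1) rfl (by
      simp)
  have h01 : ω (fun i => p ((piFinTwoEquiv fun _ => Fin 2).symm (0, 1) i)) = ω p := by
    congr 1; funext i; fin_cases i <;> rfl
  have h10 : ω (fun i => p ((piFinTwoEquiv fun _ => Fin 2).symm (1, 0) i)) = - ω p := by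
    rw [← ω.map_swap p (i := 0) (j := 1) (by simp)]
    congr 1; funext i; fin_cases i <;> rfl
  have hcc (c : Fin 2) : ω (fun i => p ((piFinTwoEquiv fun _ => Fin 2).symm (c, c) i)) = 0 := by
    rw [← h00 c]
    congr 1; funext i; fin_cases i <;> rfl
  simp only [Fin.sum_univ_two, AlternatingMap.coe_multilinearMap, hcc, h01, h10,
    Fin.prod_univ_two, smul_eq_mul]
  simp [piFinTwoEquiv]
  ring

/-- The two-form `α ∧ β`. -/
def wedge (α β : Module.Dual k V) : V [⋀^Fin 2]→ₗ[k] k :=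
  Matrix.detRowAlternating.compLinearMap (LinearMap.pi ![α, β])

@[simp] lemma wedge_apply (α β : Module.Dual k V) (v : Fin 2 → V) :
    wedge α β v = α (v 0) * β (v 1) - α (v 1) * β (v 0) := by
  refine (Matrix.det_fin_two (Matrix.of fun i j =>
    (![α, β] : Fin 2 → Module.Dual k V) j (v i))).trans ?_
  simp
  ring

section Chart
variable (B : Module.Basis (Fin 2 ⊕ Fin 5) k V)

/-- The basis of the plane with the given matrix. -/
def planeBasis (a : Fin 2 × Fin 5 → k) (i : Fin 2) : V :=
  B (.inl i) + ∑ l, a (i, l) • B (.inr l)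

lemma coord_inl_planeBasis (a : Fin 2 × Fin 5 → k) (i i' : Fin 2) :
    B.coord (.inl i) (planeBasis B a i') = if i = i' then 1 else 0 := by
  simp [planeBasis, Finsupp.single_apply, eq_comm]

lemma coord_inr_planeBasis (a : Fin 2 × Fin 5 → k) (l : Fin 5) (i' : Fin 2) :
    B.coord (.inr l) (planeBasis B a i') = a (i', l) := by
  simp [planeBasis, Finsupp.single_apply]

/-- The two-form that defines the chart. -/
def chartElt : PluckerRing k V := formElt (wedge (B.coord (.inl 0)) (B.coord (.inl 1)))

lemma chartElt_mem : chartElt B ∈ pluckerGrading k V 1 := formElt_mem _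

/-- The coordinates of the universal plane basis are 0, 1 or variables, so multilinear expansion
makes a two-form polynomial in the matrix entries. -/
lemma exists_chartPoly (F : PluckerRing k V) :
    ∃ P : MvPolynomial (Fin 2 × Fin 5) k, ∀ a, MvPolynomial.eval a P = F.toFun (planeBasis B a) :=
        by
  induction F using plucker_induction with
  | const c => exact ⟨MvPolynomial.C c, by simp⟩
  | add F G hF hG =>
    obtain ⟨P, hP⟩ := hF
    obtain ⟨Q, hQ⟩ := hG
    exact ⟨P + Q, fun a => by simp [hP, hQ]⟩
  | mul F G hF hG =>
    obtain ⟨P, hP⟩ := hF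
    obtain ⟨Q, hQ⟩ := hG
    exact ⟨P * Q, fun a => by simp [hP, hQ]⟩
  | form ω =>
    let e (i : Fin 2) (l : Fin 2 ⊕ Fin 5) : MvPolynomial (Fin 2 × Fin 5) k :=
      l.elim (fun i' => if i' = i then 1 else 0) fun l => MvPolynomial.X (i, l)
    refine ⟨∑ r : Fin 2 → Fin 2 ⊕ Fin 5, (∏ i, e i (r i)) *
      MvPolynomial.C (ω fun i => B (r i)), fun a => ?_⟩
    have h1 : planeBasis B a = fun i => ∑ l, MvPolynomial.eval a (e i l) • B l := by
      funext i
      rw [Fintype.sum_sum_type]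
      simp [planeBasis, e, apply_ite (MvPolynomial.eval a), ite_smul]
    rw [formElt_toFun, h1]
    refine Eq.trans ?_ (ω.toMultilinearMap.map_sum _).symm
    simp only [MultilinearMap.map_smul_univ]
    simp [map_sum]

/-- The polynomial expressing an element of the coordinate ring on the chart. -/
def chartPoly (F : PluckerRing k V) : MvPolynomial (Fin 2 × Fin 5) k :=
  (exists_chartPoly B F).choose

lemma eval_chartPoly (F : PluckerRing k V) (a : Fin 2 × Fin 5 → k) :
    MvPolynomial.eval a (chartPoly B F) = F.toFun (planeBasis B a) :=
  (exists_chartPoly B F).choose_spec a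

variable [Infinite k]

/-- The restriction of the coordinate ring to the chart. -/
def chartEval : PluckerRing k V →ₐ[k] MvPolynomial (Fin 2 × Fin 5) k where
  toFun := chartPoly B
  map_one' := MvPolynomial.funext fun a => by simp [eval_chartPoly]
  map_zero' := MvPolynomial.funext fun a => by simp [eval_chartPoly]
  map_add' F G := MvPolynomial.funext fun a => by simp [eval_chartPoly]
  map_mul' F G := MvPolynomial.funext fun a => by simp [eval_chartPoly]
  commutes' c := MvPolynomial.funext fun a => by simp [eval_chartPoly, MvPolynomial.algebraMap_eq]

lemma eval_chartEval (F : PluckerRing k V) (a : Fin 2 × Fin 5 → k) :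
    MvPolynomial.eval a (chartEval B F) = F.toFun (planeBasis B a) :=
  eval_chartPoly B F a

lemma chartEval_chartElt : chartEval B (chartElt B) = 1 :=
  MvPolynomial.funext fun a => by
    rw [eval_chartEval, chartElt, formElt_toFun, wedge_apply]
    simp only [coord_inl_planeBasis]
    simp

lemma chartEval_inr_wedge (l : Fin 5) :
    chartEval B (formElt (wedge (B.coord (.inr l)) (B.coord (.inl 1)))) = MvPolynomial.X (0, l) :=
  MvPolynomial.funext fun a => by
    rw [eval_chartEval, formElt_toFun, wedge_apply]
    simp only [coord_inl_planeBasis, coord_inr_planeBasis]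
    simp

lemma chartEval_wedge_inr (l : Fin 5) :
    chartEval B (formElt (wedge (B.coord (.inl 0)) (B.coord (.inr l)))) = MvPolynomial.X (1, l) :=
  MvPolynomial.funext fun a => by
    rw [eval_chartEval, formElt_toFun, wedge_apply]
    simp only [coord_inl_planeBasis, coord_inr_planeBasis]
    simp

lemma chartEval_inr_wedge_inr (l m : Fin 5) :
    chartEval B (formElt (wedge (B.coord (.inr l)) (B.coord (.inr m)))) =
      MvPolynomial.X (0, l) * MvPolynomial.X (1, m) -
        MvPolynomial.X (1, l) * MvPolynomial.X (0, m) :=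
  MvPolynomial.funext fun a => by
    rw [eval_chartEval, formElt_toFun, wedge_apply]
    simp only [coord_inr_planeBasis]
    simp

lemma isUnit_chartEval : IsUnit ((chartEval B).toRingHom (chartElt B)) := by
  change IsUnit (chartEval B (chartElt B))
  rw [chartEval_chartElt]
  exact isUnit_one

/-- The map from the degree zero part of the localization to the polynomial ring. -/
def awayToPoly : HomogeneousLocalization.Away (pluckerGrading k V) (chartElt B) →+*
    MvPolynomial (Fin 2 × Fin 5) k :=
  (IsLocalization.Away.lift (S := Localization.Away (chartElt B)) (chartElt B)
    (g := (chartEval B).toRingHom) (isUnit_chartEval B)).comp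
    (algebraMap (HomogeneousLocalization.Away (pluckerGrading k V) (chartElt B))
      (Localization.Away (chartElt B)))

lemma awayToPoly_mk (c : HomogeneousLocalization.NumDenSameDeg (pluckerGrading k V)
    (.powers (chartElt B))) :
    awayToPoly B (HomogeneousLocalization.mk c) = chartEval B c.num := by
  obtain ⟨n, hn⟩ := c.den_mem
  have h1 : (HomogeneousLocalization.mk c).val = Localization.mk (c.num : PluckerRing k V)
    ⟨c.den, c.den_mem⟩ := HomogeneousLocalization.val_mk _
  change IsLocalization.Away.lift (chartElt B) (isUnit_chartEval B) (HomogeneousLocalization.mk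
      c).val = _
  rw [h1, Localization.mk_eq_mk', IsLocalization.Away.lift, IsLocalization.lift_mk'_spec]
  have h2 : chartEval B (c.den : PluckerRing k V) = 1 := by
    rw [← hn]
    simp [chartEval_chartElt]
  change chartEval B _ = chartEval B (c.den : PluckerRing k V) * _
  rw [h2, one_mul]

variable [IsAlgClosed k]

/-- If the chart form takes the value `c ≠ 0` at `v`, then `v` spans the plane of some matrix `a`,
and `v₀ ∧ v₁` is `c` times the bivector of `planeBasis B a`. With `d ^ 2 = c` this is also the
bivector of `d • planeBasis B a`, and homogeneity of degree `2 * n` gives the factor `d ^ (2 * n) =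
c ^ n`. -/
lemma toFun_eq_chartEval {n : ℕ} {F : PluckerRing k V} (hF : F ∈ pluckerGrading k V n)
    (v : Fin 2 → V) (hv : (chartElt B).toFun v ≠ 0) :
    ∃ a, F.toFun v = (chartElt B).toFun v ^ n * MvPolynomial.eval a (chartEval B F) := by
  set c := (chartElt B).toFun v with hc
  obtain ⟨d, hd⟩ := IsAlgClosed.exists_pow_nat_eq c (n := 2) (by norm_num)
  let α := B.coord (.inl 0)
  let β := B.coord (.inl 1)
  -- Cramer's rule: the entries of the reduced matrix of the plane are quotients of Plücker
  -- coordinates by the chart coordinate `c`.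
  let a : Fin 2 × Fin 5 → k := fun p =>
    (if p.1 = 0 then wedge (B.coord (.inr p.2)) β v else wedge α (B.coord (.inr p.2)) v) / c
  have hc' : c = α (v 0) * β (v 1) - α (v 1) * β (v 0) := by
    rw [hc, chartElt, formElt_toFun, wedge_apply]
  have h1 : v = fun i => α (v i) • planeBasis B a 0 + β (v i) • planeBasis B a 1 := by
    funext i
    refine B.ext_elem fun l => ?_
    change B.coord l (v i) = B.coord l (α (v i) • planeBasis B a 0 + β (v i) • planeBasis B a 1)
    rw [map_add, map_smul, map_smul, smul_eq_mul, smul_eq_mul]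
    cases l with
    | inl l =>
      simp only [coord_inl_planeBasis]
      fin_cases l <;> simp [α, β]
    | inr l =>
      simp only [coord_inr_planeBasis, a, wedge_apply]
      simp only [if_true, one_ne_zero, if_false]
      field_simp
      rw [hc']
      fin_cases i <;> simp <;> ring
  refine ⟨a, ?_⟩
  have h2 : F.toFun v = F.toFun (d • planeBasis B a) := by
    refine toFun_eq_of_forms (fun ω => ?_) F
    have h3 := alternating_comb ω (planeBasis B a) fun i l => if l = 0 then α (v i) else β (v i)
    simp only [if_true, one_ne_zero, if_false] at h3
    rw [← h1] at h3
    have h4 := ω.toMultilinearMap.map_smul_univ (fun _ => d) (planeBasis B a)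
    simp only [Fin.prod_univ_two, smul_eq_mul] at h4
    refine h3.trans (Eq.trans ?_ h4.symm)
    rw [← pow_two, hd, hc']
    change _ = _ * ω (planeBasis B a)
    ring
  rw [h2, hF, eval_chartEval, ← hd]
  ring

/-- Elements of the ring are functions: at a pair `v` either the chart form vanishes, or the value
of `F` is a multiple of a value of its polynomial on the chart. This makes `awayToPoly` injective.
-/
lemma chartElt_mul_eq_zero {n : ℕ} {F : PluckerRing k V} (hF : F ∈ pluckerGrading k V n)
    (h : chartEval B F = 0) : chartElt B * F = 0 := by
  refine plucker_ext fun v => ?_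
  simp only [map_mul, Pi.mul_apply, map_zero, Pi.zero_apply]
  by_cases hv : (chartElt B).toFun v = 0
  · rw [hv, zero_mul]
  · obtain ⟨a, ha⟩ := toFun_eq_chartEval B hF v hv
    rw [ha, h, map_zero, mul_zero, mul_zero]

lemma awayToPoly_bijective : Function.Bijective (awayToPoly B) := by
  constructor
  · rw [injective_iff_map_eq_zero]
    intro z hz
    obtain ⟨c, rfl⟩ := HomogeneousLocalization.mk_surjective z
    rw [awayToPoly_mk] at hz
    have h1 := chartElt_mul_eq_zero B c.num.2 hz
    refine HomogeneousLocalization.val_injective _ ?_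
    rw [HomogeneousLocalization.val_mk, HomogeneousLocalization.val_zero, Localization.mk_eq_mk',
      IsLocalization.mk'_eq_zero_iff]
    exact ⟨⟨_, Submonoid.mem_powers _⟩, h1⟩
  · intro P
    induction P using MvPolynomial.induction_on with
    | C c =>
      refine ⟨HomogeneousLocalization.mk ⟨0, ⟨algebraMap k _ c, fun d v => by simp⟩, 1,
        Submonoid.one_mem _⟩, ?_⟩
      rw [awayToPoly_mk]
      exact (chartEval B).commutes c
    | add P Q hP hQ =>
      obtain ⟨x, rfl⟩ := hP
      obtain ⟨y, rfl⟩ := hQ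
      exact ⟨x + y, map_add _ _ _⟩
    | mul_X P p hP =>
      obtain ⟨x, rfl⟩ := hP
      have hX : ∃ y, awayToPoly B y = MvPolynomial.X p := by
        obtain ⟨i, l⟩ := p
        fin_cases i
        · refine ⟨HomogeneousLocalization.mk ⟨1,
            ⟨_, formElt_mem (wedge (B.coord (.inr l)) (B.coord (.inl 1)))⟩, ⟨_, chartElt_mem B⟩,
            Submonoid.mem_powers _⟩, ?_⟩
          rw [awayToPoly_mk]
          exact chartEval_inr_wedge B l
        · refine ⟨HomogeneousLocalization.mk ⟨1,
            ⟨_, formElt_mem (wedge (B.coord (.inl 0)) (B.coord (.inr l)))⟩, ⟨_, chartElt_mem B⟩,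
            Submonoid.mem_powers _⟩, ?_⟩
          rw [awayToPoly_mk]
          exact chartEval_wedge_inr B l
      obtain ⟨y, hy⟩ := hX
      exact ⟨x * y, by rw [map_mul, hy]⟩

/-- The degree zero part of the localization is a polynomial ring. -/
def awayEquiv : HomogeneousLocalization.Away (pluckerGrading k V) (chartElt B) ≃+*
    MvPolynomial (Fin 2 × Fin 5) k :=
  RingEquiv.ofBijective (awayToPoly B) (awayToPoly_bijective B)

end Chart
end Plucker

/-! ### The standard affine charts of the Grassmannian -/

section PluckerChart
variable {k V : Type u} [Field k] [AddCommGroup V] [Module k V] [Infinite k]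
  (B : Module.Basis (Fin 2 ⊕ Fin 5) k V)

lemma appLE_top_comp {X Y Z : Scheme.{u}} (f : X ⟶ Y) (g : Y ⟶ Z) (h : X ⟶ Z) (hfg : f ≫ g = h)
    (U : Z.Opens) (e : ⊤ ≤ h ⁻¹ᵁ U) (e' : ⊤ ≤ g ⁻¹ᵁ U) :
    h.appLE U ⊤ e = g.appLE U ⊤ e' ≫ f.appTop := by
  subst hfg
  rw [← Scheme.Hom.appLE_comp_appLE f g U ⊤ ⊤ e' le_rfl]
  congr 1
  exact Scheme.Hom.appLE_eq_app _

/-- The immersion is inverse to the isomorphism of the basic open set with its spectrum; cancelling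
that isomorphism leaves the known value of `Proj.basicOpenToSpec` on global sections. -/
lemma awayι_appLE (e) : Proj.awayToSection (pluckerGrading k V) (chartElt B) ≫
    (Proj.awayι (pluckerGrading k V) (chartElt B) (chartElt_mem B) one_pos).appLE
      (Proj.basicOpen (pluckerGrading k V) (chartElt B)) ⊤ e = (Scheme.ΓSpecIso _).inv := by
  set g := Proj.awayι (pluckerGrading k V) (chartElt B) (chartElt_mem B) one_pos
  set f := Proj.basicOpenToSpec (pluckerGrading k V) (chartElt B) with hf
  have hiso : IsIso f := by
    rw [hf, ← Proj.basicOpenIsoSpec_hom _ _ (chartElt_mem B) one_pos]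
    infer_instance
  have hfg : f ≫ g = (Proj.basicOpen (pluckerGrading k V) (chartElt B)).ι := by
    rw [hf, ← Proj.basicOpenIsoSpec_hom _ _ (chartElt_mem B) one_pos]
    exact Iso.hom_inv_id_assoc _ _
  have htop : ⊤ ≤ (Proj.basicOpen (pluckerGrading k V) (chartElt B)).ι ⁻¹ᵁ
      Proj.basicOpen (pluckerGrading k V) (chartElt B) := by simp
  have hmono : IsIso f.appTop := inferInstanceAs (IsIso (f.app ⊤))
  refine (cancel_mono f.appTop).1 ((Category.assoc _ _ _).trans ?_)
  refine (congrArg (_ ≫ ·) (appLE_top_comp f g _ hfg _ htop e).symm).trans ?_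
  refine Eq.trans ?_ ((congrArg (_ ≫ ·) (Proj.basicOpenToSpec_app_top _ _)).trans
    (Iso.inv_hom_id_assoc (Scheme.ΓSpecIso _) _)).symm
  congr 1

variable [IsAlgClosed k]

/-- The isomorphism of the chart with the affine space. -/
def awayIso : CommRingCat.of (HomogeneousLocalization.Away (pluckerGrading k V) (chartElt B)) ≅
    ChartRing k := (awayEquiv B).toCommRingCatIso

/-- The standard chart of the Grassmannian attached to a basis. -/
def chart : Spec (ChartRing k) ⟶ Gr k V :=
  Spec.map (awayIso B).hom ≫ Proj.awayι (pluckerGrading k V) (chartElt B) (chartElt_mem B) one_pos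

instance : IsOpenImmersion (chart B) := IsOpenImmersion.comp _ _

lemma opensRange_chart : (chart B).opensRange = Proj.basicOpen (pluckerGrading k V) (chartElt B) :=
  (Scheme.Hom.opensRange_comp_of_isIso _ _).trans (Proj.opensRange_awayι _ _ _ _)

lemma image_top_chart : chart B ''ᵁ ⊤ ≤ Proj.basicOpen (pluckerGrading k V) (chartElt B) := by
  rw [← opensRange_chart]
  exact (Scheme.Hom.image_top_eq_opensRange _).le

lemma mem_range_chart (x : Gr k V) :
    x ∈ Set.range (chart B) ↔ chartElt B ∉ x.asHomogeneousIdeal := by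
  rw [← Proj.mem_basicOpen, ← opensRange_chart]
  rfl

lemma chart_toSpec : chart B ≫ Gr.toSpec k V = Spec.map (CommRingCat.ofHom MvPolynomial.C) := by
  rw [chart, Gr.toSpec, Category.assoc, Proj.awayι_toSpecZero_assoc, ← Spec.map_comp,
    ← Spec.map_comp]
  congr 1
  refine CommRingCat.hom_ext (RingHom.ext fun c => ?_)
  exact (awayToPoly_mk B ⟨0, algebraMap k _ c, 1, Submonoid.one_mem _⟩).trans
    ((chartEval B).commutes c)

/-- The chart is the slice where the chart form equals 1, so the fraction `g / chartElt B` reads as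
the polynomial of `g`. -/
lemma chartRingIso_projFrac {g : PluckerRing k V} (hg : g ∈ pluckerGrading k V 1) :
    chartRingIso (chart B) ((Gr k V).presheaf.map (homOfLE (image_top_chart B)).op
      (projFrac (chartElt_mem B) hg)) = chartEval B g := by
  have e1 : (⊤ : (Spec (CommRingCat.of (HomogeneousLocalization.Away (pluckerGrading k V)
      (chartElt B)))).Opens) ≤
      Proj.awayι (pluckerGrading k V) (chartElt B) (chartElt_mem B) one_pos ⁻¹ᵁ
        Proj.basicOpen (pluckerGrading k V) (chartElt B) := by
    rw [← Proj.opensRange_awayι (pluckerGrading k V) (chartElt B) (chartElt_mem B) one_pos]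
    simp
  have h : Proj.awayToSection (pluckerGrading k V) (chartElt B) ≫
      (Gr k V).presheaf.map (homOfLE (image_top_chart B)).op ≫
      ((chart B).appIso ⊤).hom ≫ (Scheme.ΓSpecIso _).hom = (awayIso B).hom := by
    rw [Scheme.Hom.appIso_hom', Scheme.Hom.map_appLE_assoc]
    rw [appLE_top_comp _ _ (chart B) rfl _ _ e1, Category.assoc, reassoc_of% (awayι_appLE B e1),
      Scheme.ΓSpecIso_naturality, Iso.inv_hom_id_assoc]
  have h3 := congr($h (HomogeneousLocalization.mk ⟨1, ⟨g, hg⟩, ⟨chartElt B, chartElt_mem B⟩,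
    ⟨1, pow_one _⟩⟩))
  refine Eq.trans h3 ?_
  exact awayToPoly_mk B _

lemma chart_mem_basicOpen (y : Spec (ChartRing k)) {n : ℕ} (hn : 0 < n) {g : PluckerRing k V}
    (hg : g ∈ pluckerGrading k V n) :
    g ∈ (chart B y).asHomogeneousIdeal ↔ chartEval B g ∈ y.asIdeal := by
  rw [← not_iff_not, ← Proj.mem_basicOpen]
  have h1 := Proj.awayι_preimage_basicOpen (pluckerGrading k V) (chartElt_mem B) one_pos hg hn
  have h2 : chart B y ∈ Proj.basicOpen (pluckerGrading k V) g ↔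
    Spec.map (awayIso B).hom y ∈
      Proj.awayι (pluckerGrading k V) (chartElt B) (chartElt_mem B) one_pos ⁻¹ᵁ
      Proj.basicOpen (pluckerGrading k V) g := Iff.rfl
  rw [h2, h1]
  refine not_congr ?_
  change awayToPoly B _ ∈ y.asIdeal ↔ _
  erw [awayToPoly_mk]
  simp

end PluckerChart

/-! ### Functionals and frames of the three kinds of bundles -/

section Forms
variable {k V : Type u} [Field k] [AddCommGroup V] [Module k V]

/-- A linear form on `W` as a linear form on `A ⊗ W`. -/
def polyForm {W : Type u} [AddCommGroup W] [Module k W] (ξ : Module.Dual k W) :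
    PolyMap k V W →ₗ[PluckerRing k V] PluckerRing k V where
  toFun F := ⟨fun v => ξ (F.toFun v), F.2 ξ⟩
  map_add' F G := plucker_ext fun v => map_add ξ (F.toFun v) (G.toFun v)
  map_smul' a F := plucker_ext fun v => map_smul ξ (a.toFun v) (F.toFun v)

lemma polyForm_toFun {W : Type u} [AddCommGroup W] [Module k W] (ξ : Module.Dual k W)
    (F : PolyMap k V W) (v : Fin 2 → V) : (polyForm ξ F).toFun v = ξ (F.toFun v) := rfl

lemma polyForm_mem {W : Type u} [AddCommGroup W] [Module k W] (ξ : Module.Dual k W) (i : ℕ)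
    (F : PolyMap k V W) (hF : F ∈ polyMapGrading k V W i) :
    polyForm ξ F ∈ pluckerGrading k V i := fun c v => by
  rw [polyForm_toFun, polyForm_toFun, hF, map_smul, smul_eq_mul]

/-- The element `F ⊗ w` of `A ⊗ W`. -/
def polyMk {W : Type u} [AddCommGroup W] [Module k W] (F : PluckerRing k V) (w : W) :
    PolyMap k V W :=
  ⟨fun v => F.toFun v • w, fun ξ => by
    simpa only [map_smul, smul_eq_mul, mul_comm] using! Subalgebra.smul_mem _ F.2 (ξ w)⟩

lemma polyMk_toFun {W : Type u} [AddCommGroup W] [Module k W] (F : PluckerRing k V) (w : W)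
    (v : Fin 2 → V) : (polyMk F w).toFun v = F.toFun v • w := rfl

lemma polyMk_mem {W : Type u} [AddCommGroup W] [Module k W] {i : ℕ} {F : PluckerRing k V}
    (hF : F ∈ pluckerGrading k V i) (w : W) : polyMk F w ∈ polyMapGrading k V W i := fun c v => by
  rw [polyMk_toFun, polyMk_toFun, hF, mul_smul]

/-- A linear form on `V` as a linear form on the module of the tautological bundle. -/
def tautForm (η : Module.Dual k V) : tautModule k V →ₗ[PluckerRing k V] PluckerRing k V :=
  polyForm η ∘ₗ (tautModule k V).subtype

lemma tautForm_mem (η : Module.Dual k V) (i : ℕ) (F : tautModule k V)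
    (hF : F ∈ tautGrading k V i) : tautForm η F ∈ pluckerGrading k V i :=
  polyForm_mem η i F.1 hF

lemma mulForm_mem {ω : PluckerRing k V} (hω : ω ∈ pluckerGrading k V 1) (i : ℕ)
    (F : PluckerRing k V) (hF : F ∈ twistGrading k V (-1) i) :
    LinearMap.mulLeft (PluckerRing k V) ω F ∈ pluckerGrading k V i := by
  unfold twistGrading at hF
  split_ifs at hF with h
  · have h' : 1 + ((i : ℤ) + -1).toNat = i := by omega
    have := SetLike.mul_mem_graded hω hF
    rwa [h'] at this
  · rw [AddSubgroup.mem_bot] at hF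
    subst hF
    rw [map_zero]
    exact zero_mem _

/-- The unit has degree 1 in `A(-1)`; dividing it by the chart form generates `𝒪(-1)` on the chart.
-/
lemma one_mem_twist : (1 : PluckerRing k V) ∈ twistGrading k V (-1) 1 := by
  unfold twistGrading
  rw [if_pos (by norm_num)]
  exact (inferInstance : SetLike.GradedMonoid (pluckerGrading k V)).one_mem

/-- The sections `β(v₁) v₀ - β(v₀) v₁` of the tautological bundle. -/
def tautElt (β : Module.Dual k V) : tautModule k V :=
  ⟨⟨fun v => β (v 1) • v 0 - β (v 0) • v 1, fun ξ => by
    have h : (fun v : Fin 2 → V => ξ (β (v 1) • v 0 - β (v 0) • v 1)) = wedge ξ β := by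
      funext v
      rw [wedge_apply, map_sub, map_smul, map_smul, smul_eq_mul, smul_eq_mul]
      ring
    rw [h]
    exact (formElt (wedge ξ β)).2⟩, fun v => sub_mem
      (Submodule.smul_mem _ _ (Submodule.subset_span ⟨0, rfl⟩))
      (Submodule.smul_mem _ _ (Submodule.subset_span ⟨1, rfl⟩))⟩

lemma tautElt_toFun (β : Module.Dual k V) (v : Fin 2 → V) :
    (tautElt β).1.toFun v = β (v 1) • v 0 - β (v 0) • v 1 := rfl

lemma tautElt_mem (β : Module.Dual k V) : tautElt β ∈ tautGrading k V 1 := fun c v => by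
  change (tautElt β).1.toFun (c • v) = c ^ (2 * 1) • (tautElt β).1.toFun v
  simp only [tautElt_toFun, Pi.smul_apply, map_smul, smul_sub, smul_smul, smul_eq_mul]
  congr 2 <;> ring

lemma tautForm_tautElt (η β : Module.Dual k V) :
    tautForm η (tautElt β) = formElt (wedge η β) := plucker_ext fun v => by
  refine (polyForm_toFun _ _ _).trans ?_
  rw [formElt_toFun, wedge_apply]
  refine (congrArg η (tautElt_toFun β v)).trans ?_
  rw [map_sub, map_smul, map_smul, smul_eq_mul, smul_eq_mul]
  ring

variable (B : Module.Basis (Fin 2 ⊕ Fin 5) k V)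

/-- The basis of the tautological bundle on a chart, up to denominators. -/
def tautVec : Fin 2 → tautModule k V := ![tautElt (B.coord (.inl 1)), -tautElt (B.coord (.inl 0))]

lemma tautVec_mem (i : Fin 2) : tautVec B i ∈ tautGrading k V 1 := by
  fin_cases i
  · exact tautElt_mem _
  · exact neg_mem (tautElt_mem _)

variable [Infinite k]

/-- The functional on the trivial bundle given by a linear form. -/
def trivFunctional {W : Type u} [AddCommGroup W] [Module k W] (ξ : Module.Dual k W) :
    Gr.trivialBundle k V W ⟶ structureSheafModule (Gr k V) :=
  projFunctional (polyForm ξ) (polyForm_mem ξ)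

/-- The functional on the tautological bundle given by a linear form. -/
def tautFunctional (η : Module.Dual k V) :
    Gr.tautologicalBundle k V ⟶ structureSheafModule (Gr k V) :=
  projFunctional (tautForm η) (tautForm_mem η)

/-- The functional on `𝒪(-1)` given by a two-form. -/
def twistFunctional (ω : V [⋀^Fin 2]→ₗ[k] k) :
    Gr.twist k V (-1) ⟶ structureSheafModule (Gr k V) :=
  projFunctional (LinearMap.mulLeft _ (formElt ω)) (mulForm_mem (formElt_mem ω))

/-- The value of a linear form on a vector of the basis of the universal plane. -/
def planeVal (η : Module.Dual k V) : Fin 2 → MvPolynomial (Fin 2 × Fin 5) k :=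
  ![chartEval B (formElt (wedge η (B.coord (.inl 1)))),
    chartEval B (formElt (wedge (B.coord (.inl 0)) η))]

lemma planeVal_inr (l : Fin 5) (i : Fin 2) :
    planeVal B (B.coord (.inr l)) i = MvPolynomial.X (i, l) := by
  fin_cases i
  · exact chartEval_inr_wedge B l
  · exact chartEval_wedge_inr B l

/-- The frame of a trivial bundle on a chart. -/
def trivFrame {W : Type u} [AddCommGroup W] [Module k W] {I : Type*} [Fintype I] [DecidableEq I]
    (w : Module.Basis I k W) :
    Frame (Gr.trivialBundle k V W) (Proj.basicOpen (pluckerGrading k V) (chartElt B)) I :=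
  projFrame (chartElt_mem B) (fun i => polyMk (chartElt B) (w i))
    (fun i => polyMk_mem (chartElt_mem B) (w i)) (fun i => polyForm (w.coord i))
    (fun i => polyForm_mem (w.coord i)) (fun i j => plucker_ext fun v => by
      rw [polyForm_toFun, polyMk_toFun, map_smul, w.coord_apply, w.repr_self, Finsupp.single_apply]
      simp only [eq_comm (a := i)]
      split_ifs <;> simp) fun F => PolyMap.ext fun v => by
      rw [PolyMap.smul_toFun, map_sum, Finset.sum_apply]
      simp only [PolyMap.smul_toFun, polyForm_toFun, polyMk_toFun, w.coord_apply]
      conv_lhs => rw [← w.sum_repr (F.toFun v), Finset.smul_sum]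
      exact Finset.sum_congr rfl fun i _ => smul_comm _ _ _

/-- The frame of `𝒪(-1)` on a chart. -/
def twistFrame :
    Frame (Gr.twist k V (-1)) (Proj.basicOpen (pluckerGrading k V) (chartElt B)) Unit :=
  projFrame (chartElt_mem B) (fun _ => 1) (fun _ => one_mem_twist)
    (fun _ => LinearMap.mulLeft _ (chartElt B)) (fun _ => mulForm_mem (chartElt_mem B))
    (fun _ _ => by simp) fun F => by simp

/-- The frame of the tautological bundle on a chart. -/
def tautFrame :
    Frame (Gr.tautologicalBundle k V) (Proj.basicOpen (pluckerGrading k V) (chartElt B)) (Fin 2) :=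
  projFrame (chartElt_mem B) (tautVec B) (tautVec_mem B)
    (fun i => tautForm (B.coord (.inl i))) (fun i => tautForm_mem _)
    (fun i j => plucker_ext fun v => by
      fin_cases i <;> fin_cases j <;>
        simp [tautVec, tautForm_tautElt, chartElt] <;> ring) fun F => Subtype.ext (PolyMap.ext fun
            v => by
      -- The expansion is Cramer's rule for a vector in the span of `v 0` and `v 1`; it rests on the
      -- condition that defines the tautological module.
      obtain ⟨c, hc⟩ := (Submodule.mem_span_range_iff_exists_fun k).1 (F.2 v)
      rw [Fin.sum_univ_two] at hc
      have h (i : Fin 2) : (tautForm (B.coord (.inl i)) F).toFun v =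
        c 0 * B.coord (.inl i) (v 0) + c 1 * B.coord (.inl i) (v 1) := by
        refine (congrArg (B.coord (.inl i)) hc.symm).trans ?_
        rw [map_add, map_smul, map_smul, smul_eq_mul, smul_eq_mul]
      rw [Fin.sum_univ_two]
      change (chartElt B).toFun v • F.1.toFun v =
        (tautForm (B.coord (.inl 0)) F).toFun v • (B.coord (.inl 1) (v 1) • v 0 -
          B.coord (.inl 1) (v 0) • v 1) + (tautForm (B.coord (.inl 1)) F).toFun v •
          -(B.coord (.inl 0) (v 1) • v 0 - B.coord (.inl 0) (v 0) • v 1)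
      rw [h, h, ← hc, chartElt, formElt_toFun, wedge_apply]
      module)

variable [IsAlgClosed k]

/-- The value on the chart of a functional at a section over the basic open set. -/
def chartVal {M : (Gr k V).Modules} (Φ : M ⟶ structureSheafModule (Gr k V))
    (s : Γ(M, Proj.basicOpen (pluckerGrading k V) (chartElt B))) :
    MvPolynomial (Fin 2 × Fin 5) k :=
  chartRingIso (chart B) (ev Φ _ (res M (image_top_chart B) s))

lemma chartVal_eq {M : (Gr k V).Modules} (Φ : M ⟶ structureSheafModule (Gr k V))
    (s : Γ(M, Proj.basicOpen (pluckerGrading k V) (chartElt B))) :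
    chartVal B Φ s = chartRingIso (chart B)
      ((Gr k V).presheaf.map (homOfLE (image_top_chart B)).op (ev Φ _ s)) := by
  rw [chartVal, ev_res]

lemma chartVal_triv {W : Type u} [AddCommGroup W] [Module k W] {I : Type*} [Fintype I]
    [DecidableEq I] (w : Module.Basis I k W) (ξ : Module.Dual k W) (i : I) :
    chartVal B (trivFunctional ξ) ((trivFrame B w).b i) = MvPolynomial.C (ξ (w i)) := by
  rw [chartVal_eq]
  refine (congrArg (fun r => chartRingIso (chart B)
      ((Gr k V).presheaf.map (homOfLE (image_top_chart B)).op r))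
    (ev_modFrac (polyForm ξ) (polyForm_mem ξ) (chartElt_mem B) (polyMk_mem (chartElt_mem B) (w
        i)))).trans ?_
  rw [chartRingIso_projFrac]
  have : polyForm ξ (polyMk (chartElt B) (w i)) = algebraMap k _ (ξ (w i)) * chartElt B :=
    plucker_ext fun v => by
      rw [polyForm_toFun, polyMk_toFun]
      simp [mul_comm]
  rw [this, map_mul, chartEval_chartElt, mul_one]
  exact (chartEval B).commutes _

lemma chartVal_twist (ω : V [⋀^Fin 2]→ₗ[k] k) :
    chartVal B (twistFunctional ω) ((twistFrame B).b ()) = chartEval B (formElt ω) := by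
  rw [chartVal_eq]
  refine (congrArg (fun r => chartRingIso (chart B)
      ((Gr k V).presheaf.map (homOfLE (image_top_chart B)).op r))
    (ev_modFrac _ (mulForm_mem (formElt_mem ω)) (chartElt_mem B) one_mem_twist)).trans ?_
  rw [chartRingIso_projFrac, LinearMap.mulLeft_apply, mul_one]

lemma chartVal_taut (η : Module.Dual k V) (i : Fin 2) :
    chartVal B (tautFunctional η) ((tautFrame B).b i) = planeVal B η i := by
  rw [chartVal_eq]
  refine (congrArg (fun r => chartRingIso (chart B)
      ((Gr k V).presheaf.map (homOfLE (image_top_chart B)).op r))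
    (ev_modFrac _ (tautForm_mem η) (chartElt_mem B) (tautVec_mem B i))).trans ?_
  rw [chartRingIso_projFrac]
  fin_cases i
  · exact congrArg (chartEval B) (tautForm_tautElt η _)
  · refine congrArg (chartEval B) (((map_neg (tautForm η) _).trans
      (congrArg _ (tautForm_tautElt η _))).trans (plucker_ext fun v => ?_))
    simp
    ring

end Forms

/-! ### Charts adapted to `K` cover the Grassmannian -/

section Cover
variable {k V : Type u} [Field k] [AddCommGroup V] [Module k V]
  (C : Module.Basis (Fin 3 ⊕ Fin 4) k V)

lemma formElt_wedge_swap (α β : Module.Dual k V) :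
    formElt (wedge α β) = -formElt (wedge β α) := plucker_ext fun v => by simp; ring

lemma formElt_wedge_add_left (α α' β : Module.Dual k V) :
    formElt (wedge (α + α') β) = formElt (wedge α β) + formElt (wedge α' β) :=
  plucker_ext fun v => by simp; ring

lemma formElt_wedge_add_right (α β β' : Module.Dual k V) :
    formElt (wedge α (β + β')) = formElt (wedge α β) + formElt (wedge α β') :=
  plucker_ext fun v => by simp; ring

/-- A pair of coordinates on a three-dimensional subspace, extended to the whole space, belongs to
a basis with prescribed equations of the subspace. -/
lemma exists_adapted_basis (i j m : Fin 3) (hijm : ∀ l, l = i ∨ l = j ∨ l = m)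
    (ξ ξ' : Module.Dual k V) (hξ : ∀ v, (∀ l, C.coord (.inr l) v = 0) → ξ v = 0)
    (hξ' : ∀ v, (∀ l, C.coord (.inr l) v = 0) → ξ' v = 0) :
    ∃ B : Module.Basis (Fin 2 ⊕ Fin 5) k V, B.coord (.inl 0) = C.coord (.inl i) + ξ ∧
      B.coord (.inl 1) = C.coord (.inl j) + ξ' ∧
      ∀ l : Fin 4, B.coord (.inr l.castSucc) = C.coord (.inr l) := by
  -- The equations of `K` fill the first four columns; the remaining coordinate on `K` fills the
  -- fifth.
  let F : Fin 2 ⊕ Fin 5 → Module.Dual k V :=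
    Sum.elim ![C.coord (.inl i) + ξ, C.coord (.inl j) + ξ']
      (Fin.snoc (α := fun _ => Module.Dual k V) (fun l : Fin 4 => C.coord (.inr l))
        (C.coord (.inl m)))
  let T : V →ₗ[k] (Fin 2 ⊕ Fin 5 → k) := LinearMap.pi F
  have hl (l : Fin 4) : F (.inr l.castSucc) = C.coord (.inr l) :=
    by simp [F]
  have hm : F (.inr (Fin.last 4)) = C.coord (.inl m) :=
    Fin.snoc_last (α := fun _ => Module.Dual k V) (C.coord (.inl m)) fun l : Fin 4 =>
      C.coord (.inr l)
  have hinj : Function.Injective T := by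
    rw [injective_iff_map_eq_zero]
    intro v hv
    have hv' (q) : F q v = 0 := congrFun hv q
    have h1 (l : Fin 4) : C.coord (.inr l) v = 0 := by rw [← hl]; exact hv' _
    have h2 : C.coord (.inl m) v = 0 := by rw [← hm]; exact hv' _
    have h3 : C.coord (.inl i) v = 0 := by
      have : C.coord (.inl i) v + ξ v = 0 := hv' (.inl 0)
      rwa [hξ v h1, add_zero] at this
    have h4 : C.coord (.inl j) v = 0 := by
      have : C.coord (.inl j) v + ξ' v = 0 := hv' (.inl 1)
      rwa [hξ' v h1, add_zero] at this
    refine C.forall_coord_eq_zero_iff.1 fun p => ?_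
    rcases p with p | p
    · rcases hijm p with rfl | rfl | rfl <;> assumption
    · exact h1 p
  have hfin : FiniteDimensional k V := C.finiteDimensional_of_finite
  have hdim : Module.finrank k V = Module.finrank k (Fin 2 ⊕ Fin 5 → k) := by
    rw [Module.finrank_eq_card_basis C]
    simp
  let e := LinearEquiv.ofInjectiveOfFinrankEq T hinj hdim
  have hc (q) : (Module.Basis.ofEquivFun e).coord q = F q := by
    ext v
    simp only [Module.Basis.coord_apply, Module.Basis.ofEquivFun_repr_apply]
    rfl
  exact ⟨.ofEquivFun e, hc _, hc _, fun l => (hc _).trans (hl l)⟩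

/-- The sum runs over ordered pairs, so every product of coordinate forms occurs twice. -/
lemma two_mul_form_apply {I : Type*} [Fintype I] [DecidableEq I] (C : Module.Basis I k V)
    (ω : V [⋀^Fin 2]→ₗ[k] k) (v : Fin 2 → V) :
    2 * ω v = ∑ p, ∑ q, ω ![C p, C q] * wedge (C.coord p) (C.coord q) v := by
  have hsw (x y : V) : ω ![x, y] = - ω ![y, x] := by
    rw [← ω.map_swap _ (i := 0) (j := 1) (by simp)]
    congr 1; funext i; fin_cases i <;> rfl
  have hexp (x y : V) : ω ![x, y] = ∑ p, ∑ q, ω ![C p, C q] * (C.coord p x * C.coord q y) := by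
    have u0 (a x y : V) : Function.update ![x, y] 0 a = ![a, y] := by
      funext i; fin_cases i <;> rfl
    have u1 (a x y : V) : Function.update ![x, y] 1 a = ![x, a] := by
      funext i; fin_cases i <;> rfl
    have h1 (y : V) : IsLinearMap k fun x => ω ![x, y] :=
      ⟨fun a b => by
          simpa only [u0] using ω.map_update_add ![a, y] 0 a b,
        fun c a => by
          simpa only [u0] using ω.map_update_smul ![a, y] 0 c a⟩
    have h2 (x : V) : IsLinearMap k fun y => ω ![x, y] :=
      ⟨fun a b => by
          simpa only [u1] using ω.map_update_add ![x, a] 1 a b,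
        fun c a => by
          simpa only [u1] using ω.map_update_smul ![x, a] 1 c a⟩
    have e1 := congrArg (IsLinearMap.mk' _ (h1 y)) (C.sum_repr x).symm
    rw [map_sum] at e1
    refine e1.trans (Finset.sum_congr rfl fun p _ => ?_)
    have e2 := congrArg (IsLinearMap.mk' _ (h2 (C p))) (C.sum_repr y).symm
    rw [map_sum] at e2
    rw [map_smul]
    refine (congrArg (C.repr x p • ·) e2).trans ?_
    rw [Finset.smul_sum]
    refine Finset.sum_congr rfl fun q _ => ?_
    rw [map_smul]
    change C.repr x p * (C.repr y q * ω ![C p, C q]) = ω ![C p, C q] * (C.repr x p * C.repr y q)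
    ring
  have hv : v = ![v 0, v 1] := by funext i; fin_cases i <;> rfl
  have h3 : 2 * ω v = ω ![v 0, v 1] - ω ![v 1, v 0] := by rw [hsw (v 1), ← hv]; ring
  rw [h3, hexp, hexp, ← Finset.sum_sub_distrib]
  refine Finset.sum_congr rfl fun p _ => ?_
  rw [← Finset.sum_sub_distrib]
  refine Finset.sum_congr rfl fun q _ => ?_
  rw [wedge_apply]
  ring

variable [Infinite k]

/-- Two-forms generate the ring over its degree zero part, so their basic open sets cover `Proj`. -/
lemma exists_formElt_notMem (x : Gr k V) : ∃ ω, formElt ω ∉ x.asHomogeneousIdeal := by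
  have h := Proj.iSup_basicOpen_eq_top' (pluckerGrading k V) (formElt (k := k) (V := V))
    (fun ω => ⟨1, formElt_mem ω⟩) (by
      refine eq_top_iff.2 fun F _ => ?_
      induction F using plucker_induction with
      | form ω => exact Algebra.subset_adjoin ⟨ω, rfl⟩
      | const c =>
        exact Subalgebra.algebraMap_mem (Algebra.adjoin (pluckerGrading k V 0) _)
          (algebraMap k (pluckerGrading k V 0) c)
      | add F G hF hG => exact add_mem (hF trivial) (hG trivial)
      | mul F G hF hG => exact mul_mem (hF trivial) (hG trivial))
  obtain ⟨ω, hω⟩ := Opens.mem_iSup.1 (h.ge (Opens.mem_top x))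
  exact ⟨ω, hω⟩

/-- Two coordinates on `K` may be altered by any equations of `K` without leaving the adapted bases.
If all the resulting two-forms lay in the prime of `x`, then by bilinearity so would the product of
any two coordinates of `C`. As 2 is invertible these span the two-forms, which cannot all vanish at
a point of `Proj`. -/
lemma exists_chart_basis [CharZero k] (x : Gr k V) :
    ∃ B : Module.Basis (Fin 2 ⊕ Fin 5) k V,
      (∀ l : Fin 4, B.coord (.inr l.castSucc) = C.coord (.inr l)) ∧
      chartElt B ∉ x.asHomogeneousIdeal := by
  by_contra! H
  let a (i : Fin 3) := C.coord (.inl i)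
  have good (i j m : Fin 3) (hijm : ∀ l, l = i ∨ l = j ∨ l = m)
      (ξ ξ' : Module.Dual k V) (hξ : ∀ v, (∀ l, C.coord (.inr l) v = 0) → ξ v = 0)
      (hξ' : ∀ v, (∀ l, C.coord (.inr l) v = 0) → ξ' v = 0) :
      formElt (wedge (a i + ξ) (a j + ξ')) ∈ x.asHomogeneousIdeal.toIdeal := by
    obtain ⟨B, h0, h1, hl⟩ := exists_adapted_basis C i j m hijm ξ ξ' hξ hξ'
    have := H B hl
    rwa [chartElt, h0, h1] at this
  have third (i j : Fin 3) (h : i ≠ j) : ∃ m : Fin 3, ∀ l, l = i ∨ l = j ∨ l = m := by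
    revert i j; decide
  have hz (v : V) (_ : ∀ l, C.coord (.inr l) v = 0) : (0 : Module.Dual k V) v = 0 := rfl
  have hc (l : Fin 4) (v : V) (h : ∀ l, C.coord (.inr l) v = 0) : C.coord (.inr l) v = 0 := h l
  have hll (i j : Fin 3) : formElt (wedge (a i) (a j)) ∈ x.asHomogeneousIdeal.toIdeal := by
    by_cases h : i = j
    · have : formElt (wedge (a i) (a j)) = 0 := plucker_ext fun v => by
        subst h
        simp
        ring
      rw [this]
      exact zero_mem _
    · obtain ⟨m, hm⟩ := third i j h
      simpa using good i j m hm 0 0 hz hz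
  have hlr (i : Fin 3) (l : Fin 4) :
      formElt (wedge (a i) (C.coord (.inr l))) ∈ x.asHomogeneousIdeal.toIdeal := by
    obtain ⟨j, hj⟩ : ∃ j, i ≠ j := by revert i; decide
    obtain ⟨m, hm⟩ := third i j hj
    have h1 := good i j m hm 0 _ hz (hc l)
    rw [add_zero, formElt_wedge_add_right] at h1
    exact (Ideal.add_mem_iff_right _ (hll i j)).1 h1
  have hrr (l l' : Fin 4) :
      formElt (wedge (C.coord (.inr l)) (C.coord (.inr l'))) ∈ x.asHomogeneousIdeal.toIdeal := by
    obtain ⟨m, hm⟩ := third 0 1 (by decide)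
    have h1 := good 0 1 m hm _ _ (hc l) (hc l')
    rw [formElt_wedge_add_right, formElt_wedge_add_left, formElt_wedge_add_left] at h1
    have h2 : formElt (wedge (C.coord (.inr l)) (a 1)) ∈ x.asHomogeneousIdeal.toIdeal := by
      rw [formElt_wedge_swap]
      exact neg_mem (hlr 1 l)
    exact (Ideal.add_mem_iff_right _ (hlr 0 l')).1
      ((Ideal.add_mem_iff_right _ (add_mem (hll 0 1) h2)).1 h1)
  have hall (p q) : formElt (wedge (C.coord p) (C.coord q)) ∈ x.asHomogeneousIdeal.toIdeal := by
    rcases p with p | p <;> rcases q with q | q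
    · exact hll p q
    · exact hlr p q
    · rw [formElt_wedge_swap]
      exact neg_mem (hlr q p)
    · exact hrr p q
  obtain ⟨ω, hω⟩ := exists_formElt_notMem x
  apply hω
  have h2 : formElt ω = ∑ p, ∑ q, algebraMap k (PluckerRing k V) (2⁻¹ * ω ![C p, C q]) *
      formElt (wedge (C.coord p) (C.coord q)) := by
    refine plucker_ext fun v => ?_
    have h3 : ω v = 2⁻¹ * (2 * ω v) := by rw [← mul_assoc, inv_mul_cancel₀ two_ne_zero, one_mul]
    simp only [map_sum, map_mul, Finset.sum_apply, Pi.mul_apply, AlgHom.commutes, formElt_toFun]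
    rw [h3, two_mul_form_apply C, Finset.mul_sum]
    refine Finset.sum_congr rfl fun p _ => ?_
    rw [Finset.mul_sum]
    refine Finset.sum_congr rfl fun q _ => ?_
    rw [← mul_assoc]
    rfl
  change formElt ω ∈ x.asHomogeneousIdeal.toIdeal
  rw [h2]
  exact sum_mem fun p _ => sum_mem fun q _ => Ideal.mul_mem_left _ _ (hall p q)

end Cover

/-! ### Syzygies of the generic 2 × 4 matrix -/

section Syzygies

/-- The minors of a two-rowed matrix. -/
def minor {R I : Type*} [CommRing R] (x y : I → R) (a b : I) : R := x a * y b - x b * y a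

/-- Relations `x ∧ u + y ∧ v = 0` over a domain, for a two-rowed matrix with a prime minor that does
not divide some other minor. -/
lemma exists_of_wedge_eq_zero {R I : Type*} [CommRing R] [IsDomain R] {x y u v : I → R}
    (h : ∀ a b, x a * u b - x b * u a + (y a * v b - y b * v a) = 0) {a b c d : I}
    (hp : Prime (minor x y a b)) (hnd : ¬ minor x y a b ∣ minor x y c d) :
    ∃ s t r : R, (∀ j, u j = s * x j + t * y j) ∧ ∀ j, v j = t * x j + r * y j := by
  -- Cramer's rule on columns `a` and `b` puts `u`, and likewise `v`, in the row span up to the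
  -- denominator `minor x y a b`.
  have hu (j) : minor x y a b * u j =
      (u a * y b - u b * y a) * x j + (x a * u b - x b * u a) * y j := by
    rw [minor]
    linear_combination -y j * h a b - y a * h b j + y b * h a j
  have hv (j) : minor x y a b * v j =
      (v a * y b - v b * y a) * x j + (x a * v b - x b * v a) * y j := by
    rw [minor]
    linear_combination x j * h a b + x a * h b j - x b * h a j
  -- The coefficient of `y` in `u` is the coefficient of `x` in `v`: this is why one `t` serves
  -- both, and why the kernel is parametrized by a divided square.
  have hβ : x a * u b - x b * u a = v a * y b - v b * y a := by linear_combination h a b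
  -- Eliminating `y` between columns `c` and `d` shows that the prime minor divides `f * minor x y c
  -- d`, hence `f`.
  have dvd_fst {f g : R} (w : I → R) (h : ∀ j, minor x y a b * w j = f * x j + g * y j) :
      minor x y a b ∣ f := by
    refine (hp.dvd_or_dvd (b := minor x y c d) ⟨w c * y d - w d * y c, ?_⟩).resolve_right hnd
    rw [minor.eq_def x y c d]
    linear_combination - y d * h c + y c * h d
  have dvd_snd {f g : R} (w : I → R) (h : ∀ j, minor x y a b * w j = f * x j + g * y j) :
      minor x y a b ∣ g := by
    refine (hp.dvd_or_dvd (b := minor x y c d) ⟨x c * w d - x d * w c, ?_⟩).resolve_right hnd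
    rw [minor.eq_def x y c d]
    linear_combination x d * h c - x c * h d
  obtain ⟨s, hs⟩ := dvd_fst u hu
  obtain ⟨t, ht⟩ := dvd_snd u hu
  obtain ⟨r, hr⟩ := dvd_snd v hv
  refine ⟨s, t, r, fun j => mul_left_cancel₀ hp.ne_zero ?_,
    fun j => mul_left_cancel₀ hp.ne_zero ?_⟩
  · rw [hu, hs, ht]; ring
  · rw [hv, ← hβ, ht, hr]; ring

variable {k σ : Type*} [Field k]

open MvPolynomial in
lemma X_dvd_sub_aeval_update [DecidableEq σ] (i : σ) (f : MvPolynomial σ k) :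
    X i ∣ f - aeval (Function.update X i 0) f := by
  induction f using MvPolynomial.induction_on with
  | C a => simp
  | add p q hp hq => simpa [add_sub_add_comm] using dvd_add hp hq
  | mul_X p j hp =>
    by_cases h : j = i
    · subst h; simp
    · simpa [h, ← sub_mul] using hp.mul_right (X j)

open MvPolynomial in
lemma prime_X (i : σ) : Prime (X i : MvPolynomial σ k) := by
  rw [← UniqueFactorizationMonoid.irreducible_iff_prime]
  simpa using irreducible_mul_X_add (1 : MvPolynomial σ k) 0 i one_ne_zero (by simp) (by simp)
    isRelPrime_one_left

open MvPolynomial in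
-- The minor is linear in `X (j, b)`, with leading coefficient `X (i, a)` coprime to the remaining
-- term; it is therefore irreducible, and the polynomial ring is factorial.
lemma prime_minor_X {ι : Type*} (a b : ι) (hab : a ≠ b) (i j : Fin 2) (hij : i ≠ j) :
    Prime (X (i, a) * X (j, b) - X (i, b) * X (j, a) : MvPolynomial (Fin 2 × ι) k) := by
  classical
  rw [← UniqueFactorizationMonoid.irreducible_iff_prime, sub_eq_add_neg]
  refine irreducible_mul_X_add _ _ _ (X_ne_zero _) ?_ ?_ ?_
  · simp [vars_X, hij.symm]
  · rw [vars_neg]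
    intro h
    have := vars_mul _ _ h
    simp [vars_X, hij.symm, hab.symm] at this
  · rw [IsRelPrime.neg_right_iff]
    have hX : Irreducible (X (i, a) : MvPolynomial (Fin 2 × ι) k) := (prime_X _).irreducible
    rw [hX.isRelPrime_iff_not_dvd]
    intro h
    rcases (prime_X (k := k) (i, a)).dvd_or_dvd h with h | h
    · rw [X_dvd_X] at h
      simp [hab] at h
    · rw [X_dvd_X] at h
      simp [hij] at h

open MvPolynomial in
/-- Relations between three variables. -/
lemma koszul_three_variables (i j l : σ) (hij : i ≠ j) (hil : i ≠ l) (hjl : j ≠ l)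
    (f g h : MvPolynomial σ k) (H : X i * f + X j * g + X l * h = 0) :
    ∃ r s t : MvPolynomial σ k, f = X j * t - X l * s ∧ g = X l * r - X i * t ∧ h = X i * s - X j *
        r := by
  classical
  obtain ⟨s, hs⟩ := X_dvd_sub_aeval_update i h
  obtain ⟨r, hr⟩ := X_dvd_sub_aeval_update j (aeval (Function.update X i 0 : σ → MvPolynomial σ k)
      h)
  -- Setting `X i` and `X j` to zero in the relation leaves `X l` times the image of `h`, so `h`
  -- lies in the ideal of `X i` and `X j`.
  have h0 : aeval (Function.update X j 0 : σ → MvPolynomial σ k)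
      (aeval (Function.update X i 0 : σ → MvPolynomial σ k) h) =
      (0 : MvPolynomial σ k) := by
    have := congrArg (fun f => aeval (Function.update X j 0 : σ → MvPolynomial σ k)
      (aeval (Function.update X i 0 : σ → MvPolynomial σ k) f)) H
    simpa [hij, hij.symm, hil.symm, hjl.symm, X_ne_zero] using this
  rw [h0, sub_zero] at hr
  have hh : h = X i * s - X j * (-r) := by linear_combination hs + hr
  have H2 : X i * (f + X l * s) + X j * (g + X l * r) = 0 := by
    rw [hh] at H; linear_combination H
  have hd : X j ∣ f + X l * s := by
    refine ((prime_X j).dvd_or_dvd (a := X i) ⟨-(g + X l * r), ?_⟩).resolve_left ?_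
    · linear_combination H2
    · rw [X_dvd_X]; simp [hij.symm]
  obtain ⟨t, ht⟩ := hd
  refine ⟨-r, s, t, by linear_combination ht, mul_left_cancel₀ (X_ne_zero (R := k) j) ?_, hh⟩
  rw [ht] at H2
  linear_combination H2

/-- The rows of the generic `2 × 4` matrix. -/
def genRow (k : Type*) [Field k] (i : Fin 2) (j : Fin 4) : MvPolynomial (Fin 2 × Fin 5) k :=
  MvPolynomial.X (i, j.castSucc)

/-- Substitution of the minors with a column index `0` for the other entries of the second row. -/
def minorSubst (k : Type*) [Field k] :
    MvPolynomial (Fin 2 × Fin 5) k →ₐ[k] MvPolynomial (Fin 2 × Fin 5) k :=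
  MvPolynomial.aeval fun p => if p = (1, 1) ∨ p = (1, 2) ∨ p = (1, 3) then
    .X (0, 0) * .X p - .X (0, p.2) * .X (1, 0) else .X p

open MvPolynomial in
-- Where the coordinate `(0, 0)` is nonzero the substitution can be solved for the old variables, so
-- each such point `q` is the image of a point `p`. Thus `X (0, 0) * f` vanishes at every point.
lemma minorSubst_injective [Infinite k] (f : MvPolynomial (Fin 2 × Fin 5) k)
    (h : minorSubst k f = 0) : f = 0 := by
  refine (mul_eq_zero.1 (MvPolynomial.funext fun q => ?_ : X (0, 0) * f = 0)).resolve_left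
    (X_ne_zero _)
  by_cases hq : q (0, 0) = 0
  · simp [hq]
  · let p (i : Fin 2 × Fin 5) : k := if i = (1, 1) ∨ i = (1, 2) ∨ i = (1, 3) then
      (q i + q (0, i.2) * q (1, 0)) / q (0, 0) else q i
    have h1 : eval p (minorSubst k f) = eval q f := by
      have h2 : ((aeval p : _ →ₐ[k] k).comp (minorSubst k)) = aeval q := by
        refine algHom_ext fun i => ?_
        by_cases hi : i = (1, 1) ∨ i = (1, 2) ∨ i = (1, 3)
        · have h3 : p i = (q i + q (0, i.2) * q (1, 0)) / q (0, 0) := if_pos hi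
          have h4 : p (0, i.2) = q (0, i.2) := if_neg (by simp)
          have h5 : p (0, 0) = q (0, 0) := if_neg (by simp)
          have h6 : p (1, 0) = q (1, 0) := if_neg (by simp)
          simp only [AlgHom.comp_apply, minorSubst, aeval_X, if_pos hi, map_sub, map_mul, h3, h4,
            h5, h6]
          field_simp
          ring
        · simp only [AlgHom.comp_apply, minorSubst, aeval_X, if_neg hi, p]
      simpa [aeval_eq_eval] using DFunLike.congr_fun h2 f
    rw [map_mul, ← h1, h, map_zero, mul_zero, map_zero]

open MvPolynomial in
-- The substitution becomes surjective once `X (0, 0)` is inverted, since `X (0, 0) * X (1, j)` is a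
-- minor plus `X (0, j) * X (1, 0)`.
lemma exists_minorSubst_eq (f : MvPolynomial (Fin 2 × Fin 5) k) :
    ∃ (n : ℕ) (g : _), X (0, 0) ^ n * f = minorSubst k g := by
  induction f using MvPolynomial.induction_on with
  | C a => exact ⟨0, C a, by simp [minorSubst]⟩
  | add p q hp hq =>
    obtain ⟨n, g, hg⟩ := hp
    obtain ⟨m, h, hh⟩ := hq
    refine ⟨n + m, X (0, 0) ^ m * g + X (0, 0) ^ n * h, ?_⟩
    have h0 : minorSubst k (X (0, 0)) = X (0, 0) := by simp [minorSubst]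
    rw [map_add, map_mul, map_mul, map_pow, map_pow, h0, ← hg, ← hh]
    ring
  | mul_X p i hp =>
    obtain ⟨n, g, hg⟩ := hp
    have h0 : minorSubst k (X (0, 0)) = X (0, 0) := by simp [minorSubst]
    have h1 : minorSubst k (X (1, 0)) = X (1, 0) := by simp [minorSubst]
    by_cases hi : i = (1, 1) ∨ i = (1, 2) ∨ i = (1, 3)
    · have h2 : minorSubst k (X i) = X (0, 0) * X i - X (0, i.2) * X (1, 0) := by
        simp [minorSubst, hi]
      have h3 : minorSubst k (X (0, i.2)) = X (0, i.2) := by simp [minorSubst]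
      refine ⟨n + 1, g * (X i + X (0, i.2) * X (1, 0)), ?_⟩
      rw [map_mul, map_add, map_mul, h1, h2, h3, ← hg]
      ring
    · have h2 : minorSubst k (X i) = X i := by simp [minorSubst, hi]
      exact ⟨n, g * X i, by rw [map_mul, h2, ← hg]; ring⟩

/-- The elements of the shape `x ∧ u + y ∧ v`. -/
def IsWedgeSum {R : Type*} [CommRing R] (x y : Fin 4 → R) (w : Fin 4 → Fin 4 → R) : Prop :=
  ∃ u v : Fin 4 → R, ∀ a b, w a b = x a * u b - x b * u a + (y a * v b - y b * v a)

open MvPolynomial in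
-- Modulo `X (0, 0)` the hypothesis reads `x ∧ u + y ∧ v = 0`, so there `u = s x + t y` and `v = t x
-- + r y`. Lifts of these combinations contribute zero to `x ∧ u + y ∧ v`; once they are subtracted,
-- `u` and `v` are divisible by `X (0, 0)`, which can be cancelled.
lemma isWedgeSum_of_mul (w : Fin 4 → Fin 4 → MvPolynomial (Fin 2 × Fin 5) k)
    (h : IsWedgeSum (genRow k 0) (genRow k 1) fun a b => X (0, 0) * w a b) :
    IsWedgeSum (genRow k 0) (genRow k 1) w := by
  obtain ⟨u, v, huv⟩ := h
  set x := genRow k 0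
  set y := genRow k 1
  let φ : MvPolynomial (Fin 2 × Fin 5) k →ₐ[k] MvPolynomial (Fin 2 × Fin 5) k :=
    aeval (Function.update X (0, 0) 0)
  have hφ (f : MvPolynomial (Fin 2 × Fin 5) k) :
      (X (0, 0) : MvPolynomial (Fin 2 × Fin 5) k) ∣ f - φ f := X_dvd_sub_aeval_update _ _
  have hX : φ (X (0, 0)) = 0 := by simp [φ]
  have h1 : ∃ s t r, (∀ j, φ (u j) = s * φ (x j) + t * φ (y j)) ∧
      ∀ j, φ (v j) = t * φ (x j) + r * φ (y j) := by
    refine exists_of_wedge_eq_zero (x := fun j => φ (x j)) (y := fun j => φ (y j))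
      (u := fun j => φ (u j)) (v := fun j => φ (v j)) (fun a b => ?_) (a := 1) (b := 2) (c := 0)
      (d := 3) ?_ ?_
    · have := congrArg φ (huv a b)
      rw [map_mul, hX, zero_mul] at this
      simpa using this.symm
    · have := prime_minor_X (k := k) (1 : Fin 5) 2 (by decide) 0 1 (by decide)
      convert this using 1
      simp [minor, φ, x, y, genRow]
    · rintro ⟨g, hg⟩
      -- At this point the minor of columns 1, 2 vanishes, while that of columns 0, 3 does not, even
      -- after setting `X (0, 0) = 0`.
      have := congrArg (eval fun p => if p = (0, 3) ∨ p = (1, 0) then (1 : k) else 0) hg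
      simp [minor, φ, x, y, genRow] at this
  obtain ⟨s, t, r, h2, h3⟩ := h1
  have h4 (j) : (X (0, 0) : MvPolynomial (Fin 2 × Fin 5) k) ∣ u j - (s * x j + t * y j) := by
    obtain ⟨a, ha⟩ := hφ (u j)
    obtain ⟨b, hb⟩ := hφ (x j)
    obtain ⟨c, hc⟩ := hφ (y j)
    exact ⟨a - s * b - t * c, by linear_combination ha + h2 j - s * hb - t * hc⟩
  have h5 (j) : (X (0, 0) : MvPolynomial (Fin 2 × Fin 5) k) ∣ v j - (t * x j + r * y j) := by
    obtain ⟨a, ha⟩ := hφ (v j)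
    obtain ⟨b, hb⟩ := hφ (x j)
    obtain ⟨c, hc⟩ := hφ (y j)
    exact ⟨a - t * b - r * c, by linear_combination ha + h3 j - t * hb - r * hc⟩
  choose u' hu' using h4
  choose v' hv' using h5
  refine ⟨u', v', fun a b => mul_left_cancel₀ (X_ne_zero (R := k) (0, 0)) ?_⟩
  refine (huv a b).trans ?_
  linear_combination x a * hu' b - x b * hu' a + y a * hv' b - y b * hv' a

open MvPolynomial in
/-- The Eagon–Northcott complex of the generic `2 × 4` matrix is exact at `⋀²`. -/
lemma isWedgeSum_of_sum_minor [Infinite k] (w : Fin 4 → Fin 4 → MvPolynomial (Fin 2 × Fin 5) k)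
    (hw : ∀ a, w a a = 0) (hw' : ∀ a b, w b a = - w a b)
    (h : w 0 1 * minor (genRow k 0) (genRow k 1) 2 3 - w 0 2 * minor (genRow k 0) (genRow k 1) 1 3 +
      w 0 3 * minor (genRow k 0) (genRow k 1) 1 2 + w 1 2 * minor (genRow k 0) (genRow k 1) 0 3 -
      w 1 3 * minor (genRow k 0) (genRow k 1) 0 2 + w 2 3 * minor (genRow k 0) (genRow k 1) 0 1 =
      0) :
    IsWedgeSum (genRow k 0) (genRow k 1) w := by
  have hdesc (n : ℕ) : IsWedgeSum (genRow k 0) (genRow k 1) (fun a b => X (0, 0) ^ n * w a b) →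
      IsWedgeSum (genRow k 0) (genRow k 1) w := by
    induction n with
    | zero => simp
    | succ n ih =>
      refine fun H => ih (isWedgeSum_of_mul _ ?_)
      simpa only [pow_succ', mul_assoc] using H
  set x := genRow k 0 with hx
  set y := genRow k 1 with hy
  -- `f` is `x 0 • w` minus `x ∧ w 0`: it agrees with `x 0 • w` up to a wedge with `x` and vanishes
  -- as soon as an index is 0, so the relation involves only the minors with column 0.
  let f (a b : Fin 4) := x 0 * w a b - x a * w 0 b + x b * w 0 a
  have hf : minor x y 0 1 * f 2 3 + minor x y 0 2 * (- f 1 3) + minor x y 0 3 * f 1 2 = 0 := by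
    simp only [minor] at h
    simp only [f, minor]
    linear_combination x 0 * h
  obtain ⟨n₁, g₁, hg₁⟩ := exists_minorSubst_eq (f 2 3)
  obtain ⟨n₂, g₂, hg₂⟩ := exists_minorSubst_eq (- f 1 3)
  obtain ⟨n₃, g₃, hg₃⟩ := exists_minorSubst_eq (f 1 2)
  have s0 : minorSubst k (X (0, 0)) = X (0, 0) := by simp [minorSubst]
  have s1 : minorSubst k (X (1, 1)) = minor x y 0 1 := by simp [minorSubst, minor, x, y, genRow]
  have s2 : minorSubst k (X (1, 2)) = minor x y 0 2 := by simp [minorSubst, minor, x, y, genRow]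
  have s3 : minorSubst k (X (1, 3)) = minor x y 0 3 := by simp [minorSubst, minor, x, y, genRow]
  have hx0 : x 0 = X (0, 0) := rfl
  -- `minorSubst` carries the variables `X (1, j)` to the minors with column 0, so the relation
  -- descends to three independent variables. The powers of `X (0, 0)` bring the three coefficients
  -- to the common exponent `n₁ + n₂ + n₃`.
  obtain ⟨r, s, t, e1, e2, e3⟩ := koszul_three_variables (k := k) ((1, 1) : Fin 2 × Fin 5) (1, 2)
    (1, 3) (by decide) (by decide) (by decide) (X (0, 0) ^ (n₂ + n₃) * g₁)
    (X (0, 0) ^ (n₁ + n₃) * g₂) (X (0, 0) ^ (n₁ + n₂) * g₃) (by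
      refine minorSubst_injective _ ?_
      simp only [map_add, map_mul, map_pow, s0, s1, s2, s3, ← hg₁, ← hg₂, ← hg₃]
      linear_combination X (0, 0) ^ (n₁ + n₂ + n₃) * hf)
  replace e1 := congrArg (minorSubst k) e1
  replace e2 := congrArg (minorSubst k) e2
  replace e3 := congrArg (minorSubst k) e3
  simp only [map_mul, map_sub, map_pow, s0, s1, s2, s3, ← hg₁, ← hg₂, ← hg₃] at e1 e2 e3
  refine hdesc (n₁ + n₂ + n₃ + 1) ?_
  let τ : Fin 4 → MvPolynomial (Fin 2 × Fin 5) k :=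
    ![0, minorSubst k r, minorSubst k s, minorSubst k t]
  -- The terms in `τ` contribute `τ b` times the minor of columns `0, a` minus `τ a` times the minor
  -- of columns `0, b`. This is the Koszul expression for the multiple of `f a b`; the terms in `w
  -- 0` restore the rest of `x 0 * w a b`.
  refine ⟨fun a => X (0, 0) ^ (n₁ + n₂ + n₃) * w 0 a - y 0 * τ a, fun a => x 0 * τ a, ?_⟩
  have hlt (a b : Fin 4) (hab : a < b) : X (0, 0) ^ (n₁ + n₂ + n₃ + 1) * w a b =
      x a * (X (0, 0) ^ (n₁ + n₂ + n₃) * w 0 b - y 0 * τ b) -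
        x b * (X (0, 0) ^ (n₁ + n₂ + n₃) * w 0 a - y 0 * τ a) +
        (y a * (x 0 * τ b) - y b * (x 0 * τ a)) := by
    have h0 : τ 0 = 0 := rfl
    have h1 : τ 1 = minorSubst k r := rfl
    have h2 : τ 2 = minorSubst k s := rfl
    have h3 : τ 3 = minorSubst k t := rfl
    by_cases ha : a = 0
    · subst ha
      rw [h0, hw, hx0]
      ring
    · obtain ⟨rfl, rfl⟩ | ⟨rfl, rfl⟩ | ⟨rfl, rfl⟩ :
          a = 1 ∧ b = 2 ∨ a = 1 ∧ b = 3 ∨ a = 2 ∧ b = 3 := by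
        revert a b; decide
      · rw [h1, h2]
        simp only [f, minor, hx0] at e3 ⊢
        linear_combination e3
      · rw [h1, h3]
        simp only [f, minor, hx0] at e2 ⊢
        linear_combination -e2
      · rw [h2, h3]
        simp only [f, minor, hx0] at e1 ⊢
        linear_combination e1
  intro a b
  beta_reduce
  rcases lt_trichotomy a b with hab | rfl | hab
  · exact hlt a b hab
  · rw [hw]; ring
  · rw [hw' b a]
    linear_combination -hlt b a hab

end Syzygies

/-! ### Contractions anticommute: the Eagon–Northcott maps form a complex -/

section Contraction
variable {R : Type u} [CommRing R] {F : Type u} [AddCommGroup F] [Module R F]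

lemma contraction_contraction (d d' : Module.Dual R F) (n : ℕ) (z : ⋀[R]^(n + 2) F) :
    contraction d n (contraction d' (n + 1) z) = - contraction d' n (contraction d (n + 1) z) :=
  Subtype.ext (CliffordAlgebra.contractLeft_comm _ _ _)

lemma contraction_self (d : Module.Dual R F) (n : ℕ) (z : ⋀[R]^(n + 2) F) :
    contraction d n (contraction d (n + 1) z) = 0 :=
  Subtype.ext (CliffordAlgebra.contractLeft_contractLeft _ _)

lemma contraction_sum_smul {I : Type*} [Fintype I] (c : I → R) (d : I → Module.Dual R F) (n : ℕ)
    (z : ⋀[R]^(n + 1) F) :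
    contraction (∑ i, c i • d i) n z = ∑ i, c i • contraction (d i) n z := by
  refine Subtype.ext ?_
  rw [Submodule.coe_sum]
  change CliffordAlgebra.contractLeft (Q := (0 : QuadraticForm R F)) _ _ = _
  rw [map_sum, LinearMap.sum_apply]
  refine Finset.sum_congr rfl fun i _ => ?_
  rw [map_smul]
  rfl

lemma enMap_enMap (r : Fin 2 → Module.Dual R F) (p m : ℕ) :
    enMap r p m ∘ₗ enMap r (p + 1) (m + 1) = 0 := by
  refine LinearMap.ext fun z => funext fun j => ?_
  simp only [enMap, LinearMap.comp_apply, LinearMap.pi_apply, LinearMap.add_apply,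
    LinearMap.proj_apply, map_add, contraction_self, LinearMap.zero_apply, Pi.zero_apply]
  rw [contraction_contraction (r 1) (r 0), zero_add, add_zero, Fin.succ_castSucc, add_neg_cancel]

lemma enMinors_enMap (r : Fin 2 → Module.Dual R F) : enMinors r ∘ₗ enMap r 2 0 = 0 := by
  refine LinearMap.ext fun z => ?_
  simp only [enMap, enMinors, LinearMap.comp_apply, LinearMap.pi_apply, LinearMap.add_apply,
    LinearMap.proj_apply, map_add, contraction_self, LinearMap.zero_apply]
  rw [contraction_contraction (r 0) (r 1), map_neg, contraction_self]
  simp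

end Contraction

/-! ### Coordinates on the exterior powers of `R⁴` -/

section Coordinates
variable {R : Type u} [CommRing R]

/-- The iterated contraction of a bivector in `R⁴` by two coordinates. -/
def coord₂ (a b : Fin 4) : ⋀[R]^2 (Fin 4 → R) →ₗ[R] R :=
  (exteriorPower.zeroEquiv R (Fin 4 → R)).toLinearMap ∘ₗ contraction (.proj b) 0 ∘ₗ
    contraction (.proj a) 1

/-- The iterated contraction of a trivector in `R⁴` by three coordinates. -/
def coord₃ (a b c : Fin 4) : ⋀[R]^3 (Fin 4 → R) →ₗ[R] R :=
  coord₂ b c ∘ₗ contraction (.proj a) 2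

/-- The iterated contraction of a quadrivector in `R⁴` by four coordinates. -/
def coord₄ (a b c d : Fin 4) : ⋀[R]^4 (Fin 4 → R) →ₗ[R] R :=
  coord₃ b c d ∘ₗ contraction (.proj a) 3

lemma coord₂_self (a : Fin 4) (z : ⋀[R]^2 (Fin 4 → R)) : coord₂ a a z = 0 := by
  simp [coord₂, contraction_self]

lemma coord₂_swap {a b : Fin 4} (_ : b < a) (z : ⋀[R]^2 (Fin 4 → R)) :
    coord₂ a b z = - coord₂ b a z := by
  simp only [coord₂, LinearMap.comp_apply]
  rw [contraction_contraction, map_neg]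

lemma coord₃_self_left (a b : Fin 4) (z : ⋀[R]^3 (Fin 4 → R)) : coord₃ a a b z = 0 := by
  simp [coord₃, coord₂, contraction_self]

lemma coord₃_self_right (a b : Fin 4) (z : ⋀[R]^3 (Fin 4 → R)) : coord₃ a b b z = 0 :=
  coord₂_self b _

lemma coord₃_swap_right {b c : Fin 4} (h : c < b) (a : Fin 4) (z : ⋀[R]^3 (Fin 4 → R)) :
    coord₃ a b c z = - coord₃ a c b z := coord₂_swap h _

lemma coord₃_swap_left {a b : Fin 4} (_ : b < a) (c : Fin 4) (z : ⋀[R]^3 (Fin 4 → R)) :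
    coord₃ a b c z = - coord₃ b a c z := by
  simp only [coord₃, coord₂, LinearMap.comp_apply]
  have h := contraction_contraction (.proj b) (.proj a) 1 z
  rw [h, map_neg, map_neg]

lemma coord₄_self_left (a b c : Fin 4) (z : ⋀[R]^4 (Fin 4 → R)) : coord₄ a a b c z = 0 := by
  simp [coord₄, coord₃, coord₂, contraction_self]

lemma coord₄_self_middle (a b c : Fin 4) (z : ⋀[R]^4 (Fin 4 → R)) : coord₄ a b b c z = 0 :=
  coord₃_self_left _ _ _

lemma coord₄_self_right (a b c : Fin 4) (z : ⋀[R]^4 (Fin 4 → R)) : coord₄ a b c c z = 0 :=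
  coord₃_self_right _ _ _

lemma coord₄_swap_middle {b c : Fin 4} (h : c < b) (a d : Fin 4) (z : ⋀[R]^4 (Fin 4 → R)) :
    coord₄ a b c d z = - coord₄ a c b d z := coord₃_swap_left h _ _

lemma coord₄_swap_right {c d : Fin 4} (h : d < c) (a b : Fin 4) (z : ⋀[R]^4 (Fin 4 → R)) :
    coord₄ a b c d z = - coord₄ a b d c z := coord₃_swap_right h _ _

lemma coord₄_swap_left {a b : Fin 4} (_ : b < a) (c d : Fin 4) (z : ⋀[R]^4 (Fin 4 → R)) :
    coord₄ a b c d z = - coord₄ b a c d z := by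
  simp only [coord₄, coord₃, coord₂, LinearMap.comp_apply]
  have h := contraction_contraction (.proj b) (.proj a) 2 z
  rw [h, map_neg, map_neg, map_neg]

lemma coe_zeroEquiv_symm (r : R) : ((exteriorPower.zeroEquiv R (Fin 4 → R)).symm r :
    ExteriorAlgebra R (Fin 4 → R)) = algebraMap R _ r := by
  rw [Algebra.algebraMap_eq_smul_one]
  simp [exteriorPower.zeroEquiv_symm_apply]

/-- The volume element of `R⁴`. -/
def volElt (R : Type u) [CommRing R] : ⋀[R]^4 (Fin 4 → R) :=
  exteriorPower.ιMulti R 4 fun i => Pi.single i 1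

lemma coord₄_volElt : coord₄ 0 1 2 3 (volElt R) = 1 := by
  have h : (exteriorPower.zeroEquiv R (Fin 4 → R)).symm (coord₄ 0 1 2 3 (volElt R)) =
      (exteriorPower.zeroEquiv R (Fin 4 → R)).symm 1 := by
    simp only [coord₄, coord₃, coord₂, LinearMap.comp_apply, LinearEquiv.coe_coe,
      LinearEquiv.symm_apply_apply]
    refine Subtype.ext ?_
    simp [contraction, volElt, ExteriorAlgebra.ιMulti_succ_apply, ExteriorAlgebra.ι,
        CliffordAlgebra.contractLeft_ι_mul, Matrix.vecTail, coe_zeroEquiv_symm]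

  exact (exteriorPower.zeroEquiv R (Fin 4 → R)).symm.injective h

lemma coord₂_ιMulti (a b : Fin 4) (v : Fin 2 → Fin 4 → R) :
    coord₂ a b (exteriorPower.ιMulti R 2 v) = v 0 a * v 1 b - v 1 a * v 0 b := by
  apply (exteriorPower.zeroEquiv R (Fin 4 → R)).symm.injective
  simp only [coord₂, LinearMap.comp_apply, LinearEquiv.coe_coe,
    LinearEquiv.symm_apply_apply]
  refine Subtype.ext ?_
  simp [contraction, ExteriorAlgebra.ιMulti_succ_apply, ExteriorAlgebra.ι,
      CliffordAlgebra.contractLeft_ι_mul, Matrix.vecTail, coe_zeroEquiv_symm]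
  simp only [Algebra.smul_def]
  rw [← Algebra.commutes (v 1 a)]

/-- Coordinates of a trivector. -/
def coords₃ (R : Type u) [CommRing R] : ⋀[R]^3 (Fin 4 → R) →ₗ[R] Fin 4 → R :=
  LinearMap.pi ![coord₃ 1 2 3, -coord₃ 0 2 3, coord₃ 0 1 3, -coord₃ 0 1 2]

lemma coords₃_contraction (j : Fin 4) :
    coords₃ R (contraction (.proj j) 3 (volElt R)) = Pi.single j 1 := by
  have h (j a b c : Fin 4) : coord₃ a b c (contraction (.proj j) 3 (volElt R)) =
    coord₄ j a b c (volElt R) := rfl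
  funext i
  fin_cases i <;> fin_cases j <;>
  simp [coords₃, h, coord₄_self_left, coord₄_self_middle, coord₄_self_right, coord₄_swap_left,
    coord₄_swap_right, coord₄_swap_middle, coord₄_volElt]

variable [Nontrivial R]

/-- A surjection between finite free modules of equal rank is bijective, and the volume element
gives surjectivity. -/
lemma coord₄_injective : Function.Injective (coord₄ (R := R) 0 1 2 3) := by
  refine (OrzechProperty.bijective_of_surjective_of_finrank_le _ (fun r => ?_) ?_).1
  · exact ⟨r • volElt R, by rw [map_smul, coord₄_volElt, smul_eq_mul, mul_one]⟩
  · rw [exteriorPower.finrank_eq]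
    simp

lemma coords₃_bijective : Function.Bijective (coords₃ R) := by
  refine OrzechProperty.bijective_of_surjective_of_finrank_le _ (fun u => ?_) ?_
  · refine ⟨∑ j, u j • contraction (.proj j) 3 (volElt R), ?_⟩
    simp only [map_sum, map_smul, coords₃_contraction]
    exact (pi_eq_sum_univ' u).symm
  · rw [exteriorPower.finrank_eq]
    simp

/-- Coordinates of a bivector. -/
def coords₂ (R : Type u) [CommRing R] : ⋀[R]^2 (Fin 4 → R) →ₗ[R] Fin 6 → R :=
  LinearMap.pi ![coord₂ 0 1, coord₂ 0 2, coord₂ 0 3, coord₂ 1 2, coord₂ 1 3, coord₂ 2 3]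

lemma coords₂_bijective : Function.Bijective (coords₂ R) := by
  refine OrzechProperty.bijective_of_surjective_of_finrank_le _ (fun u => ?_) ?_
  · let e (a b : Fin 4) : ⋀[R]^2 (Fin 4 → R) :=
      exteriorPower.ιMulti R 2 ![Pi.single a 1, Pi.single b 1]
    refine ⟨u 0 • e 0 1 + u 1 • e 0 2 + u 2 • e 0 3 + u 3 • e 1 2 + u 4 • e 1 3 + u 5 • e 2 3, ?_⟩
    funext i
    fin_cases i <;> simp [coords₂, e, coord₂_ιMulti]
  · rw [exteriorPower.finrank_eq]
    simp [Nat.choose]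

end Coordinates
-- Exactness of the Eagon–Northcott complex of the generic matrix
section Exactness

variable {R : Type u} [CommRing R]

lemma contraction_rowForms (a : Matrix (Fin 2) (Fin 4) R) (i : Fin 2) (n : ℕ)
    (z : ⋀[R]^(n + 1) (Fin 4 → R)) :
    contraction (rowForms a i) n z = ∑ j, a i j • contraction (.proj j) n z := by
  rw [← contraction_sum_smul]
  congr 2

lemma coord₂_contraction_rowForms (a : Matrix (Fin 2) (Fin 4) R) (i : Fin 2) (b c : Fin 4)
    (z : ⋀[R]^3 (Fin 4 → R)) :
    coord₂ b c (contraction (rowForms a i) 2 z) = ∑ j, a i j * coord₃ j b c z := by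
  simp only [contraction_rowForms, map_sum, map_smul]
  rfl

lemma coord₃_contraction_rowForms (a : Matrix (Fin 2) (Fin 4) R) (i : Fin 2) (b c d : Fin 4)
    (z : ⋀[R]^4 (Fin 4 → R)) :
    coord₃ b c d (contraction (rowForms a i) 3 z) = ∑ j, a i j * coord₄ j b c d z := by
  simp only [contraction_rowForms, map_sum, map_smul]
  rfl

lemma enMinors_rowForms (a : Matrix (Fin 2) (Fin 4) R) (z : Fin 1 → ⋀[R]^2 (Fin 4 → R)) :
    enMinors (rowForms a) z = minor (a 0) (a 1) 0 1 * coord₂ 0 1 (z 0) +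
      minor (a 0) (a 1) 0 2 * coord₂ 0 2 (z 0) + minor (a 0) (a 1) 0 3 * coord₂ 0 3 (z 0) +
      minor (a 0) (a 1) 1 2 * coord₂ 1 2 (z 0) + minor (a 0) (a 1) 1 3 * coord₂ 1 3 (z 0) +
      minor (a 0) (a 1) 2 3 * coord₂ 2 3 (z 0) := by
  have h : enMinors (rowForms a) z = ∑ b, a 0 b * ∑ c, a 1 c * coord₂ b c (z 0) := by
    simp only [enMinors, LinearMap.comp_apply, LinearMap.proj_apply, contraction_rowForms, map_sum,
      map_smul]
    rfl
  rw [h]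
  simp [Fin.sum_univ_four, coord₂_self, coord₂_swap, minor]
  ring

lemma coords₃_contraction_rowForms (a : Matrix (Fin 2) (Fin 4) R) (i : Fin 2)
    (z : ⋀[R]^4 (Fin 4 → R)) (j : Fin 4) :
    coords₃ R (contraction (rowForms a i) 3 z) j = a i j * coord₄ 0 1 2 3 z := by
  fin_cases j <;>
  simp [coords₃, coord₃_contraction_rowForms, Fin.sum_univ_four, coord₄_self_left,
    coord₄_self_middle, coord₄_self_right, coord₄_swap_left, coord₄_swap_right, coord₄_swap_middle]

/-- Since `coords₃` labels a trivector by its missing index, contraction with a row becomes the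
wedge product with this row, each pair being read, up to sign, at the complementary pair. -/
lemma coords₂_contraction_rowForms (a : Matrix (Fin 2) (Fin 4) R) (i : Fin 2)
    (z : ⋀[R]^3 (Fin 4 → R)) :
    coords₂ R (contraction (rowForms a i) 2 z) =
      ![-(a i 2 * coords₃ R z 3 - a i 3 * coords₃ R z 2), a i 1 * coords₃ R z 3 - a i 3 * coords₃ R
          z 1,
        -(a i 1 * coords₃ R z 2 - a i 2 * coords₃ R z 1),
        -(a i 0 * coords₃ R z 3 - a i 3 * coords₃ R z 0), a i 0 * coords₃ R z 2 - a i 2 * coords₃ R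
            z 0,
        -(a i 0 * coords₃ R z 1 - a i 1 * coords₃ R z 0)] := by
  funext j
  fin_cases j <;>
  simp [coords₂, coords₃, coord₂_contraction_rowForms, Fin.sum_univ_four, coord₃_self_left,
    coord₃_self_right, coord₃_swap_left, coord₃_swap_right] <;> ring

variable (k : Type u) [Field k]

/-- For each `i` the coordinates of consecutive components are coefficients of a relation between
the two rows, and a nonzero minor forces both to vanish. -/
lemma enMap_three_injective : Function.Injective (enMap (chartForms k) 3 1) := by
  rw [injective_iff_map_eq_zero]
  intro z hz
  have h1 (i : Fin 2) (j : Fin 4) : genRow k 0 j * coord₄ 0 1 2 3 (z i.castSucc) +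
      genRow k 1 j * coord₄ 0 1 2 3 (z i.succ) = 0 := by
    have := congrArg (fun w => coords₃ _ w j) (congrFun hz i)
    simpa [enMap, chartForms, coords₃_contraction_rowForms, genRow] using this
  have h2 : minor (genRow k 0) (genRow k 1) 0 1 ≠ 0 :=
    (prime_minor_X (k := k) (0 : Fin 5) 1 (by decide) 0 1 (by decide)).ne_zero
  have h3 (i : Fin 2) : coord₄ 0 1 2 3 (z i.castSucc) = 0 := by
    refine (mul_eq_zero.1 ?_).resolve_left h2
    rw [minor]
    linear_combination genRow k 1 1 * h1 i 0 - genRow k 1 0 * h1 i 1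
  have h4 (i : Fin 2) : coord₄ 0 1 2 3 (z i.succ) = 0 := by
    refine (mul_eq_zero.1 ?_).resolve_left h2
    rw [minor]
    linear_combination - genRow k 0 1 * h1 i 0 + genRow k 0 0 * h1 i 1
  funext i
  refine coord₄_injective (R := ChartRing k) ?_
  rw [Pi.zero_apply, map_zero]
  induction i using Fin.lastCases with
  | last => exact h4 1
  | cast i => exact h3 i

lemma eq_zero_of_antisymm {W : Fin 4 → Fin 4 → R} (h : ∀ a, W a a = 0)
    (h' : ∀ a b, W b a = - W a b) (h₀₁ : W 0 1 = 0) (h₀₂ : W 0 2 = 0) (h₀₃ : W 0 3 = 0)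
    (h₁₂ : W 1 2 = 0) (h₁₃ : W 1 3 = 0) (h₂₃ : W 2 3 = 0) (a b : Fin 4) : W a b = 0 := by
  have hlt (a b : Fin 4) (hab : a < b) : W a b = 0 := by
    have : a = 0 ∧ b = 1 ∨ a = 0 ∧ b = 2 ∨ a = 0 ∧ b = 3 ∨ a = 1 ∧ b = 2 ∨ a = 1 ∧ b = 3 ∨
      a = 2 ∧ b = 3 := by revert a b; decide
    rcases this with ⟨rfl, rfl⟩ | ⟨rfl, rfl⟩ | ⟨rfl, rfl⟩ | ⟨rfl, rfl⟩ | ⟨rfl, rfl⟩ | ⟨rfl, rfl⟩ <;>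
    assumption
  rcases lt_trichotomy a b with hab | rfl | hab
  · exact hlt a b hab
  · exact h a
  · rw [h' b a, hlt b a hab, neg_zero]

lemma enMap_chartForms_two (z : Fin 2 → ⋀[ChartRing k]^3 (Fin 4 → ChartRing k)) :
    coords₂ (ChartRing k) (enMap (chartForms k) 2 0 z 0) =
      let W (a b : Fin 4) := genRow k 0 a * coords₃ _ (z 0) b - genRow k 0 b * coords₃ _ (z 0) a +
        (genRow k 1 a * coords₃ _ (z 1) b - genRow k 1 b * coords₃ _ (z 1) a)
      ![-W 2 3, W 1 3, -W 1 2, -W 0 3, W 0 2, -W 0 1] := by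
  have h : enMap (chartForms k) 2 0 z 0 =
    contraction (chartForms k 0) 2 (z 0) + contraction (chartForms k 1) 2 (z 1) := rfl
  rw [h, map_add, chartForms, coords₂_contraction_rowForms, coords₂_contraction_rowForms]
  funext j
  fin_cases j <;> simp [genRow] <;> ring

/-- In complementary coordinates the kernel condition is `x ∧ u + y ∧ v = 0`, and the `s`, `t`, `r`
of `exists_of_wedge_eq_zero` are the three components of the preimage. -/
lemma exists_enMap_three_eq (z : Fin 2 → ⋀[ChartRing k]^3 (Fin 4 → ChartRing k))
    (hz : enMap (chartForms k) 2 0 z = 0) : ∃ w, enMap (chartForms k) 3 1 w = z := by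
  have h1 := enMap_chartForms_two k z
  rw [hz, Pi.zero_apply, map_zero] at h1
  have h2 := eq_zero_of_antisymm (W := fun a b =>
    genRow k 0 a * coords₃ _ (z 0) b - genRow k 0 b * coords₃ _ (z 0) a +
      (genRow k 1 a * coords₃ _ (z 1) b - genRow k 1 b * coords₃ _ (z 1) a))
    (fun a => by ring) (fun a b => by ring) (neg_eq_zero.1 (congrFun h1 5).symm)
    (congrFun h1 4).symm (neg_eq_zero.1 (congrFun h1 3).symm) (neg_eq_zero.1 (congrFun h1 2).symm)
    (congrFun h1 1).symm (neg_eq_zero.1 (congrFun h1 0).symm)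
  obtain ⟨s, t, r, h3, h4⟩ := exists_of_wedge_eq_zero h2 (a := 0) (b := 1) (c := 2) (d := 3)
    (prime_minor_X (k := k) (0 : Fin 5) 1 (by decide) 0 1 (by decide)) (by
      rintro ⟨g, hg⟩
      -- At this point the minor of columns 0, 1 vanishes and that of columns 2, 3 equals 1.
      have := congrArg (MvPolynomial.eval fun p => if p = (0, 2) ∨ p = (1, 3) then (1 : k) else 0)
          hg
      simp [minor, genRow] at this)
  refine ⟨![s • volElt _, t • volElt _, r • volElt _], funext fun i => ?_⟩
  refine coords₃_bijective.1 (funext fun j => ?_)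
  have h5 : enMap (chartForms k) 3 1 ![s • volElt _, t • volElt _, r • volElt _] i =
    contraction (chartForms k 0) 3 (![s • volElt _, t • volElt _, r • volElt _] i.castSucc) +
    contraction (chartForms k 1) 3 (![s • volElt _, t • volElt _, r • volElt _] i.succ) := rfl
  rw [h5, map_add, chartForms, Pi.add_apply, coords₃_contraction_rowForms,
    coords₃_contraction_rowForms]
  fin_cases i
  · refine Eq.trans ?_ (h3 j).symm
    simp [coord₄_volElt, genRow]
    ring
  · refine Eq.trans ?_ (h4 j).symm
    simp [coord₄_volElt, genRow]
    ring

lemma exists_enMap_two_eq [Infinite k] (z : Fin 1 → ⋀[ChartRing k]^2 (Fin 4 → ChartRing k))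
    (hz : enMinors (chartForms k) z = 0) : ∃ w, enMap (chartForms k) 2 0 w = z := by
  set c := coords₂ (ChartRing k) (z 0) with hc
  -- The antisymmetric matrix of the bivector in complementary indices, with the signs of
  -- `enMap_chartForms_two`.
  let w : Fin 4 → Fin 4 → MvPolynomial (Fin 2 × Fin 5) k :=
    ![![0, -c 5, c 4, -c 3], ![c 5, 0, -c 2, c 1], ![-c 4, c 2, 0, -c 0], ![c 3, -c 1, c 0, 0]]
  rw [chartForms, enMinors_rowForms] at hz
  obtain ⟨u, v, huv⟩ := isWedgeSum_of_sum_minor w (fun a => by fin_cases a <;> rfl)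
    (fun a b => by fin_cases a <;> fin_cases b <;> simp [w]) (by
      have h : minor (genRow k 0) (genRow k 1) 0 1 * c 0 +
        minor (genRow k 0) (genRow k 1) 0 2 * c 1 + minor (genRow k 0) (genRow k 1) 0 3 * c 2 +
        minor (genRow k 0) (genRow k 1) 1 2 * c 3 + minor (genRow k 0) (genRow k 1) 1 3 * c 4 +
        minor (genRow k 0) (genRow k 1) 2 3 * c 5 = 0 := hz
      change -c 5 * _ - c 4 * _ + -c 3 * _ + -c 2 * _ - c 1 * _ + -c 0 * _ = 0
      linear_combination -h)
  obtain ⟨u', hu'⟩ := coords₃_bijective (R := ChartRing k).2 u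
  obtain ⟨v', hv'⟩ := coords₃_bijective (R := ChartRing k).2 v
  refine ⟨![u', v'], funext fun i => ?_⟩
  obtain rfl : i = 0 := Subsingleton.elim (α := Fin 1) _ _
  refine coords₂_bijective.1 ?_
  rw [enMap_chartForms_two]
  simp only [Matrix.cons_val_zero, Matrix.cons_val_one, hu', hv', ← huv]
  rw [← hc]
  funext j
  fin_cases j <;> simp [w]

lemma enMinors_ιMulti (a b : Fin 4) : enMinors (chartForms k) (fun _ => exteriorPower.ιMulti _ 2
    ![Pi.single a 1, Pi.single b 1]) = minor (genRow k 0) (genRow k 1) a b := by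
  rw [chartForms, enMinors_rowForms]
  simp only [coord₂_ιMulti]
  fin_cases a <;> fin_cases b <;> simp [minor, genRow]

end Exactness

/-! ### The ideal of minors and the Segre parametrization -/

section Segre
open MvPolynomial
variable (k : Type u) [Field k]

/-- The ideal of maximal minors of the generic `2 × 4` matrix. -/
def minorIdeal : Ideal (MvPolynomial (Fin 2 × Fin 5) k) :=
  Ideal.span (Set.range fun p : Fin 4 × Fin 4 => minor (genRow k 0) (genRow k 1) p.1 p.2)

lemma mk_X_mul_X (i i' : Fin 2) (j l : Fin 5) (hi : i' ≠ i) (hj : j ≠ Fin.last 4)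
    (hl : l ≠ Fin.last 4) : Ideal.Quotient.mk (minorIdeal k) (X (i, l) * X (i', j)) =
      Ideal.Quotient.mk (minorIdeal k) (X (i, j) * X (i', l)) := by
  obtain ⟨a, rfl⟩ := Fin.exists_castSucc_eq.2 hj
  obtain ⟨b, rfl⟩ := Fin.exists_castSucc_eq.2 hl
  rw [Ideal.Quotient.eq]
  obtain ⟨rfl, rfl⟩ | ⟨rfl, rfl⟩ : i = 0 ∧ i' = 1 ∨ i = 1 ∧ i' = 0 := by revert i i'; decide
  · exact Ideal.subset_span ⟨(b, a), rfl⟩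
  · have h : X (1, b.castSucc) * X (0, a.castSucc) - X (1, a.castSucc) * X (0, b.castSucc) =
        minor (genRow k 0) (genRow k 1) a b := by
      simp only [minor, genRow]
      ring
    rw [h]
    exact Ideal.subset_span ⟨(a, b), rfl⟩

/-- The exponents of the images of the variables in the Segre parametrization. -/
def segreExponent (p : Fin 2 × Fin 5) : (Fin 2 ⊕ Fin 5 ⊕ Fin 2) →₀ ℕ :=
  if p.2 = Fin.last 4 then .single (.inr (.inr p.1)) 1
  else .single (.inl p.1) 1 + .single (.inr (.inl p.2)) 1

lemma segreExponent_last (i : Fin 2) :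
    segreExponent (i, Fin.last 4) = .single (.inr (.inr i)) 1 := if_pos rfl

lemma segreExponent_of_ne (i : Fin 2) {j : Fin 5} (h : j ≠ Fin.last 4) :
    segreExponent (i, j) = .single (.inl i) 1 + .single (.inr (.inl j)) 1 := if_neg h

/-- The exponents of the images of monomials in the Segre parametrization. -/
def segreDegree : ((Fin 2 × Fin 5) →₀ ℕ) →ₗ[ℕ] ((Fin 2 ⊕ Fin 5 ⊕ Fin 2) →₀ ℕ) :=
  Finsupp.linearCombination ℕ segreExponent

lemma segreDegree_apply (m : (Fin 2 × Fin 5) →₀ ℕ) (t) :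
    segreDegree m t = ∑ p, m p * segreExponent p t := by
  rw [segreDegree, Finsupp.linearCombination_apply, Finsupp.sum_fintype _ _ (by simp),
    Finsupp.finsetSum_apply]
  rfl

/-- A parameter that occurs in the image of one monomial must be supplied by some variable of any
other monomial with the same image. -/
lemma exists_of_segreDegree_eq {m m' : (Fin 2 × Fin 5) →₀ ℕ} (h : segreDegree m = segreDegree m')
    {p : Fin 2 × Fin 5} (hp : m p ≠ 0) (t) (ht : segreExponent p t ≠ 0) :
    ∃ q, m' q ≠ 0 ∧ segreExponent q t ≠ 0 := by
  by_contra! H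
  have h1 : segreDegree m' t = 0 := by
    rw [segreDegree_apply]
    refine Finset.sum_eq_zero fun q _ => ?_
    by_cases hq : m' q = 0
    · rw [hq, zero_mul]
    · rw [H q hq, mul_zero]
  rw [← h, segreDegree_apply, Finset.sum_eq_zero_iff] at h1
  exact mul_ne_zero hp ht (h1 p (Finset.mem_univ p))

/-- Induction on the degree: a common variable is cancelled. Otherwise, for a variable `(i, j)` of
`m` in the first four columns, `m'` contains variables `(i, l)` and `(i', j)`, and one minor
exchanges their columns, which creates the common variable `(i, j)`. A variable of the fifth column
has its own parameter and is always common. -/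
lemma mk_monomial_eq (m m' : (Fin 2 × Fin 5) →₀ ℕ) (h : segreDegree m = segreDegree m') :
    Ideal.Quotient.mk (minorIdeal k) (monomial m 1) =
      Ideal.Quotient.mk (minorIdeal k) (monomial m' 1) := by
  induction hn : m.degree using Nat.strong_induction_on generalizing m m' with
  | _ n ih =>
  have common (p) (m' : (Fin 2 × Fin 5) →₀ ℕ) (h : segreDegree m = segreDegree m') (hp : m p ≠ 0)
      (hp' : m' p ≠ 0) : Ideal.Quotient.mk (minorIdeal k) (monomial m 1) =
      Ideal.Quotient.mk (minorIdeal k) (monomial m' 1) := by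
    obtain ⟨a, rfl⟩ : ∃ a, m = a + .single p 1 :=
      ⟨m - .single p 1, (tsub_add_cancel_of_le (Finsupp.single_le_iff.2 (by omega))).symm⟩
    obtain ⟨b, rfl⟩ : ∃ b, m' = b + .single p 1 :=
      ⟨m' - .single p 1, (tsub_add_cancel_of_le (Finsupp.single_le_iff.2 (by omega))).symm⟩
    rw [map_add, map_add, add_left_inj] at h
    have := ih a.degree (by rw [← hn, map_add]; simp) a b h rfl
    rw [monomial_add_single, monomial_add_single, map_mul, map_mul, this]
  by_cases hm : m = 0
  · subst hm
    have : m' = 0 := by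
      by_contra H
      obtain ⟨p, hp⟩ := Finsupp.ne_iff.1 H
      obtain ⟨i, j⟩ := p
      have hp' : ∃ t, segreExponent (i, j) t ≠ 0 := by
        by_cases hl : j = Fin.last 4
        · subst hl
          exact ⟨.inr (.inr i), by rw [segreExponent_last]; simp⟩
        · exact ⟨.inl i, by rw [segreExponent_of_ne i hl]; simp⟩
      obtain ⟨t, ht⟩ := hp'
      obtain ⟨q, hq, -⟩ := exists_of_segreDegree_eq h.symm hp t ht
      exact hq rfl
    rw [this]
  obtain ⟨⟨i, j⟩, hp⟩ := Finsupp.ne_iff.1 hm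
  by_cases hp' : m' (i, j) = 0
  · by_cases hj : j = Fin.last 4
    · subst hj
      obtain ⟨⟨i', j'⟩, hq, hq'⟩ := exists_of_segreDegree_eq h hp (.inr (.inr i))
        (by rw [segreExponent_last]; simp)
      by_cases h1 : j' = Fin.last 4
      · subst h1
        rw [segreExponent_last, Finsupp.single_apply] at hq'
        obtain rfl : i' = i := by
          by_contra H
          simp [H] at hq'
        exact absurd hp' hq
      · rw [segreExponent_of_ne i' h1] at hq'
        simp at hq'
    · obtain ⟨⟨i₁, l⟩, hq, hq'⟩ := exists_of_segreDegree_eq h hp (.inl i)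
        (by rw [segreExponent_of_ne i hj]; simp)
      obtain ⟨⟨i', j₁⟩, hr, hr'⟩ := exists_of_segreDegree_eq h hp (.inr (.inl j))
        (by rw [segreExponent_of_ne i hj]; simp)
      have hl : l ≠ Fin.last 4 := fun H => by
        rw [H, segreExponent_last] at hq'
        simp at hq'
      have hj₁ : j₁ ≠ Fin.last 4 := fun H => by
        rw [H, segreExponent_last] at hr'
        simp at hr'
      rw [segreExponent_of_ne _ hl, Finsupp.add_apply, Finsupp.single_apply] at hq'
      rw [segreExponent_of_ne _ hj₁, Finsupp.add_apply, Finsupp.single_apply,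
        Finsupp.single_apply] at hr'
      obtain rfl : i₁ = i := by
        by_contra H
        simp [H] at hq'
      obtain rfl : j₁ = j := by
        by_contra H
        simp [H] at hr'
      have hi' : i' ≠ i₁ := by rintro rfl; exact hr hp'
      have hne : (i₁, l) ≠ (i', j₁) := fun H => hi' (congrArg Prod.fst H).symm
      obtain ⟨a, rfl⟩ : ∃ a, m' = a + .single (i₁, l) 1 + .single (i', j₁) 1 := by
        refine ⟨m' - (.single (i₁, l) 1 + .single (i', j₁) 1), ?_⟩
        rw [add_assoc, tsub_add_cancel_of_le]
        intro q
        by_cases h1 : (i₁, l) = q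
        · subst h1
          simp [hne.symm]
          omega
        · by_cases h2 : (i', j₁) = q
          · subst h2
            simp [hne]
            omega
          · simp [h1, h2]
      -- The intermediate monomial is `m'` after the exchange: congruent to `m'` by a minor, and
      -- sharing `(i₁, j₁)` with `m`.
      rw [common (i₁, j₁) (a + .single (i₁, j₁) 1 + .single (i', l) 1) ?_ hp (by simp)]
      · simp only [monomial_add_single, pow_one, mul_assoc]
        rw [map_mul, map_mul _ (monomial a 1), mk_X_mul_X k _ _ _ _ hi' hj hl]
      · rw [h]
        simp only [map_add, segreDegree, Finsupp.linearCombination_single, one_smul,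
          segreExponent_of_ne _ hl, segreExponent_of_ne _ hj]
        abel
  · exact common _ m' h hp hp'

/-- A polynomial that vanishes at all `2 × 5` matrices whose first four columns form a matrix of
rank at most one lies in the ideal of minors of these columns. -/
lemma mem_minorIdeal [Infinite k] (f : MvPolynomial (Fin 2 × Fin 5) k)
    (hf : ∀ a : Fin 2 × Fin 5 → k, (∀ l m : Fin 4, a (0, l.castSucc) * a (1, m.castSucc) =
      a (1, l.castSucc) * a (0, m.castSucc)) → eval a f = 0) : f ∈ minorIdeal k := by
  let ψ : MvPolynomial (Fin 2 × Fin 5) k →ₐ[k] MvPolynomial (Fin 2 ⊕ Fin 5 ⊕ Fin 2) k :=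
    aeval fun p => monomial (segreExponent p) 1
  have hψ (m) (c : k) : ψ (monomial m c) = monomial (segreDegree m) c := by
    simp only [ψ, aeval_monomial, segreDegree, Finsupp.linearCombination_apply,
      monomial_finsupp_sum_index, algebraMap_eq, monomial_pow, one_pow]
  -- Every specialization of the parametrized matrix has rank at most one in its first four columns,
  -- so `ψ f` vanishes at all points of an infinite field.
  have h0 : ψ f = 0 := by
    refine MvPolynomial.funext fun b => ?_
    have : (aeval b).comp ψ = aeval fun p => eval b (monomial (segreExponent p) 1) :=
      algHom_ext fun p => by simp [ψ, aeval_eq_eval]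
    have h2 := DFunLike.congr_fun this f
    simp only [AlgHom.comp_apply, aeval_eq_eval] at h2
    rw [map_zero]
    refine h2.trans (hf _ fun l m => ?_)
    have h3 (i : Fin 2) (l : Fin 4) : eval b (monomial (segreExponent (i, l.castSucc)) 1) =
        b (.inl i) * b (.inr (.inl l.castSucc)) := by
      rw [segreExponent_of_ne i (Fin.castSucc_ne_last l), monomial_add_single, pow_one, map_mul]
      simp [eval_monomial]
    simp only [h3]
    ring
  -- `Λ` sends each image monomial to one chosen monomial above it. By `mk_monomial_eq`, `g - Λ (ψ
  -- g)` lies in the ideal of minors, so that ideal contains the kernel of `ψ`.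
  let Λ : MvPolynomial (Fin 2 ⊕ Fin 5 ⊕ Fin 2) k →ₗ[k] MvPolynomial (Fin 2 × Fin 5) k :=
    (basisMonomials _ k).constr k fun t => monomial (Function.invFun segreDegree t) 1
  have hΛ (g : MvPolynomial (Fin 2 × Fin 5) k) : g - Λ (ψ g) ∈ minorIdeal k := by
    induction g using MvPolynomial.induction_on' with
    | add p q hp hq =>
      rw [map_add, map_add, add_sub_add_comm]
      exact add_mem hp hq
    | monomial m c =>
      have h1 : monomial (segreDegree m) c = c • basisMonomials _ k (segreDegree m) := by
        simp [smul_monomial]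
      have h2 : (monomial m c : MvPolynomial (Fin 2 × Fin 5) k) = c • monomial m 1 := by
        simp [smul_monomial]
      rw [hψ, h1, map_smul, Module.Basis.constr_basis, h2, ← smul_sub]
      refine Submodule.smul_of_tower_mem _ c ((Ideal.Quotient.eq).1 (mk_monomial_eq k _ _ ?_))
      exact (Function.invFun_eq ⟨m, rfl⟩).symm
  simpa [h0] using hΛ f

end Segre

/-! ### Exterior powers under extension of scalars -/

section BaseChange
variable {k R A F : Type u} [Field k] [CommRing R] [Algebra k R] [AddCommGroup A] [Module k A]
  [AddCommGroup F] [Module R F] [Module k F] [IsScalarTower k R F]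

/-- The homomorphism of exterior algebras over different rings induced by a linear map. -/
def extMap (t : A →ₗ[k] F) : ExteriorAlgebra k A →ₐ[k] ExteriorAlgebra R F :=
  ExteriorAlgebra.lift k ⟨(ExteriorAlgebra.ι R).restrictScalars k ∘ₗ t,
    fun _ => ExteriorAlgebra.ι_sq_zero _⟩

@[simp]
lemma extMap_ι (t : A →ₗ[k] F) (x : A) :
    extMap (R := R) t (ExteriorAlgebra.ι k x) = ExteriorAlgebra.ι R (t x) :=
  ExteriorAlgebra.lift_ι_apply k _ _ _

lemma extMap_mem (t : A →ₗ[k] F) (n : ℕ) (z : ExteriorAlgebra k A) (hz : z ∈ ⋀[k]^n A) :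
    extMap (R := R) t z ∈ ⋀[R]^n F := by
  induction n generalizing z with
  | zero =>
    rw [ExteriorAlgebra.exteriorPower, pow_zero] at hz ⊢
    obtain ⟨c, rfl⟩ := Submodule.mem_one.1 hz
    rw [AlgHom.commutes, IsScalarTower.algebraMap_apply k R]
    exact Submodule.mem_one.2 ⟨_, rfl⟩
  | succ n ih =>
    rw [ExteriorAlgebra.exteriorPower, pow_succ'] at hz ⊢
    induction hz using Submodule.mul_induction_on' with
    | mem_mul_mem a ha b hb =>
      obtain ⟨y, rfl⟩ := ha
      rw [map_mul, extMap_ι]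
      exact Submodule.mul_mem_mul ⟨_, rfl⟩ (ih b hb)
    | add a _ b _ ha hb =>
      rw [map_add]
      exact add_mem ha hb

lemma contractLeft_extMap (t : A →ₗ[k] F) (d : Module.Dual k A) (d' : Module.Dual R F)
    (h : ∀ x, d' (t x) = algebraMap k R (d x)) (z : ExteriorAlgebra k A) :
    CliffordAlgebra.contractLeft (Q := (0 : QuadraticForm R F)) d' (extMap t z) =
      extMap t (CliffordAlgebra.contractLeft (Q := (0 : QuadraticForm k A)) d z) := by
  induction z using CliffordAlgebra.left_induction with
  | algebraMap r =>
    rw [CliffordAlgebra.contractLeft_algebraMap, map_zero]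
    refine (congrArg _ ((extMap t).commutes r)).trans ?_
    rw [IsScalarTower.algebraMap_apply k R, CliffordAlgebra.contractLeft_algebraMap]
  | add x y hx hy => rw [map_add, map_add, map_add, map_add, hx, hy]
  | ι_mul x m hx =>
    have h1 : extMap (R := R) t (CliffordAlgebra.ι 0 m) = CliffordAlgebra.ι 0 (t m) :=
      extMap_ι t m
    rw [map_mul, h1, CliffordAlgebra.contractLeft_ι_mul, CliffordAlgebra.contractLeft_ι_mul,
        map_sub,
      map_smul, map_mul, h1, hx, h, algebraMap_smul]

/-- The map of exterior powers over different rings induced by a linear map. -/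
def extPowMap (t : A →ₗ[k] F) (n : ℕ) (z : ⋀[k]^n A) : ⋀[R]^n F :=
  ⟨extMap t z, extMap_mem t n z z.2⟩

lemma extPowMap_ιMulti (t : A →ₗ[k] F) (n : ℕ) (v : Fin n → A) :
    extPowMap (R := R) t n (exteriorPower.ιMulti k n v) = exteriorPower.ιMulti R n (t ∘ v) := by
  refine Subtype.ext ?_
  change extMap t (exteriorPower.ιMulti k n v : ExteriorAlgebra k A) = _
  rw [exteriorPower.ιMulti_apply_coe, exteriorPower.ιMulti_apply_coe, ExteriorAlgebra.ιMulti_apply,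
    ExteriorAlgebra.ιMulti_apply, map_list_prod, List.map_ofFn]
  congr 2
  funext i
  exact extMap_ι t _

lemma contraction_extPowMap (t : A →ₗ[k] F) (d : Module.Dual k A) (d' : Module.Dual R F)
    (h : ∀ x, d' (t x) = algebraMap k R (d x)) (n : ℕ) (z : ⋀[k]^(n + 1) A) :
    contraction d' n (extPowMap t (n + 1) z) = extPowMap t n (contraction d n z) :=
  Subtype.ext (contractLeft_extMap t d d' h z)

end BaseChange

/-! ### Linear forms on exterior powers of `A`, extended to the chart ring -/

section Forms
variable {k R A : Type u} [Field k] [CommRing R] [Algebra k R] [AddCommGroup A] [Module k A]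
  (ξ : Module.Basis (Fin 4) k A)

variable (R) in
/-- The coordinate map of a basis, with values in an algebra. -/
def coordMap : A →ₗ[k] (Fin 4 → R) :=
  LinearMap.pi fun j => (Algebra.linearMap k R) ∘ₗ ξ.coord j

variable (R) in
/-- The basis of exterior powers of `R⁴`. -/
def extBasis (n : ℕ) : Module.Basis (Set.powersetCard (Fin 4) n) R (⋀[R]^n (Fin 4 → R)) :=
  (Pi.basisFun R (Fin 4)).exteriorPower n

lemma extPowMap_basis (n : ℕ) (s) :
    extPowMap (coordMap R ξ) n (ξ.exteriorPower n s) = extBasis R n s := by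
  rw [extBasis, exteriorPower.basis_apply, exteriorPower.basis_apply]
  simp only [exteriorPower.ιMulti_family]
  rw [extPowMap_ιMulti]
  congr 1
  funext i
  refine funext fun j => ?_
  simp [coordMap, Pi.single_apply, Finsupp.single_apply, eq_comm]

/-- The base change of a linear form on an exterior power. -/
def extForm (n : ℕ) (μ : Module.Dual k (⋀[k]^n A)) : Module.Dual R (⋀[R]^n (Fin 4 → R)) :=
  (extBasis R n).constr R fun s => algebraMap k R (μ (ξ.exteriorPower n s))

lemma extForm_basis (n : ℕ) (μ : Module.Dual k (⋀[k]^n A)) (s) :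
    extForm ξ n μ (extBasis R n s) = algebraMap k R (μ (ξ.exteriorPower n s)) :=
  (extBasis R n).constr_basis R _ s

lemma extForm_extPowMap (n : ℕ) (μ : Module.Dual k (⋀[k]^n A)) (z : ⋀[k]^n A) :
    extForm ξ n μ (extPowMap (coordMap R ξ) n z) = algebraMap k R (μ z) := by
  let f : ⋀[k]^n A →ₗ[k] R :=
    { toFun := fun z => extForm ξ n μ (extPowMap (coordMap R ξ) n z)
      map_add' := fun x y => by
        rw [← map_add]
        congr 1
        exact Subtype.ext (map_add (extMap (coordMap R ξ)) _ _)
      map_smul' := fun c x => by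
        rw [RingHom.id_apply, ← algebraMap_smul R c (extForm ξ n μ _), ← map_smul]
        congr 1
        refine Subtype.ext ((map_smul (extMap (coordMap R ξ)) c _).trans ?_)
        exact (algebraMap_smul R c _).symm }
  have : f = Algebra.linearMap k R ∘ₗ μ := (ξ.exteriorPower n).ext fun s => by
    simp only [f, LinearMap.coe_mk, AddHom.coe_mk, LinearMap.comp_apply, Algebra.linearMap_apply]
    rw [extPowMap_basis, extForm_basis]
  exact LinearMap.congr_fun this z

/-- It suffices to test basis vectors; they come from exterior powers of `A` over `k`, where
contraction commutes with extension of scalars. -/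
lemma extForm_contraction (n : ℕ) (μ : Module.Dual k (⋀[k]^n A)) (j : Fin 4)
    (z : ⋀[R]^(n + 1) (Fin 4 → R)) :
    extForm ξ n μ (contraction (.proj j) n z) =
      extForm ξ (n + 1) (μ ∘ₗ contraction (ξ.coord j) n) z := by
  suffices extForm ξ n μ ∘ₗ contraction (R := R) (.proj j) n =
    extForm ξ (n + 1) (μ ∘ₗ contraction (ξ.coord j) n) from LinearMap.congr_fun this z
  refine (extBasis R (n + 1)).ext fun s => ?_
  rw [← extPowMap_basis ξ, LinearMap.comp_apply, contraction_extPowMap _ (ξ.coord j),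
      extForm_extPowMap,
    extForm_extPowMap]
  · rfl
  · exact fun x => rfl

lemma extForm_contraction_rowForms (a : Matrix (Fin 2) (Fin 4) R) (i : Fin 2) (n : ℕ)
    (μ : Module.Dual k (⋀[k]^n A)) (z : ⋀[R]^(n + 1) (Fin 4 → R)) :
    extForm ξ n μ (contraction (rowForms a i) n z) =
      ∑ j, a i j * extForm ξ (n + 1) (μ ∘ₗ contraction (ξ.coord j) n) z := by
  simp only [contraction_rowForms, map_sum, map_smul, extForm_contraction, smul_eq_mul]

lemma extForm_contraction_genRow (n : ℕ) (μ : Module.Dual k (⋀[k]^n A))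
    (i : Fin 2) (z : ⋀[MvPolynomial (Fin 2 × Fin 5) k]^(n + 1)
      (Fin 4 → MvPolynomial (Fin 2 × Fin 5) k)) :
    extForm ξ n μ (contraction (rowForms (Matrix.of (genRow k)) i) n z) =
      ∑ j : Fin 4, genRow k i j * extForm ξ (n + 1) (μ ∘ₗ contraction (ξ.coord j) n) z := by
  have h := extForm_contraction_rowForms ξ (Matrix.of (genRow k)) i n μ z
  simp only [Matrix.of_apply] at h
  exact h

end Forms

/-! ### The terms of the resolution on a chart -/

section ChartForms

variable {k V : Type u} [Field k] [AddCommGroup V] [Module k V] [Infinite k]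
  (B : Module.Basis (Fin 2 ⊕ Fin 5) k V)

/-- A half, as a function on a chart. -/
lemma exists_half [CharZero k] : ∃ c : Γ(Gr k V, Proj.basicOpen (pluckerGrading k V) (chartElt B)),
    2 * c = 1 := by
  let h : k →+* Γ(Gr k V, Proj.basicOpen (pluckerGrading k V) (chartElt B)) :=
    (Proj.awayToSection (pluckerGrading k V) (chartElt B)).hom.comp
      ((HomogeneousLocalization.fromZeroRingHom (pluckerGrading k V) _).comp
        (algebraMap k (pluckerGrading k V 0)))
  refine ⟨h 2⁻¹, ?_⟩
  rw [← map_ofNat h 2, ← map_mul, mul_inv_cancel₀ two_ne_zero, map_one]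

lemma planeVal_basis {K : Submodule k V} (ξ : Module.Basis (Fin 4) k K.dualAnnihilator)
    (hB : ∀ l : Fin 4, B.coord (.inr l.castSucc) = (ξ l : Module.Dual k V))
    (l : Fin 4) (i : Fin 2) :
    planeVal B (ξ l : Module.Dual k V) i = genRow k i l := by
  rw [← hB, planeVal_inr, genRow]

variable [IsAlgClosed k]

lemma chartVal_tensor {M N : (Gr k V).Modules} (φ : M ⟶ structureSheafModule (Gr k V))
    (ψ : N ⟶ structureSheafModule (Gr k V))
    (s : Γ(M, Proj.basicOpen (pluckerGrading k V) (chartElt B)))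
    (t : Γ(N, Proj.basicOpen (pluckerGrading k V) (chartElt B))) :
    chartVal B (tensorFunctional φ ψ) (tm s t) = chartVal B φ s * chartVal B ψ t := by
  simp only [chartVal_eq, ev_tensorFunctional_tm, map_mul]

lemma chartVal_sym {M : (Gr k V).Modules} (φ ψ : M ⟶ structureSheafModule (Gr k V))
    (s t : Γ(M, Proj.basicOpen (pluckerGrading k V) (chartElt B))) :
    chartVal B (symFunctional φ ψ) (sm s t) =
      chartVal B φ s * chartVal B ψ t + chartVal B ψ s * chartVal B φ t := by
  simp only [chartVal_eq, ev_symFunctional_sm, map_mul, map_add]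

lemma chartVal_smul {M : (Gr k V).Modules} (φ : M ⟶ structureSheafModule (Gr k V))
    {c : Γ(Gr k V, Proj.basicOpen (pluckerGrading k V) (chartElt B))} {e : ℕ} (hc : e * c = 1)
    (s : Γ(M, Proj.basicOpen (pluckerGrading k V) (chartElt B))) :
    e * chartVal B φ (c • s) = chartVal B φ s := by
  have h := congrArg (fun r => chartRingIso (chart B)
    ((Gr k V).presheaf.map (homOfLE (image_top_chart B)).op r)) hc
  simp only [map_mul, map_natCast, map_one] at h
  rw [chartVal_eq, chartVal_eq, map_smul, smul_eq_mul, map_mul, map_mul, ← mul_assoc, h, one_mul]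

variable (K : Submodule k V)

/-- Functionals on `⋀²A(-1)`. -/
def resFunctional₁ (μ : Module.Dual k (⋀[k]^2 K.dualAnnihilator)) (ω : V [⋀^Fin 2]→ₗ[k] k) :
    resTerm1 K ⟶ structureSheafModule (Gr k V) :=
  tensorFunctional (trivFunctional μ) (twistFunctional ω)

/-- Functionals on `⋀³A ⊗ T(-1)`. -/
def resFunctional₂ (μ : Module.Dual k (⋀[k]^3 K.dualAnnihilator)) (η : Module.Dual k V)
    (ω : V [⋀^Fin 2]→ₗ[k] k) : resTerm2 K ⟶ structureSheafModule (Gr k V) :=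
  tensorFunctional (trivFunctional μ) (tensorFunctional (tautFunctional η) (twistFunctional ω))

/-- Functionals on `⋀⁴A ⊗ Sym²T(-1)`. -/
def resFunctional₃ (μ : Module.Dual k (⋀[k]^4 K.dualAnnihilator)) (η η' : Module.Dual k V)
    (ω : V [⋀^Fin 2]→ₗ[k] k) : resTerm3 K ⟶ structureSheafModule (Gr k V) :=
  tensorFunctional (trivFunctional μ)
    (tensorFunctional (symFunctional (tautFunctional η) (tautFunctional η')) (twistFunctional ω))

variable {K} (ξ : Module.Basis (Fin 4) k K.dualAnnihilator)

/-- The frame of `⋀²A(-1)` on a chart. -/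
def resFrame₁ : Frame (resTerm1 K) (chart B ''ᵁ ⊤) (Set.powersetCard (Fin 4) 2 × Unit) :=
  ((trivFrame B (ξ.exteriorPower 2)).tensor (twistFrame B)).restrict (image_top_chart B)

/-- The frame of `⋀³A ⊗ T(-1)` on a chart. -/
def resFrame₂ :
    Frame (resTerm2 K) (chart B ''ᵁ ⊤) (Set.powersetCard (Fin 4) 3 × (Fin 2 × Unit)) :=
  ((trivFrame B (ξ.exteriorPower 3)).tensor ((tautFrame B).tensor (twistFrame B))).restrict
    (image_top_chart B)

/-- The frame of `⋀⁴A ⊗ Sym²T(-1)` on a chart. -/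
def resFrame₃ [CharZero k] :
    Frame (resTerm3 K) (chart B ''ᵁ ⊤) (Set.powersetCard (Fin 4) 4 × (Fin 3 × Unit)) :=
  ((trivFrame B (ξ.exteriorPower 4)).tensor
    (((tautFrame B).sym2 _ (exists_half B).choose_spec).tensor (twistFrame B))).restrict
    (image_top_chart B)

/-- A basis of the terms of the Eagon–Northcott complex. -/
def enBasis (R : Type u) [CommRing R] (n : ℕ) {m : ℕ} {J : Type*} (e : J ≃ Fin m) :
    Module.Basis (Set.powersetCard (Fin 4) n × J) R (Fin m → ⋀[R]^n (Fin 4 → R)) :=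
  (Pi.basis fun _ : Fin m => extBasis R n).reindex
    ((Equiv.sigmaEquivProd _ _).trans ((Equiv.prodComm _ _).trans
      (Equiv.prodCongr (Equiv.refl _) e.symm)))

lemma enBasis_apply (R : Type u) [CommRing R] (n : ℕ) {m : ℕ} {J : Type*} (e : J ≃ Fin m)
    (p : Set.powersetCard (Fin 4) n × J) :
    enBasis R n e p = Pi.single (e p.2) (extBasis R n p.1) := by
  simp [enBasis]

/-- The form on the chart of a functional on `⋀²A(-1)`. -/
def resForm₁ (Φ : resTerm1 K ⟶ structureSheafModule (Gr k V)) :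
    (Fin 1 → ⋀[MvPolynomial (Fin 2 × Fin 5) k]^2 (Fin 4 → MvPolynomial (Fin 2 × Fin 5) k))
        →ₗ[MvPolynomial (Fin 2 × Fin 5) k]
      MvPolynomial (Fin 2 × Fin 5) k :=
  chartForm (N := en1 k) (chart B) (resFrame₁ B ξ)
    (enBasis (MvPolynomial (Fin 2 × Fin 5) k) 2 (Equiv.ofUnique Unit (Fin 1))) Φ

/-- The form on the chart of a functional on `⋀³A ⊗ T(-1)`. -/
def resForm₂ (Φ : resTerm2 K ⟶ structureSheafModule (Gr k V)) :
    (Fin 2 → ⋀[MvPolynomial (Fin 2 × Fin 5) k]^3 (Fin 4 → MvPolynomial (Fin 2 × Fin 5) k))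
        →ₗ[MvPolynomial (Fin 2 × Fin 5) k]
      MvPolynomial (Fin 2 × Fin 5) k :=
  chartForm (N := en2 k) (chart B) (resFrame₂ B ξ)
    (enBasis (MvPolynomial (Fin 2 × Fin 5) k) 3 (Equiv.prodPUnit (Fin 2))) Φ

/-- The form on the chart of a functional on `⋀⁴A ⊗ Sym²T(-1)`. -/
def resForm₃ [CharZero k] (Φ : resTerm3 K ⟶ structureSheafModule (Gr k V)) :
    (Fin 3 → ⋀[MvPolynomial (Fin 2 × Fin 5) k]^4 (Fin 4 → MvPolynomial (Fin 2 × Fin 5) k))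
        →ₗ[MvPolynomial (Fin 2 × Fin 5) k]
      MvPolynomial (Fin 2 × Fin 5) k :=
  chartForm (N := en3 k) (chart B) (resFrame₃ B ξ)
    (enBasis (MvPolynomial (Fin 2 × Fin 5) k) 4 (Equiv.prodPUnit (Fin 3))) Φ

lemma resForm₁_resFunctional₁ (μ ω) (x : Fin 1 → ⋀[MvPolynomial (Fin 2 × Fin 5) k]^2 (Fin 4 →
    MvPolynomial (Fin 2 × Fin 5) k)) :
    resForm₁ B ξ (resFunctional₁ K μ ω) x =
      chartEval B (formElt ω) * extForm ξ 2 μ (x 0) := by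
  suffices resForm₁ B ξ (resFunctional₁ K μ ω) =
    (chartEval B (formElt ω)) • (extForm ξ 2 μ ∘ₗ .proj 0) from
      LinearMap.congr_fun this x
  refine (enBasis (MvPolynomial (Fin 2 × Fin 5) k) 2 (Equiv.ofUnique Unit (Fin 1))).ext fun p => ?_
  refine (chartForm_basis (N := en1 k) (chart B) (resFrame₁ B ξ)
    (enBasis (MvPolynomial (Fin 2 × Fin 5) k) 2 (Equiv.ofUnique Unit (Fin 1))) _ p).trans ?_
  refine (chartVal_tensor B (trivFunctional μ) (twistFunctional ω) _ _).trans ?_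
  refine (congrArg₂ _ (chartVal_triv B _ _ _) (chartVal_twist B _)).trans ?_
  rw [enBasis_apply, LinearMap.smul_apply, LinearMap.comp_apply, LinearMap.proj_apply,
    Subsingleton.elim (Equiv.ofUnique Unit (Fin 1) p.2) 0, Pi.single_eq_same, extForm_basis,
    smul_eq_mul, mul_comm]
  rfl

lemma resForm₂_resFunctional₂ (μ η ω) (x : Fin 2 → ⋀[MvPolynomial (Fin 2 × Fin 5) k]^3 (Fin 4 →
    MvPolynomial (Fin 2 × Fin 5) k)) :
    resForm₂ B ξ (resFunctional₂ K μ η ω) x =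
      chartEval B (formElt ω) * (planeVal B η 0 * extForm ξ 3 μ (x 0) +
        planeVal B η 1 * extForm ξ 3 μ (x 1)) := by
  suffices resForm₂ B ξ (resFunctional₂ K μ η ω) =
    (chartEval B (formElt ω)) •
      ((planeVal B η 0) • (extForm ξ 3 μ ∘ₗ .proj 0) +
        (planeVal B η 1) • (extForm ξ 3 μ ∘ₗ .proj 1)) from
      LinearMap.congr_fun this x
  refine (enBasis (MvPolynomial (Fin 2 × Fin 5) k) 3 (Equiv.prodPUnit (Fin 2))).ext fun p => ?_
  refine (chartForm_basis (N := en2 k) (chart B) (resFrame₂ B ξ)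
    (enBasis (MvPolynomial (Fin 2 × Fin 5) k) 3 (Equiv.prodPUnit (Fin 2))) _ p).trans ?_
  refine (chartVal_tensor B (trivFunctional μ) _ _ _).trans ?_
  refine (congrArg₂ _ (chartVal_triv B _ _ _) (chartVal_tensor B _ _ _ _)).trans ?_
  rw [chartVal_taut]
  refine (congrArg (fun r => _ * (_ * r)) (chartVal_twist B ω)).trans ?_
  rw [enBasis_apply]
  obtain ⟨s, i, -⟩ := p
  fin_cases i <;> simp [extForm_basis] <;> ring

lemma resForm₃_resFunctional₃ [CharZero k] (μ η η' ω)
    (x : Fin 3 → ⋀[MvPolynomial (Fin 2 × Fin 5) k]^4 (Fin 4 → MvPolynomial (Fin 2 × Fin 5) k)) :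
    resForm₃ B ξ (resFunctional₃ K μ η η' ω) x =
      chartEval B (formElt ω) * (planeVal B η 0 * planeVal B η' 0 * extForm ξ 4 μ (x 0) +
        (planeVal B η 0 * planeVal B η' 1 + planeVal B η' 0 * planeVal B η 1) *
          extForm ξ 4 μ (x 1) +
        planeVal B η 1 * planeVal B η' 1 * extForm ξ 4 μ (x 2)) := by
  suffices resForm₃ B ξ (resFunctional₃ K μ η η' ω) =
    (chartEval B (formElt ω)) •
      ((planeVal B η 0 * planeVal B η' 0) • (extForm ξ 4 μ ∘ₗ .proj 0) +
        (planeVal B η 0 * planeVal B η' 1 + planeVal B η' 0 * planeVal B η 1) •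
          (extForm ξ 4 μ ∘ₗ .proj 1) +
        (planeVal B η 1 * planeVal B η' 1) • (extForm ξ 4 μ ∘ₗ .proj 2)) from
      LinearMap.congr_fun this x
  refine (enBasis (MvPolynomial (Fin 2 × Fin 5) k) 4 (Equiv.prodPUnit (Fin 3))).ext fun p => ?_
  refine (chartForm_basis (N := en3 k) (chart B) (resFrame₃ B ξ)
    (enBasis (MvPolynomial (Fin 2 × Fin 5) k) 4 (Equiv.prodPUnit (Fin 3))) _ p).trans ?_
  refine (chartVal_tensor B (trivFunctional μ) _ _ _).trans ?_
  refine (congrArg₂ _ (chartVal_triv B _ _ _) (chartVal_tensor B _ _ _ _)).trans ?_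
  refine (congrArg (fun r => _ * (_ * r)) (chartVal_twist B ω)).trans ?_
  -- The halves in the divided squares cancel the factor 2 of the symmetrized form, so the frame
  -- matches the divided monomials of `D₂(G*)`.
  have hv : chartVal B (symFunctional (tautFunctional η) (tautFunctional η'))
    (((tautFrame B).sym2 _ (exists_half B).choose_spec).b p.2.1) =
      ![planeVal B η 0 * planeVal B η' 0, planeVal B η 0 * planeVal B η' 1 +
        planeVal B η' 0 * planeVal B η 1, planeVal B η 1 * planeVal B η' 1] p.2.1 := by
    have hs (i : Fin 2) : chartVal B (symFunctional (tautFunctional η) (tautFunctional η'))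
        ((exists_half B).choose • sm ((tautFrame B).b i) ((tautFrame B).b i)) =
        planeVal B η i * planeVal B η' i := by
      have h2 : ((2 : ℕ) : MvPolynomial (Fin 2 × Fin 5) k) ≠ 0 := by simp
      refine mul_left_cancel₀ h2 ?_
      rw [chartVal_smul B _ (e := 2) (by exact_mod_cast (exists_half B).choose_spec), chartVal_sym,
        chartVal_taut, chartVal_taut]
      push_cast
      ring
    obtain ⟨s, i, -⟩ := p
    fin_cases i
    · exact hs 0
    · refine (chartVal_sym B _ _ _ _).trans ?_
      rw [chartVal_taut, chartVal_taut, chartVal_taut, chartVal_taut]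
      rfl
    · exact hs 1
  refine (congrArg (fun r => _ * (r * _)) hv).trans ?_
  rw [enBasis_apply]
  obtain ⟨s, i, -⟩ := p
  fin_cases i <;> simp [extForm_basis] <;> ring

lemma resForm₁_sum {I : Type*} (s : Finset I) (Φ : I → (resTerm1 K ⟶ structureSheafModule (Gr k
    V))) :
    resForm₁ B ξ (∑ i ∈ s, Φ i) = ∑ i ∈ s, resForm₁ B ξ (Φ i) :=
  chartForm_sum _ _ _ _ _

lemma resForm₂_sum {I : Type*} (s : Finset I) (Φ : I → (resTerm2 K ⟶ structureSheafModule (Gr k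
    V))) :
    resForm₂ B ξ (∑ i ∈ s, Φ i) = ∑ i ∈ s, resForm₂ B ξ (Φ i) :=
  chartForm_sum _ _ _ _ _

lemma resForm₃_sum [CharZero k] {I : Type*} (s : Finset I)
    (Φ : I → (resTerm3 K ⟶ structureSheafModule (Gr k V))) :
    resForm₃ B ξ (∑ i ∈ s, Φ i) = ∑ i ∈ s, resForm₃ B ξ (Φ i) :=
  chartForm_sum _ _ _ _ _

/-- The functionals that define the differential `⋀³A ⊗ T(-1) → ⋀²A(-1)`. -/
def diffFunctional₂ (μ : Module.Dual k (⋀[k]^2 K.dualAnnihilator)) (ω : V [⋀^Fin 2]→ₗ[k] k) :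
    resTerm2 K ⟶ structureSheafModule (Gr k V) :=
  ∑ j, resFunctional₂ K (μ ∘ₗ contraction (ξ.coord j) 2) (ξ j : Module.Dual k V) ω

/-- The functionals that define the differential `⋀⁴A ⊗ Sym²T(-1) → ⋀³A ⊗ T(-1)`. -/
def diffFunctional₃ (μ : Module.Dual k (⋀[k]^3 K.dualAnnihilator)) (η : Module.Dual k V)
    (ω : V [⋀^Fin 2]→ₗ[k] k) : resTerm3 K ⟶ structureSheafModule (Gr k V) :=
  ∑ j, resFunctional₃ K (μ ∘ₗ contraction (ξ.coord j) 3) (ξ j : Module.Dual k V) η ω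

/-- The differential `⋀²A(-1) → 𝒪`. -/
def diff₁ : resTerm1 K ⟶ structureSheafModule (Gr k V) :=
  ∑ s : Set.powersetCard (Fin 4) 2, resFunctional₁ K ((ξ.exteriorPower 2).coord s)
    (wedge (ξ (Set.powersetCard.ofFinEmbEquiv.symm s 0) : Module.Dual k V)
      (ξ (Set.powersetCard.ofFinEmbEquiv.symm s 1) : Module.Dual k V))

/-- Composing the local differential with the functional of `(μ, ω)` gives the same expression in
every adapted chart, because the `ξ j` evaluate on the universal plane to the matrix entries. This
is the compatibility that gluing requires. -/
lemma resForm₁_enMap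
    (hB : ∀ l : Fin 4, B.coord (.inr l.castSucc) = (ξ l : Module.Dual k V))
    (μ ω) (x : Fin 2 → ⋀[MvPolynomial (Fin 2 × Fin 5) k]^3 (Fin 4 → MvPolynomial (Fin 2 × Fin 5)
        k)) :
    resForm₁ B ξ (resFunctional₁ K μ ω) (enMap (rowForms (Matrix.of (genRow k))) 2 0 x) =
      resForm₂ B ξ (diffFunctional₂ ξ μ ω) x := by
  rw [diffFunctional₂, resForm₂_sum, LinearMap.sum_apply, resForm₁_resFunctional₁]
  simp only [resForm₂_resFunctional₂, planeVal_basis B ξ hB, ← Finset.mul_sum]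
  congr 1
  refine (map_add _ (contraction (rowForms (Matrix.of (genRow k)) 0) 2 (x 0)) (contraction
      (rowForms (Matrix.of (genRow k)) 1) 2 (x 1))).trans ?_
  rw [extForm_contraction_genRow, extForm_contraction_genRow, ← Finset.sum_add_distrib]

lemma resForm₂_enMap [CharZero k]
    (hB : ∀ l : Fin 4, B.coord (.inr l.castSucc) = (ξ l : Module.Dual k V))
    (μ η ω) (x : Fin 3 → ⋀[MvPolynomial (Fin 2 × Fin 5) k]^4 (Fin 4 → MvPolynomial (Fin 2 × Fin 5)
        k)) :
    resForm₂ B ξ (resFunctional₂ K μ η ω) (enMap (rowForms (Matrix.of (genRow k))) 3 1 x) =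
      resForm₃ B ξ (diffFunctional₃ ξ μ η ω) x := by
  rw [diffFunctional₃, resForm₃_sum, LinearMap.sum_apply, resForm₂_resFunctional₂]
  simp only [resForm₃_resFunctional₃, planeVal_basis B ξ hB, ← Finset.mul_sum]
  congr 1
  have h0 : extForm ξ 3 μ (enMap (rowForms (Matrix.of (genRow k))) 3 1 x 0) = _ :=
    map_add _ (contraction (rowForms (Matrix.of (genRow k)) 0) 3 (x 0)) (contraction (rowForms
        (Matrix.of (genRow k)) 1) 3 (x 1))
  have h1 : extForm ξ 3 μ (enMap (rowForms (Matrix.of (genRow k))) 3 1 x 1) = _ :=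
    map_add _ (contraction (rowForms (Matrix.of (genRow k)) 0) 3 (x 1)) (contraction (rowForms
        (Matrix.of (genRow k)) 1) 3 (x 2))
  rw [h0, h1]
  simp only [extForm_contraction_genRow, ← Finset.sum_add_distrib, Finset.mul_sum]
  refine Finset.sum_congr rfl fun j _ => ?_
  ring

/-- On basis vectors only one summand of `diff₁` survives, and its two-form, a product of two
equations of `K`, restricts to the corresponding minor. -/
lemma resForm₁_diff₁
    (hB : ∀ l : Fin 4, B.coord (.inr l.castSucc) = (ξ l : Module.Dual k V))
    (x : Fin 1 → ⋀[MvPolynomial (Fin 2 × Fin 5) k]^2 (Fin 4 → MvPolynomial (Fin 2 × Fin 5) k)) :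
    resForm₁ B ξ (diff₁ ξ) x = enMinors (rowForms (Matrix.of (genRow k))) x := by
  suffices resForm₁ B ξ (diff₁ ξ) = enMinors (rowForms (Matrix.of (genRow k))) from
      LinearMap.congr_fun this x
  refine (enBasis (MvPolynomial (Fin 2 × Fin 5) k) 2 (Equiv.ofUnique Unit (Fin 1))).ext fun p => ?_
  rw [diff₁, resForm₁_sum, LinearMap.sum_apply, enBasis_apply,
    Subsingleton.elim (Equiv.ofUnique Unit (Fin 1) p.2) 0]
  simp only [resForm₁_resFunctional₁, Pi.single_eq_same, extForm_basis]
  rw [Finset.sum_eq_single p.1]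
  · rw [← hB, ← hB, chartEval_inr_wedge_inr, Module.Basis.coord_apply, Module.Basis.repr_self,
      Finsupp.single_eq_same, map_one (algebraMap k _), mul_one]
    have h : (Pi.single 0 (extBasis (MvPolynomial (Fin 2 × Fin 5) k) 2 p.1) :
        Fin 1 → ⋀[MvPolynomial (Fin 2 × Fin 5) k]^2 (Fin 4 → MvPolynomial (Fin 2 × Fin 5) k)) =
        fun _ => exteriorPower.ιMulti _ 2
          ![Pi.single (Set.powersetCard.ofFinEmbEquiv.symm p.1 0) 1,
            Pi.single (Set.powersetCard.ofFinEmbEquiv.symm p.1 1) 1] := by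
      funext i
      rw [Subsingleton.elim i 0, Pi.single_eq_same, extBasis, exteriorPower.basis_apply]
      refine congrArg (exteriorPower.ιMulti _ 2) (funext fun l => ?_)
      fin_cases l <;> simp
    rw [h]
    refine Eq.trans ?_ (enMinors_ιMulti k _ _).symm
    simp only [minor, genRow]
    ring
  · intro s _ hs
    simp [hs.symm]
  · simp

end ChartForms

/-! ### Dual functionals of the frames -/

section FrameDual

variable {k V : Type u} [Field k] [AddCommGroup V] [Module k V] [Infinite k]
  (B : Module.Basis (Fin 2 ⊕ Fin 5) k V)

lemma trivFrame_dual {W : Type u} [AddCommGroup W] [Module k W] {I : Type*} [Fintype I]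
    [DecidableEq I] (w : Module.Basis I k W) (i : I) :
    (trivFrame B w).dual i = trivFunctional (w.coord i) := rfl

lemma twistFrame_dual (p : Unit) : (twistFrame B).dual p =
    twistFunctional (wedge (B.coord (.inl 0)) (B.coord (.inl 1))) := rfl

lemma tautFrame_dual (i : Fin 2) :
    (tautFrame B).dual i = tautFunctional (B.coord (.inl i)) := rfl

end FrameDual

/-! ### Gluing the Eagon–Northcott differentials -/

section Resolution

variable {k V : Type u} [Field k] [AddCommGroup V] [Module k V] [Infinite k] [IsAlgClosed k]
  {K : Submodule k V}

lemma resFrame₁_dual (ξ : Module.Basis (Fin 4) k K.dualAnnihilator)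
    (B : Module.Basis (Fin 2 ⊕ Fin 5) k V) (p : Set.powersetCard (Fin 4) 2 × Unit) :
    (resFrame₁ B ξ).dual p = resFunctional₁ K ((ξ.exteriorPower 2).coord p.1)
      (wedge (B.coord (.inl 0)) (B.coord (.inl 1))) := by
  dsimp only [resFrame₁, Frame.restrict, Frame.tensor, resFunctional₁]
  rw [trivFrame_dual, twistFrame_dual]

lemma resFrame₂_dual (ξ : Module.Basis (Fin 4) k K.dualAnnihilator)
    (B : Module.Basis (Fin 2 ⊕ Fin 5) k V) (p : Set.powersetCard (Fin 4) 3 × (Fin 2 × Unit)) :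
    (resFrame₂ B ξ).dual p = resFunctional₂ K ((ξ.exteriorPower 3).coord p.1)
      (B.coord (.inl p.2.1)) (wedge (B.coord (.inl 0)) (B.coord (.inl 1))) := by
  dsimp only [resFrame₂, Frame.restrict, Frame.tensor, resFunctional₂]
  rw [trivFrame_dual, tautFrame_dual, twistFrame_dual]

lemma resFrame₁_joint (ξ : Module.Basis (Fin 4) k K.dualAnnihilator)
    (B : Module.Basis (Fin 2 ⊕ Fin 5) k V) (W : (Gr k V).Opens)
    (hW : W ≤ chart B ''ᵁ ⊤) (s : Γ(resTerm1 K, W))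
    (hs : ∀ i : Module.Dual k (⋀[k]^2 K.dualAnnihilator) × (V [⋀^Fin 2]→ₗ[k] k),
      ev (resFunctional₁ K i.1 i.2) W s = 0) : s = 0 :=
  (resFrame₁ B ξ).inj W hW s fun p => by
    rw [resFrame₁_dual]
    exact hs (_, _)

lemma resFrame₂_joint (ξ : Module.Basis (Fin 4) k K.dualAnnihilator)
    (B : Module.Basis (Fin 2 ⊕ Fin 5) k V) (W : (Gr k V).Opens)
    (hW : W ≤ chart B ''ᵁ ⊤) (s : Γ(resTerm2 K, W))
    (hs : ∀ i : Module.Dual k (⋀[k]^3 K.dualAnnihilator) × Module.Dual k V ×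
      (V [⋀^Fin 2]→ₗ[k] k), ev (resFunctional₂ K i.1 i.2.1 i.2.2) W s = 0) : s = 0 :=
  (resFrame₂ B ξ).inj W hW s fun p => by
    rw [resFrame₂_dual]
    exact hs (_, _, _)

/-- On each chart the differential is the Eagon–Northcott one transported along the frame
isomorphisms. Its composites with functionals are `diffFunctional₂` and `diffFunctional₃`, which do
not depend on the chart, so `exists_glued_hom` applies. -/
lemma exists_resolution_maps [CharZero k] (ξ : Module.Basis (Fin 4) k K.dualAnnihilator)
    (B : Gr k V → Module.Basis (Fin 2 ⊕ Fin 5) k V)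
    (hB : ∀ x, ∀ l : Fin 4, (B x).coord (.inr l.castSucc) = (ξ l : Module.Dual k V))
    (hx : ∀ x, x ∈ Set.range (chart (B x))) :
    ∃ (d₃ : resTerm3 K ⟶ resTerm2 K) (d₂ : resTerm2 K ⟶ resTerm1 K)
      (e₃ : ∀ x, (resTerm3 K).restrict (chart (B x)) ≅ tilde (en3 k))
      (e₂ : ∀ x, (resTerm2 K).restrict (chart (B x)) ≅ tilde (en2 k))
      (e₁ : ∀ x, (resTerm1 K).restrict (chart (B x)) ≅ tilde (en1 k)),
      (∀ x, (Scheme.Modules.restrictFunctor (chart (B x))).map d₃ ≫ (e₂ x).hom =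
        (e₃ x).hom ≫ tilde.map (enD3 k)) ∧
      (∀ x, (Scheme.Modules.restrictFunctor (chart (B x))).map d₂ ≫ (e₁ x).hom =
        (e₂ x).hom ≫ tilde.map (enD2 k)) ∧
      ∀ x, (Scheme.Modules.restrictFunctor (chart (B x))).map (diff₁ ξ) ≫
        (restrictStructureSheafIso (chart (B x))).hom =
          (e₁ x).hom ≫ tilde.map (enD1 k) ≫ tildeSelf.hom := by
  choose e₁ he₁ using fun x => exists_chartIso (N := en1 k) (chart (B x)) (resFrame₁ (B x) ξ)
    (enBasis (MvPolynomial (Fin 2 × Fin 5) k) 2 (Equiv.ofUnique Unit (Fin 1)))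
  choose e₂ he₂ using fun x => exists_chartIso (N := en2 k) (chart (B x)) (resFrame₂ (B x) ξ)
    (enBasis (MvPolynomial (Fin 2 × Fin 5) k) 3 (Equiv.prodPUnit (Fin 2)))
  choose e₃ he₃ using fun x => exists_chartIso (N := en3 k) (chart (B x)) (resFrame₃ (B x) ξ)
    (enBasis (MvPolynomial (Fin 2 × Fin 5) k) 4 (Equiv.prodPUnit (Fin 3)))
  obtain ⟨d₂, -, hd₂⟩ := exists_glued_hom
    (fun i : Module.Dual k (⋀[k]^2 K.dualAnnihilator) × (V [⋀^Fin 2]→ₗ[k] k) =>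
      resFunctional₁ K i.1 i.2) (fun i => diffFunctional₂ ξ i.1 i.2) (fun x => chart (B x)) hx
    (fun x => resFrame₁_joint ξ (B x))
    (fun x => (e₂ x).hom ≫ tilde.map (enD2 k) ≫ (e₁ x).inv) fun x i => by
      rw [he₁, he₂, Category.assoc, Category.assoc, Iso.inv_hom_id_assoc, ← tilde.map_comp]
      congr 2
      exact ModuleCat.hom_ext (LinearMap.ext (resForm₁_enMap (B x) ξ (hB x) i.1 i.2))
  obtain ⟨d₃, -, hd₃⟩ := exists_glued_hom
    (fun i : Module.Dual k (⋀[k]^3 K.dualAnnihilator) × Module.Dual k V ×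
      (V [⋀^Fin 2]→ₗ[k] k) => resFunctional₂ K i.1 i.2.1 i.2.2)
    (fun i => diffFunctional₃ ξ i.1 i.2.1 i.2.2) (fun x => chart (B x)) hx
    (fun x => resFrame₂_joint ξ (B x))
    (fun x => (e₃ x).hom ≫ tilde.map (enD3 k) ≫ (e₂ x).inv) fun x i => by
      rw [he₂, he₃, Category.assoc, Category.assoc, Iso.inv_hom_id_assoc, ← tilde.map_comp]
      congr 2
      exact ModuleCat.hom_ext (LinearMap.ext (resForm₂_enMap (B x) ξ (hB x) i.1 i.2.1 i.2.2))
  refine ⟨d₃, d₂, e₃, e₂, e₁, fun x => ?_, fun x => ?_, fun x => ?_⟩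
  · rw [hd₃]
    simp
  · rw [hd₂]
    simp
  · have h := he₁ x (diff₁ ξ)
    have h' : ModuleCat.ofHom (chartForm (N := en1 k) (chart (B x)) (resFrame₁ (B x) ξ)
      (enBasis (MvPolynomial (Fin 2 × Fin 5) k) 2 (Equiv.ofUnique Unit (Fin 1))) (diff₁ ξ)) =
        enD1 k := ModuleCat.hom_ext (LinearMap.ext (resForm₁_diff₁ (B x) ξ (hB x)))
    rw [h'] at h
    exact ((Iso.comp_inv_eq tildeSelf).1 ((Category.assoc _ _ _).trans h)).trans
      (Category.assoc _ _ _)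

end Resolution

/-! ### Closed points of the Schubert locus on a chart -/

section LocusPoints

variable {k V : Type u} [Field k] [AddCommGroup V] [Module k V]

/-- A homogeneous function on the cone of decomposable bivectors, along a plane. -/
lemma toFun_comb [IsAlgClosed k] {n : ℕ} {F : PluckerRing k V} (hF : F ∈ pluckerGrading k V n)
    (p : Fin 2 → V) (g : Fin 2 → Fin 2 → k) :
    F.toFun (fun i => g i 0 • p 0 + g i 1 • p 1) =
      (g 0 0 * g 1 1 - g 0 1 * g 1 0) ^ n * F.toFun p := by
  obtain ⟨d, hd⟩ := IsAlgClosed.exists_pow_nat_eq (g 0 0 * g 1 1 - g 0 1 * g 1 0)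
    (n := 2) (by norm_num)
  rw [← hd, ← pow_mul, ← hF d p]
  refine toFun_eq_of_forms (fun ω => ?_) F
  rw [alternating_comb, ← hd]
  have := ω.toMultilinearMap.map_smul_univ (fun _ => d) p
  simp only [Fin.prod_univ_two, smul_eq_mul] at this
  rw [pow_two]
  exact this.symm

lemma exists_eq_comb_planeBasis (B : Module.Basis (Fin 2 ⊕ Fin 5) k V)
    (a : Fin 2 × Fin 5 → k) {v : Fin 2 → V}
    (hv : ∀ i, v i ∈ Submodule.span k (Set.range (planeBasis B a))) :
    ∃ g : Fin 2 → Fin 2 → k, v = fun i => g i 0 • planeBasis B a 0 + g i 1 • planeBasis B a 1 := by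
  have h (i : Fin 2) : ∃ g : Fin 2 → k, g 0 • planeBasis B a 0 + g 1 • planeBasis B a 1 = v i := by
    obtain ⟨g, hg⟩ := (Submodule.mem_span_range_iff_exists_fun k).1 (hv i)
    exact ⟨g, by rw [← hg, Fin.sum_univ_two]⟩
  choose g hg using h
  exact ⟨g, funext fun i => (hg i).symm⟩

lemma linearIndependent_planeBasis (B : Module.Basis (Fin 2 ⊕ Fin 5) k V)
    (a : Fin 2 × Fin 5 → k) : LinearIndependent k (planeBasis B a) := by
  rw [Fintype.linearIndependent_iff]
  intro g hg i
  have h := congrArg (B.coord (.inl i)) hg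
  rw [map_sum, map_zero] at h
  simpa only [map_smul, coord_inl_planeBasis, smul_eq_mul, mul_ite, mul_one, mul_zero,
    Finset.sum_ite_eq, Finset.mem_univ, if_true] using h

/-- The forms that vanish at a plane, on homogeneous components. -/
lemma forall_toFun_eq_zero_iff [IsAlgClosed k] [Infinite k] (B : Module.Basis (Fin 2 ⊕ Fin 5) k V)
    (a : Fin 2 × Fin 5 → k) (f : PluckerRing k V) :
    (∀ v : Fin 2 → V, (∀ i, v i ∈ Submodule.span k (Set.range (planeBasis B a))) →
      f.toFun v = 0) ↔ ∀ n, (DirectSum.decompose (pluckerGrading k V) f n : PluckerRing k V).toFun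
        (planeBasis B a) = 0 := by
  classical
  have hsum (v : Fin 2 → V) : f.toFun v = ∑ n ∈ (DirectSum.decompose (pluckerGrading k V)
      f).support,
      (DirectSum.decompose (pluckerGrading k V) f n : PluckerRing k V).toFun v := by
    conv_lhs => rw [← DirectSum.sum_support_decompose (pluckerGrading k V) f]
    rw [map_sum, Finset.sum_apply]
  constructor
  · intro h n
    by_cases hn : n ∈ (DirectSum.decompose (pluckerGrading k V) f).support
    -- Along `c • planeBasis B a` the function is a polynomial in `c` whose coefficient of `c ^ (2 *
    -- n)` is the value of the component of degree `n`; it vanishes for all `c`, hence identically.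
    · let P : Polynomial k := ∑ m ∈ (DirectSum.decompose (pluckerGrading k V) f).support,
        Polynomial.monomial (2 * m) ((DirectSum.decompose (pluckerGrading k V) f m :
          PluckerRing k V).toFun (planeBasis B a))
      have hP : P = 0 := by
        refine Polynomial.funext fun c => ?_
        rw [Polynomial.eval_zero, ← h (c • planeBasis B a) fun i =>
          Submodule.smul_mem _ _ (Submodule.subset_span ⟨i, rfl⟩), hsum, Polynomial.eval_finsetSum]
        refine Finset.sum_congr rfl fun m _ => ?_
        rw [Polynomial.eval_monomial,
          (DirectSum.decompose (pluckerGrading k V) f m).2 c (planeBasis B a), mul_comm]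
      have h2 := congrArg (fun p => Polynomial.coeff p (2 * n)) hP
      simp only [P, Polynomial.finsetSum_coeff, Polynomial.coeff_monomial, Polynomial.coeff_zero]
        at h2
      rw [Finset.sum_eq_single n] at h2
      · simpa using h2
      · intro m _ hm
        rw [if_neg]; omega
      · exact fun h => absurd hn h
    · have : DirectSum.decompose (pluckerGrading k V) f n = 0 := by simpa using hn
      rw [this, ZeroMemClass.coe_zero, map_zero, Pi.zero_apply]
  · intro h v hv
    obtain ⟨g, rfl⟩ := exists_eq_comb_planeBasis B a hv
    rw [hsum]
    refine Finset.sum_eq_zero fun n _ => ?_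
    rw [toFun_comb (DirectSum.decompose (pluckerGrading k V) f n).2, h n, mul_zero]

lemma isPoint_chart [IsAlgClosed k] [Infinite k] (B : Module.Basis (Fin 2 ⊕ Fin 5) k V)
    (a : Fin 2 × Fin 5 → k) (y : Spec (ChartRing k))
    (hy : ∀ f, f ∈ y.asIdeal ↔ MvPolynomial.eval a f = 0) :
    Gr.IsPoint (chart B y) (Submodule.span k (Set.range (planeBasis B a))) := by
  refine ⟨?_, fun f => ?_⟩
  · rw [finrank_span_eq_card (linearIndependent_planeBasis B a), Fintype.card_fin]
  · rw [forall_toFun_eq_zero_iff]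
    refine (Ideal.IsHomogeneous.mem_iff (pluckerGrading k V)
      (ProjectiveSpectrum.asHomogeneousIdeal (chart B y)).isHomogeneous).trans
      (forall_congr' fun n => ?_)
    set F := DirectSum.decompose (pluckerGrading k V) f n
    have hx : chartElt B ∉ (chart B y).asHomogeneousIdeal := (mem_range_chart B _).1 ⟨y, rfl⟩
    -- `chart_mem_basicOpen` needs positive degree, so the component is multiplied by the chart
    -- form, which is not in the prime and becomes 1 on the chart.
    have h1 := chart_mem_basicOpen B y (n := 1 + n) (by omega)
      (SetLike.mul_mem_graded (chartElt_mem B) F.2)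
    rw [map_mul, chartEval_chartElt, one_mul] at h1
    have h2 : chartElt B * F ∈ (chart B y).asHomogeneousIdeal ↔
        (F : PluckerRing k V) ∈ (chart B y).asHomogeneousIdeal := by
      have := ProjectiveSpectrum.isPrime (chart B y)
      exact ⟨fun h => (this.mem_or_mem h).resolve_left hx, fun h => Ideal.mul_mem_left _ _ h⟩
    refine (h2.symm.trans h1).trans ((hy _).trans ?_)
    rw [eval_chartEval]

/-- Forms `α ∧ β` with `α`, `β` in the annihilator of `K` vanish on the Schubert locus. -/
lemma wedge_eq_zero_of_inf_ne_bot {K P : Submodule k V} (hP : Module.finrank k P = 2)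
    (hPK : P ⊓ K ≠ ⊥) {α β : Module.Dual k V} (hα : α ∈ K.dualAnnihilator)
    (hβ : β ∈ K.dualAnnihilator) (v : Fin 2 → V) (hv : ∀ i, v i ∈ P) : wedge α β v = 0 := by
  obtain ⟨w, hw, hw0⟩ := Submodule.exists_mem_ne_zero_of_ne_bot hPK
  rw [Submodule.mem_dualAnnihilator] at hα hβ
  by_contra hne
  rw [wedge_apply] at hne
  -- If `α ∧ β` were nonzero at `v`, then `v` would be a basis of `P` on which `α` and `β` have
  -- invertible matrix, while both kill a nonzero vector `w` of `P ⊓ K`.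
  have hli : LinearIndependent k (fun i => (⟨v i, hv i⟩ : P)) := by
    rw [Fintype.linearIndependent_iff]
    intro g hg
    have hg' : g 0 • v 0 + g 1 • v 1 = 0 := by
      have := congrArg P.subtype hg
      simpa [Fin.sum_univ_two] using this
    have h1 := congrArg α hg'
    have h2 := congrArg β hg'
    simp only [map_add, map_smul, smul_eq_mul, map_zero] at h1 h2
    have e0 : g 0 = 0 := (mul_eq_zero.1 (by linear_combination β (v 1) * h1 - α (v 1) * h2 :
      g 0 * (α (v 0) * β (v 1) - α (v 1) * β (v 0)) = 0)).resolve_right hne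
    have e1 : g 1 = 0 := (mul_eq_zero.1 (by linear_combination α (v 0) * h2 - β (v 0) * h1 :
      g 1 * (α (v 0) * β (v 1) - α (v 1) * β (v 0)) = 0)).resolve_right hne
    intro i
    fin_cases i
    · exact e0
    · exact e1
  have hspan := hli.span_eq_top_of_card_eq_finrank (by rw [hP, Fintype.card_fin])
  have hwP : (⟨w, hw.1⟩ : P) ∈ Submodule.span k (Set.range fun i => (⟨v i, hv i⟩ : P)) := by
    rw [hspan]; trivial
  obtain ⟨g, hg⟩ := (Submodule.mem_span_range_iff_exists_fun k).1 hwP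
  have hg' : g 0 • v 0 + g 1 • v 1 = w := by
    have := congrArg P.subtype hg
    simpa [Fin.sum_univ_two] using this
  have h1 := hα w hw.2
  have h2 := hβ w hw.2
  rw [← hg'] at h1 h2
  simp only [map_add, map_smul, smul_eq_mul] at h1 h2
  have e0 : g 0 = 0 := (mul_eq_zero.1 (by linear_combination β (v 1) * h1 - α (v 1) * h2 :
    g 0 * (α (v 0) * β (v 1) - α (v 1) * β (v 0)) = 0)).resolve_right hne
  have e1 : g 1 = 0 := (mul_eq_zero.1 (by linear_combination α (v 0) * h2 - β (v 0) * h1 :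
    g 1 * (α (v 0) * β (v 1) - α (v 1) * β (v 0)) = 0)).resolve_right hne
  exact hw0 (by rw [← hg', e0, e1, zero_smul, zero_smul, add_zero])

/-- A rank one `2 × 4` matrix has a non-trivial relation between its rows. -/
lemma exists_row_relation {x y : Fin 4 → k} (h : ∀ l m, x l * y m = y l * x m) :
    ∃ g : Fin 2 → k, g ≠ 0 ∧ ∀ l, g 0 * x l + g 1 * y l = 0 := by
  by_cases hx : x = 0
  · exact ⟨![1, 0], fun h => one_ne_zero (congrFun h 0), fun l => by simp [hx]⟩
  · obtain ⟨m, hm⟩ := Function.ne_iff.1 hx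
    exact ⟨![y m, - x m], fun h => hm (neg_eq_zero.1 (congrFun h 1)), fun l => by
      have := h m l
      simp only [Matrix.cons_val_zero, Matrix.cons_val_one]
      linear_combination - this⟩

/-- The functions that vanish at the points of the Schubert locus on a chart form the ideal of
minors. -/
lemma forall_chart_mem_schubertLocus_iff [IsAlgClosed k] [Infinite k] {K : Submodule k V}
    (ξ : Module.Basis (Fin 4) k K.dualAnnihilator) (B : Module.Basis (Fin 2 ⊕ Fin 5) k V)
    (hB : ∀ l : Fin 4, B.coord (.inr l.castSucc) = (ξ l : Module.Dual k V)) [FiniteDimensional k V]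
    (f : MvPolynomial (Fin 2 × Fin 5) k) :
    (∀ y : Spec (ChartRing k), chart B y ∈ schubertLocus K → f ∈ y.asIdeal) ↔
      f ∈ minorIdeal k := by
  constructor
  · intro h
    refine mem_minorIdeal k f fun a ha => ?_
    have hprime : (RingHom.ker (MvPolynomial.eval a)).IsPrime := RingHom.ker_isPrime _
    refine h ⟨RingHom.ker (MvPolynomial.eval a), hprime⟩
      ⟨_, isPoint_chart B a ⟨RingHom.ker (MvPolynomial.eval a), hprime⟩ fun g => Iff.rfl, ?_⟩
    -- A relation between the rows gives a nonzero vector of the plane on which all equations of `K`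
    -- vanish.
    obtain ⟨g, hg, hrel⟩ := exists_row_relation ha
    rw [Submodule.ne_bot_iff]
    refine ⟨g 0 • planeBasis B a 0 + g 1 • planeBasis B a 1, ⟨add_mem
      (Submodule.smul_mem _ _ (Submodule.subset_span ⟨0, rfl⟩))
      (Submodule.smul_mem _ _ (Submodule.subset_span ⟨1, rfl⟩)), ?_⟩, fun h0 => hg ?_⟩
    · have hK : K.dualAnnihilator.dualCoannihilator = K :=
        Subspace.dualAnnihilator_dualCoannihilator_eq
      rw [SetLike.mem_coe, ← hK, Submodule.mem_dualCoannihilator]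
      intro φ hφ
      rw [← Subtype.coe_mk φ hφ, ← ξ.sum_repr ⟨φ, hφ⟩]
      rw [Submodule.coe_sum, LinearMap.sum_apply]
      refine Finset.sum_eq_zero fun l _ => ?_
      rw [Submodule.coe_smul, LinearMap.smul_apply, ← hB, map_add, map_smul, map_smul,
        coord_inr_planeBasis, coord_inr_planeBasis, smul_eq_mul (g 0), smul_eq_mul (g 1), hrel,
        smul_zero]
    · refine funext fun i => ?_
      refine Fintype.linearIndependent_iff.1 (linearIndependent_planeBasis B a) g ?_ i
      rw [Fin.sum_univ_two, h0]
  · rintro hf y ⟨P, hP, hPK⟩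
    refine (Ideal.span_le.2 ?_ : minorIdeal k ≤ y.asIdeal) hf
    rintro _ ⟨p, rfl⟩
    have h1 := chart_mem_basicOpen B y one_pos
      (formElt_mem (wedge (B.coord (.inr p.1.castSucc)) (B.coord (.inr p.2.castSucc))))
    have h2 := h1.1 ((hP.2 _).2 fun v hv => by
      rw [formElt_toFun, hB, hB]
      exact wedge_eq_zero_of_inf_ne_bot hP.1 hPK (ξ p.1).2 (ξ p.2).2 v hv)
    rw [chartEval_inr_wedge_inr] at h2
    have h3 : minor (genRow k 0) (genRow k 1) p.1 p.2 = MvPolynomial.X (0, p.1.castSucc) *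
        MvPolynomial.X (1, p.2.castSucc) -
        MvPolynomial.X (1, p.1.castSucc) * MvPolynomial.X (0, p.2.castSucc) := by
      simp only [minor, genRow]
      ring
    exact (congrArg (· ∈ y.asIdeal) h3).mpr h2

lemma range_enMinors : LinearMap.range (enMinors (chartForms k)) = minorIdeal k := by
  refine le_antisymm ?_ (Ideal.span_le.2 ?_)
  · rintro _ ⟨z, rfl⟩
    rw [chartForms, enMinors_rowForms]
    have h (a b : Fin 4) : minor (genRow k 0) (genRow k 1) a b ∈ minorIdeal k :=
      Ideal.subset_span ⟨(a, b), rfl⟩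
    repeat' apply Ideal.add_mem
    all_goals exact Ideal.mul_mem_right _ _ (h _ _)
  · rintro _ ⟨p, rfl⟩
    exact ⟨_, enMinors_ιMulti k p.1 p.2⟩

end LocusPoints

/-! ### The reduced closed subscheme of a set of points -/

section Reduced

variable {X : Scheme.{u}}

/-- On an affine open set the kernel is the vanishing ideal of the closure of `L`. Non-vanishing of
`s` is an open condition, so it may be tested on `L` itself. -/
lemma subschemeι_app_eq_zero_iff (L : Set X) (U : X.affineOpens) (s : Γ(X, U)) :
    (Scheme.IdealSheafData.vanishingIdeal (.closure L)).subschemeι.app U s = 0 ↔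
      ∀ z ∈ L, z ∉ X.basicOpen s := by
  have h1 : (Scheme.IdealSheafData.vanishingIdeal (.closure L)).subschemeι.app U s = 0 ↔
      s ∈ (Scheme.IdealSheafData.vanishingIdeal (.closure L)).ideal U := by
    rw [← Scheme.IdealSheafData.ker_subschemeι_app]
    rfl
  rw [h1, Scheme.IdealSheafData.vanishingIdeal_ideal, PrimeSpectrum.mem_vanishingIdeal]
  have h2 (p : PrimeSpectrum Γ(X, U)) : U.2.fromSpec p ∈ X.basicOpen s ↔ s ∉ p.asIdeal := by
    change p ∈ U.2.fromSpec ⁻¹ᵁ X.basicOpen s ↔ _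
    rw [U.2.fromSpec_preimage_basicOpen]
    rfl
  constructor
  · intro h z hz hzs
    obtain ⟨p, rfl⟩ : z ∈ Set.range U.2.fromSpec := by
      rw [U.2.range_fromSpec]
      exact X.basicOpen_le s hzs
    exact (h2 p).1 hzs (h p (subset_closure hz))
  · intro h p hp
    by_contra hs
    obtain ⟨z, hz, hzL⟩ := mem_closure_iff.1 hp _ (X.basicOpen s).2 ((h2 p).2 hs)
    exact h z hzL hz

lemma epi_toPushforward_subschemeι (I : X.IdealSheafData) : Epi (toPushforward I.subschemeι) := by
  refine epi_of_locally_surjective _ fun U s x hx => ?_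
  obtain ⟨_, ⟨V, hV, rfl⟩, hxV, hVU⟩ := X.isBasis_affineOpens.exists_subset_of_mem_open hx U.2
  obtain ⟨t, ht⟩ := I.subschemeι_app_surjective ⟨V, hV⟩ (res _ hVU s)
  exact ⟨V, hVU, t, hxV, ht⟩

end Reduced

/-! ### Exactness at the structure sheaf -/

section ChartSections
variable {R : CommRingCat.{u}} {X : Scheme.{u}} (j : Spec R ⟶ X) [IsOpenImmersion j]

/-- A function on a basic open set of a chart, as a section of the sheaf associated with the
coordinate ring. -/
def chartSection (W : (Spec R).Opens) (s : Γ(X, j ''ᵁ W)) : Γ(tilde (ModuleCat.of R R), W) :=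
  (j.appIso W).hom s

lemma chartSection_injective (W : (Spec R).Opens) : Function.Injective (chartSection j W) :=
  (j.appIso W).commRingCatIsoToRingEquiv.injective

/-- On `D(a)` the section is the fraction `f / a ^ n`, so it is nonzero at a point exactly when both
`a` and `f` are. -/
lemma basicOpen_eq_of_chartSection (a f : R) (n : ℕ) (s : Γ(X, j ''ᵁ specOpen a))
    (h : a ^ n • chartSection j (specOpen a) s = toTilde (ModuleCat.of R R) (specOpen a) f)
    (y : Spec R) : j y ∈ X.basicOpen s ↔ a * f ∉ y.asIdeal := by
  let ρ (r : R) : Γ(Spec R, (specOpen a)) := (Spec R).presheaf.map (specOpen a).leTop.op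
      ((Scheme.ΓSpecIso R).inv r)
  have hρ (r : R) (y : Spec R) : y ∈ (Spec R).basicOpen (ρ r) ↔ y ∈ specOpen a ∧ r ∉ y.asIdeal := by
    rw [Scheme.basicOpen_res, basicOpen_eq_of_affine]
    rfl
  have hσ : j y ∈ X.basicOpen s ↔ y ∈ (Spec R).basicOpen ((j.appIso (specOpen a)).hom s) := by
    rw [Scheme.Hom.appIso_hom', Scheme.basicOpen_appLE]
    refine ⟨fun h => ⟨?_, h⟩, fun h => h.2⟩
    obtain ⟨y', hy', h'⟩ := X.basicOpen_le s h
    rwa [← j.isOpenEmbedding.injective h']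
  have h' : ρ (a ^ n) * (j.appIso (specOpen a)).hom s = ρ f := h
  have h2 := congrArg (y ∈ (Spec R).basicOpen ·) h'
  have hy : y ∈ specOpen a ↔ a ∉ y.asIdeal := Iff.rfl
  have hpr := y.isPrime
  simp only [Scheme.basicOpen_mul, eq_iff_iff] at h2
  rw [hσ, hpr.mul_mem_iff_mem_or_mem]
  have h3 : y ∈ (Spec R).basicOpen (ρ (a ^ n)) ⊓ (Spec R).basicOpen ((j.appIso (specOpen a)).hom s)
      ↔
      y ∈ (Spec R).basicOpen (ρ (a ^ n)) ∧ y ∈ (Spec R).basicOpen ((j.appIso (specOpen a)).hom s)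
          := Iff.rfl
  rw [h3, hρ, hρ, hy] at h2
  have h4 : y ∈ (Spec R).basicOpen ((j.appIso (specOpen a)).hom s) → a ∉ y.asIdeal := fun h =>
    hy.1 ((Spec R).basicOpen_le _ h)
  have h5 : a ∉ y.asIdeal → a ^ n ∉ y.asIdeal := fun h h' => h (hpr.mem_of_pow_mem n h')
  tauto

lemma chartSection_ev {M : X.Modules} {N : ModuleCat.{u} R} (d : M ⟶ structureSheafModule X)
    (f : N ⟶ ModuleCat.of R R) (e : M.restrict j ≅ tilde N)
    (hd : (Scheme.Modules.restrictFunctor j).map d ≫ (restrictStructureSheafIso j).hom =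
      e.hom ≫ tilde.map f ≫ tildeSelf.hom) (W : (Spec R).Opens) (t : Γ(M, j ''ᵁ W)) :
    chartSection j W (ev d _ t) = (tilde.map f).app W (e.hom.app W t) :=
  congr(Scheme.Modules.Hom.app $hd W t)

lemma subschemeι_app_ev_eq_zero {M : X.Modules} {N : ModuleCat.{u} R}
    (d : M ⟶ structureSheafModule X) (f : N ⟶ ModuleCat.of R R) (e : M.restrict j ≅ tilde N)
    (hd : (Scheme.Modules.restrictFunctor j).map d ≫ (restrictStructureSheafIso j).hom =
      e.hom ≫ tilde.map f ≫ tildeSelf.hom) (L : Set X)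
    (hL : ∀ y, j y ∈ L → ∀ n, f n ∈ y.asIdeal) (a : R) (t : Γ(M, j ''ᵁ specOpen a)) :
    (Scheme.IdealSheafData.vanishingIdeal (.closure L)).subschemeι.app _ (ev d _ t) = 0 := by
  have haff : IsAffineOpen (j ''ᵁ specOpen a) :=
    (IsAffineOpen.Spec_basicOpen a).image_of_isOpenImmersion j
  refine (subschemeι_app_eq_zero_iff L ⟨_, haff⟩ _).2 fun z hz hzs => ?_
  obtain ⟨y, -, rfl⟩ := X.basicOpen_le _ hzs
  obtain ⟨⟨m, ⟨_, n, rfl⟩⟩, hm⟩ := IsLocalizedModule.surj (.powers a) (toTilde N (specOpen a))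
    (e.hom.app (specOpen a) t)
  refine (basicOpen_eq_of_chartSection j a (f m) n _ ?_ y).1 hzs
    (Ideal.mul_mem_left _ _ (hL y hz m))
  rw [chartSection_ev j d f e hd, ← hom_app_smul, ← tildeMap_app_toTilde]
  exact congrArg _ hm

lemma exists_ev_eq_of_subschemeι_app_eq_zero {M : X.Modules} {N : ModuleCat.{u} R}
    (d : M ⟶ structureSheafModule X) (f : N ⟶ ModuleCat.of R R) (e : M.restrict j ≅ tilde N)
    (hd : (Scheme.Modules.restrictFunctor j).map d ≫ (restrictStructureSheafIso j).hom =
      e.hom ≫ tilde.map f ≫ tildeSelf.hom) (L : Set X)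
    (hL : ∀ g : R, (∀ y, j y ∈ L → g ∈ y.asIdeal) → ∃ n, f n = g) (a : R)
    (s : Γ(X, j ''ᵁ specOpen a))
    (hs : (Scheme.IdealSheafData.vanishingIdeal (.closure L)).subschemeι.app _ s = 0) :
    ∃ t, ev d _ t = s := by
  have haff : IsAffineOpen (j ''ᵁ specOpen a) :=
    (IsAffineOpen.Spec_basicOpen a).image_of_isOpenImmersion j
  have hs' := (subschemeι_app_eq_zero_iff L ⟨_, haff⟩ _).1 hs
  have hloc (N' : ModuleCat.{u} R) : IsLocalizedModule (.powers a) (toTilde N' (specOpen a)) :=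
    inferInstance
  have := hloc (ModuleCat.of R R)
  obtain ⟨⟨g, ⟨_, n, rfl⟩⟩, hg⟩ := IsLocalizedModule.surj (.powers a)
    (toTilde (ModuleCat.of R R) (specOpen a)) (chartSection j (specOpen a) s)
  -- The numerator `g` is known to vanish only at points of `L` inside `D(a)`; the factor `a`
  -- handles the others and is compensated by the exponent `n + 1` below.
  obtain ⟨m, hm⟩ := hL (a * g) fun y hy => by
    by_contra h
    exact hs' _ hy ((basicOpen_eq_of_chartSection j a g n s hg y).2 h)
  let w := IsLocalizedModule.mk' (toTilde N (specOpen a)) m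
    (⟨a ^ (n + 1), n + 1, rfl⟩ : Submonoid.powers a)
  have hw : a ^ (n + 1) • w = toTilde N (specOpen a) m :=
    IsLocalizedModule.mk'_cancel' (toTilde N (specOpen a)) m
      (⟨a ^ (n + 1), n + 1, rfl⟩ : Submonoid.powers a)
  refine ⟨e.inv.app (specOpen a) w, chartSection_injective j _ ?_⟩
  have h1 : e.hom.app (specOpen a) (e.inv.app (specOpen a) w) = w :=
    congr(Scheme.Modules.Hom.app $(e.inv_hom_id) (specOpen a) w)
  have h2 : a ^ (n + 1) • (tilde.map f).app (specOpen a) w =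
      a ^ (n + 1) • chartSection j (specOpen a) s := by
    rw [← hom_app_smul, hw, tildeMap_app_toTilde, hm, pow_succ', mul_smul]
    exact (map_smul _ a g).trans (congrArg (a • ·) hg.symm)
  exact ((chartSection_ev j d f e hd _ _).trans (congrArg _ h1)).trans
    (IsLocalizedModule.smul_injective (toTilde (ModuleCat.of R R) (specOpen a))
      (⟨a ^ (n + 1), n + 1, rfl⟩ : Submonoid.powers a) h2)

/-- A resolution of the structure sheaf of a reduced closed subscheme may be checked on charts, at
the last two terms. -/
lemma exact_toPushforward_of_charts {M : X.Modules} {N : ModuleCat.{u} R}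
    (d : M ⟶ structureSheafModule X) (f : N ⟶ ModuleCat.of R R) (j : X → (Spec R ⟶ X))
    [∀ x, IsOpenImmersion (j x)] (hj : ∀ x, x ∈ Set.range (j x))
    (e : ∀ x, M.restrict (j x) ≅ tilde N)
    (hd : ∀ x, (Scheme.Modules.restrictFunctor (j x)).map d ≫
      (restrictStructureSheafIso (j x)).hom = (e x).hom ≫ tilde.map f ≫ tildeSelf.hom) (L : Set X)
    (hL : ∀ x, ∀ g : R, (∀ y, j x y ∈ L → g ∈ y.asIdeal) ↔ ∃ n, f n = g) :
    ∃ h : d ≫ toPushforward (Scheme.IdealSheafData.vanishingIdeal (.closure L)).subschemeι = 0,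
      (ShortComplex.mk d (toPushforward
        (Scheme.IdealSheafData.vanishingIdeal (.closure L)).subschemeι) h).Exact := by
  have h : d ≫ toPushforward
      (Scheme.IdealSheafData.vanishingIdeal (.closure L)).subschemeι = 0 := by
    ext U t
    refine eq_of_locally_eq fun x hx => ?_
    obtain ⟨a, haU, hxa⟩ := exists_chart_basicOpen (j x) (hj x) hx
    refine ⟨_, haU, hxa, ?_⟩
    rw [← app_res, ← app_res]
    exact subschemeι_app_ev_eq_zero (j x) d f (e x) (hd x) L
      (fun y hy n => (hL x (f n)).2 ⟨n, rfl⟩ y hy) a (res M haU t)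
  refine ⟨h, exact_of_locally_exact _ fun U s hs x hx => ?_⟩
  obtain ⟨a, haU, hxa⟩ := exists_chart_basicOpen (j x) (hj x) hx
  obtain ⟨t, ht⟩ := exists_ev_eq_of_subschemeι_app_eq_zero (j x) d f (e x) (hd x) L
    (fun g => (hL x g).1) a (res (structureSheafModule X) haU s) (by
      refine (app_res (toPushforward
        (Scheme.IdealSheafData.vanishingIdeal (.closure L)).subschemeι) haU s).trans ?_
      exact (congrArg _ hs).trans (map_zero _))
  exact ⟨_, haU, t, hxa, ht⟩

end ChartSections

/-! ### Composites checked on charts and bases adapted to `K` -/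

section Final

lemma comp_eq_zero_of_charts {R : CommRingCat.{u}} {X : Scheme.{u}} {M₁ M₂ M₃ : X.Modules}
    (d : M₁ ⟶ M₂) (d' : M₂ ⟶ M₃) (j : X → (Spec R ⟶ X))
    [∀ x, IsOpenImmersion (j x)] (hj : ∀ x, x ∈ Set.range (j x)) {N₁ N₂ N₃ : ModuleCat.{u} R}
    (f : N₁ ⟶ N₂) (g : N₂ ⟶ N₃) (h : f ≫ g = 0)
    (e₁ : ∀ x, M₁.restrict (j x) ≅ tilde N₁) (e₂ : ∀ x, M₂.restrict (j x) ≅ tilde N₂)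
    (e₃ : ∀ x, M₃.restrict (j x) ≅ tilde N₃)
    (hf : ∀ x, (Scheme.Modules.restrictFunctor (j x)).map d ≫ (e₂ x).hom =
      (e₁ x).hom ≫ tilde.map f)
    (hg : ∀ x, (Scheme.Modules.restrictFunctor (j x)).map d' ≫ (e₃ x).hom =
      (e₂ x).hom ≫ tilde.map g) : d ≫ d' = 0 := by
  ext U s
  refine eq_of_locally_eq fun x hx => ?_
  obtain ⟨a, haU, hxa⟩ := exists_chart_basicOpen (j x) (hj x) hx
  refine ⟨_, haU, hxa, ?_⟩
  rw [← app_res, ← app_res]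
  have h1 : (Scheme.Modules.restrictFunctor (j x)).map (d ≫ d') = 0 := by
    rw [← cancel_mono (e₃ x).hom, Functor.map_comp, Category.assoc, hg, ← Category.assoc, hf,
      Category.assoc, ← tilde.map_comp, h, tilde.map_zero, Limits.comp_zero, Limits.zero_comp]
  exact congr(Scheme.Modules.Hom.app $h1 (specOpen a) (res M₁ haU s))

variable {k V : Type u} [Field k] [AddCommGroup V] [Module k V]

/-- A basis adapted to a subspace. -/
lemma exists_basis_coord_mem_dualAnnihilator (hV : Module.finrank k V = 7) (K : Submodule k V)
    (hK : Module.finrank k K = 3) : ∃ C : Module.Basis (Fin 3 ⊕ Fin 4) k V,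
      ∀ l, C.coord (.inr l) ∈ K.dualAnnihilator := by
  have hfin : FiniteDimensional k V := .of_finrank_pos (by omega)
  obtain ⟨L, hL⟩ := K.exists_isCompl
  have h1 := Submodule.finrank_add_eq_of_isCompl hL
  refine ⟨((Module.finBasisOfFinrankEq k K hK).prod
    (Module.finBasisOfFinrankEq k L (by omega : Module.finrank k L = 4))).map
      (K.prodEquivOfIsCompl L hL), fun l => ?_⟩
  rw [Submodule.mem_dualAnnihilator]
  intro w hw
  have : (K.prodEquivOfIsCompl L hL).symm w = (⟨w, hw⟩, 0) :=
    Submodule.prodEquivOfIsCompl_symm_apply_left K L hL ⟨w, hw⟩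
  simp [this]

lemma exists_submodule_basis {W : Type*} [AddCommGroup W] [Module k W] (A : Submodule k W) {n : ℕ}
    (hn : Module.finrank k A = n + 1) (v : Fin (n + 1) → W) (hv : ∀ l, v l ∈ A)
    (hli : LinearIndependent k v) : ∃ ξ : Module.Basis (Fin (n + 1)) k A, ∀ l, v l = ξ l := by
  have h : LinearIndependent k fun l => (⟨v l, hv l⟩ : A) := .of_comp A.subtype hli
  exact ⟨basisOfLinearIndependentOfCardEqFinrank h (by rw [hn, Fintype.card_fin]), fun l => by
    rw [coe_basisOfLinearIndependentOfCardEqFinrank]⟩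

/-- A basis of the annihilator of a subspace, as a part of a dual basis. -/
lemma exists_annihilator_basis (hV : Module.finrank k V = 7) (K : Submodule k V)
    (hK : Module.finrank k K = 3) : ∃ (C : Module.Basis (Fin 3 ⊕ Fin 4) k V)
      (ξ : Module.Basis (Fin 4) k K.dualAnnihilator),
      ∀ l, C.coord (.inr l) = (ξ l : Module.Dual k V) := by
  have hfin : FiniteDimensional k V := .of_finrank_pos (by omega)
  obtain ⟨C, hC⟩ := exists_basis_coord_mem_dualAnnihilator hV K hK
  have h2 : Module.finrank k K.dualAnnihilator = 3 + 1 := by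
    have := Subspace.finrank_add_finrank_dualAnnihilator_eq K
    omega
  have h3 := C.dualBasis.linearIndependent
  rw [C.coe_dualBasis] at h3
  obtain ⟨ξ, hξ⟩ := exists_submodule_basis K.dualAnnihilator h2 _ hC
    (h3.comp (Sum.inr : Fin 4 → _) Sum.inr_injective)
  exact ⟨C, ξ, hξ⟩

end Final

end SchubertRes

end

theorem mainTheorem7 {k V : Type u} [Field k] [IsAlgClosed k] [CharZero k] [AddCommGroup V]
    [Module k V] (hV : Module.finrank k V = 7) (K : Submodule k V)
    (hK : Module.finrank k K = 3) :
    ∃ (d₃ : resTerm3 K ⟶ resTerm2 K) (d₂ : resTerm2 K ⟶ resTerm1 K)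
      (d₁ : resTerm1 K ⟶ structureSheafModule (Gr k V))
      (h₃₂ : d₃ ≫ d₂ = 0) (h₂₁ : d₂ ≫ d₁ = 0) (h₁₀ : d₁ ≫ toPushforward (schubertι K) = 0),
      Mono d₃ ∧ (ShortComplex.mk d₃ d₂ h₃₂).Exact ∧ (ShortComplex.mk d₂ d₁ h₂₁).Exact ∧
      (ShortComplex.mk d₁ (toPushforward (schubertι K)) h₁₀).Exact ∧
      Epi (toPushforward (schubertι K)) ∧
      ∀ x : Gr k V, ∃ (j : Spec (ChartRing k) ⟶ Gr k V) (_ : IsOpenImmersion j),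
        x ∈ Set.range j ∧
        j ≫ Gr.toSpec k V = Spec.map (CommRingCat.ofHom MvPolynomial.C) ∧
        ∃ (e₃ : (resTerm3 K).restrict j ≅ tilde (en3 k))
          (e₂ : (resTerm2 K).restrict j ≅ tilde (en2 k))
          (e₁ : (resTerm1 K).restrict j ≅ tilde (en1 k)),
          (Scheme.Modules.restrictFunctor j).map d₃ ≫ e₂.hom = e₃.hom ≫ tilde.map (enD3 k) ∧
          (Scheme.Modules.restrictFunctor j).map d₂ ≫ e₁.hom = e₂.hom ≫ tilde.map (enD2 k) ∧
          (Scheme.Modules.restrictFunctor j).map d₁ ≫ (restrictStructureSheafIso j).hom =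
            e₁.hom ≫ tilde.map (enD1 k) ≫ tildeSelf.hom := by
  have hfin : FiniteDimensional k V := .of_finrank_pos (by omega)
  obtain ⟨C, ξ, hξ⟩ := exists_annihilator_basis hV K hK
  choose B hBC hB0 using fun x : Gr k V => exists_chart_basis C x
  have hB (x : Gr k V) (l : Fin 4) : (B x).coord (.inr l.castSucc) = (ξ l : Module.Dual k V) :=
    (hBC x l).trans (hξ l)
  have hx (x : Gr k V) : x ∈ Set.range (chart (B x)) := (mem_range_chart (B x) x).2 (hB0 x)
  obtain ⟨d₃, d₂, e₃, e₂, e₁, h₃, h₂, h₁⟩ := exists_resolution_maps ξ B hB hx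
  let e₀ (x : Gr k V) : (structureSheafModule (Gr k V)).restrict (chart (B x)) ≅
      tilde (ModuleCat.of (ChartRing k) (ChartRing k)) :=
    restrictStructureSheafIso (chart (B x)) ≪≫ tildeSelf.symm
  have h₁' (x : Gr k V) : (Scheme.Modules.restrictFunctor (chart (B x))).map (diff₁ ξ) ≫
      (e₀ x).hom = (e₁ x).hom ≫ tilde.map (enD1 k) := by
    refine (Category.assoc _ _ _).symm.trans ((congrArg (· ≫ tildeSelf.inv) (h₁ x)).trans ?_)
    exact (Iso.comp_inv_eq tildeSelf).2 (Category.assoc _ _ _).symm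
  have h₃₂ : d₃ ≫ d₂ = 0 := comp_eq_zero_of_charts d₃ d₂ (fun x => chart (B x)) hx _ _
    (ModuleCat.hom_ext (enMap_enMap (chartForms k) 2 0)) e₃ e₂ e₁ h₃ h₂
  have h₂₁ : d₂ ≫ diff₁ ξ = 0 := comp_eq_zero_of_charts d₂ (diff₁ ξ) (fun x => chart (B x)) hx _ _
    (ModuleCat.hom_ext (enMinors_enMap (chartForms k))) e₂ e₁ e₀ h₂ h₁'
  -- On each chart the functions vanishing on the Schubert locus form the ideal of minors, which is
  -- the image of the last Eagon–Northcott map.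
  have hL (x : Gr k V) (g : ChartRing k) : (∀ y, chart (B x) y ∈ schubertLocus K →
      g ∈ y.asIdeal) ↔ ∃ n, enD1 k n = g :=
    (forall_chart_mem_schubertLocus_iff ξ (B x) (hB x) g).trans
      (iff_of_eq (congrArg (g ∈ ·) (range_enMinors (k := k)).symm))
  obtain ⟨h₁₀, hex⟩ := exact_toPushforward_of_charts (diff₁ ξ) (enD1 k) (fun x => chart (B x)) hx
    e₁ h₁ (schubertLocus K) hL
  refine ⟨d₃, d₂, diff₁ ξ, h₃₂, h₂₁, h₁₀, ?_, ?_, ?_, hex, epi_toPushforward_subschemeι _,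
    fun x => ⟨chart (B x), inferInstance, hx x, chart_toSpec (B x), e₃ x, e₂ x, e₁ x, h₃ x, h₂ x,
      h₁ x⟩⟩
  · exact mono_of_charts d₃ (fun x => chart (B x)) hx _ (enMap_three_injective k) e₃ e₂ h₃
  · exact exact_of_charts (ShortComplex.mk d₃ d₂ h₃₂) (fun x => chart (B x)) hx (enD3 k) (enD2 k)
      (fun z => ⟨exists_enMap_three_eq k z, fun ⟨w, hw⟩ => hw ▸
        LinearMap.congr_fun (enMap_enMap (chartForms k) 2 0) w⟩) e₃ e₂ e₁ h₃ h₂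
  · exact exact_of_charts (ShortComplex.mk d₂ (diff₁ ξ) h₂₁) (fun x => chart (B x)) hx (enD2 k)
      (enD1 k) (fun z => ⟨exists_enMap_two_eq k z, fun ⟨w, hw⟩ => hw ▸
        LinearMap.congr_fun (enMinors_enMap (chartForms k)) w⟩) e₂ e₁ e₀ h₂ h₁'
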